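/- Let $\mathcal C$ be a braided monoidal category with braiding $\Psi$. "Hopf algebra" means Hopf algebra with invertible antipode in a braided monoidal category; identities on objects are written as the object, and associators are suppressed except where stated. Crossed modules. For a Hopf algebra $H$ in $\mathcal C$, with multiplication $\mu$, unit $\eta$, comultiplication $\Delta$, counit $\varepsilon$ and antipode $S$, a (right) crossed module over $H$ is an object $X$ with a right $H$-module structure $\mu_r:X\otimes H\to X$ and a right $H$-comodule structure $\Delta_r:X\to X\otimes H$ such that $$(X\otimes\mu)(\Psi_{H,X}\otimes H)(H\otimes\Delta_r)(H\otimes\mu_r)(\Psi_{X,H}\otimes H)(X\otimes\Delta)=(\mu_r\otimes\mu)(X\otimes\Psi_{H,H}\otimes H)(\Delta_r\otimes\Delta)$$ as morphisms $X\otimes H\to X\otimes H$. With morphisms that are both module and comodule morphisms, with the (co)diagonal action and coaction on tensor products (formed with $\Psi$), and with the trivial action and coaction on the unit object, crossed modules form a monoidal category $\mathcal C^H_H$. It is braided by $$(Y\otimes\mu_r^X)(\Psi_{X,Y}\otimes H)(X\otimes\Delta_r^Y):X\otimes Y\to Y\otimes X .$$ Cross products. Let $A$ be a Hopf algebra in $\mathcal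 C$ and $B$ a Hopf algebra in $\mathcal C^A_A$ with action $\mu_r^B$ and coaction $\Delta_r^B$ of $A$. Put $$\Phi=(A\otimes\mu_r^B)(\Psi_{B,A}\otimes A)(B\otimes\Delta_A):B\otimes A\to A\otimes B,\qquad \Theta=(B\otimes\mu_A)(\Psi_{A,B}\otimes A)(A\otimes\Delta_r^B):A\otimes B\to B\otimes A .$$ The cross product $A\ltimes B$ is the object $A\otimes B$ of $\mathcal C$ with unit $\eta_A\otimes\eta_B$, counit $\varepsilon_A\otimes\varepsilon_B$, multiplication $(\mu_A\otimes\mu_B)(A\otimes\Phi\otimes B)$, comultiplication $(A\otimes\Theta\otimes B)(\Delta_A\otimes\Delta_B)$ and antipode $\Phi\,(S_B\otimes S_A)\,\Theta$. Proposition (transitivity of cross product). Let $A$ be a Hopf algebra in $\mathcal C$ and $B$ a Hopf algebra in $\mathcal C^A_A$. Then: (0) $A\ltimes B$ is a Hopf algebra in $\mathcal C$ (with invertible antipode). (1) Say that a Hopf algebra $C'$ in $\mathcal C^{A\ltimes B}_{A\ltimes B}$ and a Hopf algebra $C$ in $(\mathcal C^A_A)^B_B$ are the same if they have the same underlying object of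 $\mathcal C$, the action of $A\ltimes B$ on it is $C\otimes A\otimes B\to C\otimes B\to C$ (first the action of $A$, then that of $B$), the coaction of $A\ltimes B$ on it is $C\to C\otimes B\to C\otimes A\otimes B$ (first the coaction of $B$, then that of $A$ on the factor $C$), and the unit, multiplication, counit, comultiplication and antipode of $C'$ and of $C$ are the same morphisms of $\mathcal C$. For every Hopf algebra $C$ in $(\mathcal C^A_A)^B_B$ there is exactly one Hopf algebra $C'$ in $\mathcal C^{A\ltimes B}_{A\ltimes B}$ that is the same as $C$, and for every $C'$ there is exactly one such $C$. (2) Whenever $C'$ and $C$ are the same, $(A\ltimes B)\ltimes C'$ is a Hopf algebra in $\mathcal C$, $B\ltimes C$ is a Hopf algebra in $\mathcal C^A_A$, $A\ltimes(B\ltimes C)$ is a Hopf algebra in $\mathcal C$, all with invertible antipodes, and the Hopf algebras $(A\ltimes B)\ltimes C'$ and $A\ltimes(B\ltimes C)$ coincide: the associator $(A\otimes B)\otimes C\to A\otimes(B\otimes C)$ carries the unit, multiplication, counit, comultiplication and antipode of the first to those of the second. -/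

import Mathlib

open CategoryTheory MonoidalCategory BraidedCategory
open scoped MonObj ComonObj HopfObj

universe v u

namespace CrossProd

/-! ### Actions, coactions and the braiding of crossed modules -/

section Raw

variable {𝒞 : Type u} [Category.{v} 𝒞] [MonoidalCategory 𝒞] [BraidedCategory 𝒞] {H X Y Z : 𝒞}

/-- The diagonal action on a tensor product. -/
def tensorAct [ComonObj H] (a : X ⊗ H ⟶ X) (b : Y ⊗ H ⟶ Y) : (X ⊗ Y) ⊗ H ⟶ X ⊗ Y :=
  (X ⊗ Y) ◁ Δ[H] ≫ tensorμ X Y H H ≫ (a ⊗ₘ b)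

/-- The codiagonal coaction on a tensor product. -/
def tensorCoact [MonObj H] (c : X ⟶ X ⊗ H) (d : Y ⟶ Y ⊗ H) : X ⊗ Y ⟶ (X ⊗ Y) ⊗ H :=
  (c ⊗ₘ d) ≫ tensorμ X H Y H ≫ (X ⊗ Y) ◁ μ[H]

/-- The morphism `x ⊗ y ↦ y₀ ⊗ x ◁ y₁` given by an action `a` on `X` and a coaction `c` on `Y`. -/
def psi (a : X ⊗ H ⟶ X) (c : Y ⟶ Y ⊗ H) : X ⊗ Y ⟶ Y ⊗ X :=
  X ◁ c ≫ (α_ X Y H).inv ≫ (β_ X Y).hom ▷ H ≫ (α_ Y X H).hom ≫ Y ◁ a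

theorem tensorAct_one [BimonObj H] (a : X ⊗ H ⟶ X) (b : Y ⊗ H ⟶ Y)
    (ha : X ◁ η[H] ≫ a = (ρ_ X).hom) (hb : Y ◁ η[H] ≫ b = (ρ_ Y).hom) :
    (X ⊗ Y) ◁ η[H] ≫ tensorAct a b = (ρ_ (X ⊗ Y)).hom := by
  unfold tensorAct
  have h : η[H] ≫ Δ[H] = (λ_ (𝟙_ 𝒞)).inv ≫ (η[H] ⊗ₘ η[H]) := by
    simp [MonObj.tensorObj.one_def]
  rw [← whiskerLeft_comp_assoc, h, whiskerLeft_comp, Category.assoc, tensorμ_natural_right_assoc,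
    tensorHom_comp_tensorHom, ha, hb, tensor_right_unitality]

theorem tensorAct_mul [BimonObj H] (a : X ⊗ H ⟶ X) (b : Y ⊗ H ⟶ Y)
    (ha : a ▷ H ≫ a = (α_ X H H).hom ≫ X ◁ μ[H] ≫ a)
    (hb : b ▷ H ≫ b = (α_ Y H H).hom ≫ Y ◁ μ[H] ≫ b) :
    tensorAct a b ▷ H ≫ tensorAct a b =
      (α_ (X ⊗ Y) H H).hom ≫ (X ⊗ Y) ◁ μ[H] ≫ tensorAct a b := by
  unfold tensorAct
  rw [← whiskerLeft_comp_assoc, BimonObj.mul_comul]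
  simp only [comp_whiskerRight, Category.assoc, whiskerLeft_comp]
  rw [← whisker_exchange_assoc, tensorμ_natural_left_assoc, tensorHom_comp_tensorHom, ha, hb,
    ← tensorHom_comp_tensorHom, ← whisker_exchange_assoc, tensor_associativity_assoc,
    tensorμ_natural_right_assoc, tensorHom_comp_tensorHom, MonoidalCategory.tensorHom_def (Δ[H])]
  simp

theorem tensorCoact_counit [BimonObj H] (c : X ⟶ X ⊗ H) (d : Y ⟶ Y ⊗ H)
    (hc : c ≫ X ◁ ε[H] = (ρ_ X).inv) (hd : d ≫ Y ◁ ε[H] = (ρ_ Y).inv) :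
    tensorCoact c d ≫ (X ⊗ Y) ◁ ε[H] = (ρ_ (X ⊗ Y)).inv := by
  unfold tensorCoact
  have h : μ[H] ≫ ε[H] = (ε[H] ⊗ₘ ε[H]) ≫ (λ_ (𝟙_ 𝒞)).hom := by
    simp
  rw [Category.assoc, Category.assoc, ← whiskerLeft_comp, h, whiskerLeft_comp, ← id_tensorHom, ← id_tensorHom_id,
    ← tensorμ_natural_assoc, tensorHom_comp_tensorHom_assoc, id_tensorHom, id_tensorHom, hc, hd]
  simp [tensorμ]
  monoidal

theorem tensorCoact_coassoc [BimonObj H] (c : X ⟶ X ⊗ H) (d : Y ⟶ Y ⊗ H)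
    (hc : c ≫ X ◁ Δ[H] = c ≫ c ▷ H ≫ (α_ X H H).hom)
    (hd : d ≫ Y ◁ Δ[H] = d ≫ d ▷ H ≫ (α_ Y H H).hom) :
    tensorCoact c d ≫ (X ⊗ Y) ◁ Δ[H] =
      tensorCoact c d ≫ tensorCoact c d ▷ H ≫ (α_ (X ⊗ Y) H H).hom := by
  unfold tensorCoact
  simp only [Category.assoc]
  rw [← whiskerLeft_comp, BimonObj.mul_comul]
  simp only [comp_whiskerRight, Category.assoc, whiskerLeft_comp]
  rw [← id_tensorHom (X ⊗ Y) (Δ[H] ⊗ₘ Δ[H]), ← id_tensorHom_id,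
    ← tensorμ_natural_assoc, tensorHom_comp_tensorHom_assoc, id_tensorHom, id_tensorHom, hc, hd,
    ← Category.assoc c, ← Category.assoc d, ← tensorHom_comp_tensorHom_assoc,
    ← associator_monoidal_assoc, ← tensorHom_comp_tensorHom_assoc, ← tensorHom_id,
    ← tensorHom_id, tensorμ_natural_assoc, id_tensorHom_id, tensorHom_id, whisker_exchange_assoc,
    whisker_exchange_assoc]
  simp [MonoidalCategory.tensorHom_def' μ[H]]

theorem psi_naturality_left {X' : 𝒞} (a : X ⊗ H ⟶ X) (a' : X' ⊗ H ⟶ X') (c : Y ⟶ Y ⊗ H)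
    (f : X ⟶ X') (hf : a ≫ f = f ▷ H ≫ a') :
    psi a c ≫ Y ◁ f = f ▷ Y ≫ psi a' c := by
  simp only [psi, Category.assoc, ← whiskerLeft_comp, hf]
  rw [← whisker_exchange_assoc, associator_inv_naturality_left_assoc, ← comp_whiskerRight_assoc (f ▷ Y),
    braiding_naturality_left]
  simp

theorem psi_naturality_right {Y' : 𝒞} (a : X ⊗ H ⟶ X) (c : Y ⟶ Y ⊗ H) (c' : Y' ⟶ Y' ⊗ H)
    (g : Y ⟶ Y') (hg : c ≫ g ▷ H = g ≫ c') :
    psi a c ≫ g ▷ X = X ◁ g ≫ psi a c' := by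
  simp only [psi, Category.assoc]
  rw [← whiskerLeft_comp_assoc, ← hg, whiskerLeft_comp_assoc, associator_inv_naturality_middle_assoc,
    ← comp_whiskerRight_assoc, braiding_naturality_right, whisker_exchange]
  simp

theorem psi_tensor_left [ComonObj H] (a : X ⊗ H ⟶ X) (b : Y ⊗ H ⟶ Y) (c : Z ⟶ Z ⊗ H)
    (hc : c ≫ Z ◁ Δ[H] = c ≫ c ▷ H ≫ (α_ Z H H).hom) :
    psi (tensorAct a b) c =
      (α_ X Y Z).hom ≫ X ◁ psi b c ≫ (α_ X Z Y).inv ≫ psi a c ▷ Y ≫ (α_ Z X Y).hom := by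
  unfold psi tensorAct tensorμ
  calc
    _ = 𝟙 _ ⊗≫ X ◁ Y ◁ c ⊗≫ ((β_ (X ⊗ Y) Z).hom ▷ H ≫ (Z ⊗ X ⊗ Y) ◁ Δ[H]) ⊗≫
          Z ◁ X ◁ (β_ Y H).hom ▷ H ⊗≫ Z ◁ (a ⊗ₘ b) := by monoidal
    _ = 𝟙 _ ⊗≫ X ◁ Y ◁ (c ≫ Z ◁ Δ[H]) ⊗≫ (β_ (X ⊗ Y) Z).hom ▷ (H ⊗ H) ⊗≫
          Z ◁ X ◁ (β_ Y H).hom ▷ H ⊗≫ Z ◁ (a ▷ (Y ⊗ H) ≫ X ◁ b) := by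
            rw [← whisker_exchange (β_ (X ⊗ Y) Z).hom Δ[H], MonoidalCategory.tensorHom_def]; monoidal
    _ = 𝟙 _ ⊗≫ X ◁ Y ◁ c ⊗≫ X ◁ Y ◁ c ▷ H ⊗≫ X ◁ (β_ Y Z).hom ▷ (H ⊗ H) ⊗≫
          ((β_ X Z).hom ▷ (Y ⊗ H) ≫ (Z ⊗ X) ◁ (β_ Y H).hom) ▷ H ⊗≫
          Z ◁ (a ▷ (Y ⊗ H) ≫ X ◁ b) := by
            rw [hc, braiding_tensor_left_hom]; monoidal
    _ = 𝟙 _ ⊗≫ X ◁ Y ◁ c ⊗≫ X ◁ (Y ◁ c ≫ (β_ Y (Z ⊗ H)).hom) ▷ H ⊗≫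
          (β_ X Z).hom ▷ (H ⊗ Y ⊗ H) ⊗≫
          Z ◁ (a ▷ (Y ⊗ H) ≫ X ◁ b) := by
            rw [← whisker_exchange, braiding_tensor_right_hom]; monoidal
    _ = 𝟙 _ ⊗≫ X ◁ Y ◁ c ⊗≫ X ◁ (β_ Y Z).hom ▷ H ⊗≫
          (psi a c ▷ (Y ⊗ H) ≫ (Z ⊗ X) ◁ b) ⊗≫ 𝟙 _ := by
            rw [braiding_naturality_right, psi]; monoidal
    _ = _ := by rw [← whisker_exchange, psi]; monoidal

theorem psi_tensor_right [MonObj H] (a : X ⊗ H ⟶ X) (c : Y ⟶ Y ⊗ H) (d : Z ⟶ Z ⊗ H)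
    (ha : a ▷ H ≫ a = (α_ X H H).hom ≫ X ◁ μ[H] ≫ a) :
    psi a (tensorCoact c d) =
      (α_ X Y Z).inv ≫ psi a c ▷ Z ≫ (α_ Y X Z).hom ≫ Y ◁ psi a d ≫ (α_ Y Z X).inv := by
  unfold psi tensorCoact tensorμ
  calc
    _ = 𝟙 _ ⊗≫ X ◁ (c ⊗ₘ d) ⊗≫ X ◁ Y ◁ (β_ H Z).hom ▷ H ⊗≫
          ((X ⊗ Y ⊗ Z) ◁ μ[H] ≫ (β_ X (Y ⊗ Z)).hom ▷ H) ⊗≫ Y ◁ Z ◁ a ⊗≫ 𝟙 _ := by monoidal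
    _ = 𝟙 _ ⊗≫ X ◁ (c ⊗ₘ d) ⊗≫ X ◁ Y ◁ (β_ H Z).hom ▷ H ⊗≫
          (β_ X (Y ⊗ Z)).hom ▷ (H ⊗ H) ⊗≫ Y ◁ Z ◁ ((α_ X H H).hom ≫ X ◁ μ[H] ≫ a) ⊗≫ 𝟙 _ := by
            rw [whisker_exchange]; monoidal
    _ = 𝟙 _ ⊗≫ X ◁ (c ▷ Z ≫ (Y ⊗ H) ◁ d) ⊗≫
          (X ⊗ Y) ◁ (β_ H Z).hom ▷ H ⊗≫
          ((β_ X Y).hom ▷ (Z ⊗ H) ≫ (Y ⊗ X) ◁ 𝟙 (Z ⊗ H)) ▷ H ⊗≫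
          Y ◁ (β_ X Z).hom ▷ (H ⊗ H) ⊗≫
          Y ◁ Z ◁ a ▷ H ⊗≫ Y ◁ Z ◁ a ⊗≫ 𝟙 _ := by
            rw [← ha, braiding_tensor_right_hom, MonoidalCategory.tensorHom_def]; monoidal
    _ = 𝟙 _ ⊗≫ X ◁ (c ▷ Z ≫ (Y ⊗ H) ◁ d) ⊗≫
          ((X ⊗ Y) ◁ (β_ H Z).hom ≫ (β_ X Y).hom ▷ (Z ⊗ H)) ▷ H ⊗≫
          Y ◁ (β_ X Z).hom ▷ (H ⊗ H) ⊗≫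
          Y ◁ Z ◁ a ▷ H ⊗≫ Y ◁ Z ◁ a ⊗≫ 𝟙 _ := by monoidal
    _ = 𝟙 _ ⊗≫ X ◁ c ▷ Z ⊗≫ (((X ⊗ Y) ⊗ H) ◁ d ≫ (β_ X Y).hom ▷ H ▷ (Z ⊗ H)) ⊗≫
          Y ◁ ((β_ (X ⊗ H) Z).hom ≫ Z ◁ a) ▷ H ⊗≫ Y ◁ Z ◁ a ⊗≫ 𝟙 _ := by
            rw [whisker_exchange (β_ X Y).hom (β_ H Z).hom, braiding_tensor_left_hom]; monoidal
    _ = 𝟙 _ ⊗≫ X ◁ c ▷ Z ⊗≫ ((X ⊗ Y ⊗ H) ◁ d ≫ ((α_ X Y H).inv ≫ (β_ X Y).hom ▷ H ≫ (α_ Y X H).hom ≫ Y ◁ a) ▷ (Z ⊗ H)) ⊗≫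
          Y ◁ (β_ X Z).hom ▷ H ⊗≫ Y ◁ Z ◁ a ⊗≫ 𝟙 _ := by
            rw [← braiding_naturality_left]; monoidal
    _ = _ := by rw [whisker_exchange]; monoidal

theorem braid_aux (A B C D Y : 𝒞) :
    𝟙 (A ⊗ Y ⊗ B ⊗ C ⊗ D) ⊗≫ A ◁ (β_ (Y ⊗ B) C).hom ▷ D ⊗≫ (β_ A C).hom ▷ (Y ⊗ B ⊗ D) ⊗≫
      C ◁ A ◁ Y ◁ (β_ B D).hom ⊗≫ C ◁ (β_ A (Y ⊗ D)).hom ▷ B ⊗≫ 𝟙 (C ⊗ Y ⊗ D ⊗ A ⊗ B) =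
    𝟙 (A ⊗ Y ⊗ B ⊗ C ⊗ D) ⊗≫ (β_ A Y).hom ▷ (B ⊗ C ⊗ D) ⊗≫
      Y ◁ (β_ (A ⊗ B) (C ⊗ D)).hom ⊗≫ (β_ Y C).hom ▷ (D ⊗ A ⊗ B) ⊗≫
      𝟙 (C ⊗ Y ⊗ D ⊗ A ⊗ B) := by
  calc
    _ = 𝟙 (A ⊗ Y ⊗ B ⊗ C ⊗ D) ⊗≫ A ◁ Y ◁ (β_ B C).hom ▷ D ⊗≫
          (A ◁ (β_ Y C).hom ≫ (α_ A C Y).inv ≫ (β_ A C).hom ▷ Y) ▷ (B ⊗ D) ⊗≫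
          (C ◁ ((A ⊗ Y) ◁ (β_ B D).hom ≫ (β_ A Y).hom ▷ (D ⊗ B))) ⊗≫
          C ◁ Y ◁ (β_ A D).hom ▷ B ⊗≫ 𝟙 (C ⊗ Y ⊗ D ⊗ A ⊗ B) := by
        rw [braiding_tensor_left_hom, braiding_tensor_right_hom]; monoidal
    _ = 𝟙 (A ⊗ Y ⊗ B ⊗ C ⊗ D) ⊗≫ A ◁ Y ◁ (β_ B C).hom ▷ D ⊗≫
          (A ◁ (β_ Y C).hom ≫ (α_ A C Y).inv ≫ (β_ A C).hom ▷ Y ≫ (α_ C A Y).hom ≫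
            C ◁ (β_ A Y).hom) ▷ (B ⊗ D) ⊗≫
          C ◁ Y ◁ A ◁ (β_ B D).hom ⊗≫
          C ◁ Y ◁ (β_ A D).hom ▷ B ⊗≫ 𝟙 (C ⊗ Y ⊗ D ⊗ A ⊗ B) := by
        rw [whisker_exchange]; monoidal
    _ = 𝟙 (A ⊗ Y ⊗ B ⊗ C ⊗ D) ⊗≫ ((A ⊗ Y) ◁ (β_ B C).hom ≫
            (β_ A Y).hom ▷ (C ⊗ B)) ▷ D ⊗≫ Y ◁ (β_ A C).hom ▷ (B ⊗ D) ⊗≫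
          ((β_ Y C).hom ▷ (A ⊗ B ⊗ D) ≫
          (C ⊗ Y) ◁ (A ◁ (β_ B D).hom ≫ (α_ A D B).inv ≫ (β_ A D).hom ▷ B)) ⊗≫
          𝟙 (C ⊗ Y ⊗ D ⊗ A ⊗ B) := by
        rw [← yang_baxter]; monoidal
    _ = 𝟙 (A ⊗ Y ⊗ B ⊗ C ⊗ D) ⊗≫
            (β_ A Y).hom ▷ (B ⊗ C ⊗ D) ⊗≫ Y ◁ A ◁ (β_ B C).hom ▷ D ⊗≫
           Y ◁ ((β_ A C).hom ▷ (B ⊗ D) ≫ (C ⊗ A) ◁ (β_ B D).hom) ⊗≫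
           Y ◁ C ◁ (β_ A D).hom ▷ B ⊗≫
          (β_ Y C).hom ▷ (D ⊗ A ⊗ B) ⊗≫
          𝟙 (C ⊗ Y ⊗ D ⊗ A ⊗ B) := by
        rw [whisker_exchange, ← whisker_exchange (β_ Y C).hom]; monoidal
    _ = _ := by
        rw [← whisker_exchange, braiding_tensor_left_hom, braiding_tensor_right_hom,
          braiding_tensor_right_hom]
        monoidal

theorem psi_comul [ComonObj H] (b : Y ⊗ H ⟶ Y) :
    psi b Δ[H] ≫ Δ[H] ▷ Y =
      Y ◁ Δ[H] ≫ (α_ Y H H).inv ≫ (β_ Y H).hom ▷ H ≫ (α_ H Y H).hom ≫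
        H ◁ psi b Δ[H] ≫ (α_ H H Y).inv := by
  unfold psi
  calc
    _ = 𝟙 _ ⊗≫ Y ◁ Δ[H] ⊗≫ (β_ Y H).hom ▷ H ⊗≫ (H ◁ b ≫ Δ[H] ▷ Y) ⊗≫ 𝟙 _ := by monoidal
    _ = 𝟙 _ ⊗≫ Y ◁ Δ[H] ⊗≫ ((β_ Y H).hom ≫ Δ[H] ▷ Y) ▷ H ⊗≫ H ◁ H ◁ b ⊗≫ 𝟙 _ := by
      rw [whisker_exchange]; monoidal
    _ = 𝟙 _ ⊗≫ Y ◁ (Δ[H] ≫ Δ[H] ▷ H ≫ (α_ H H H).hom) ⊗≫ (β_ Y H).hom ▷ H ▷ H ⊗≫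
          H ◁ (β_ Y H).hom ▷ H ⊗≫ H ◁ H ◁ b ⊗≫ 𝟙 _ := by
      rw [← braiding_naturality_right, braiding_tensor_right_hom]; monoidal
    _ = 𝟙 _ ⊗≫ Y ◁ Δ[H] ⊗≫ ((Y ⊗ H) ◁ Δ[H] ≫ (β_ Y H).hom ▷ (H ⊗ H)) ⊗≫
          H ◁ (β_ Y H).hom ▷ H ⊗≫ H ◁ H ◁ b ⊗≫ 𝟙 _ := by
      rw [← ComonObj.comul_assoc]; monoidal
    _ = _ := by
      rw [whisker_exchange]; monoidal

theorem mul_psi [MonObj H] (d : Y ⟶ Y ⊗ H) :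
    μ[H] ▷ Y ≫ psi μ[H] d =
      (α_ H H Y).hom ≫ H ◁ psi μ[H] d ≫ (α_ H Y H).inv ≫ (β_ H Y).hom ▷ H ≫ (α_ Y H H).hom ≫
        Y ◁ μ[H] := by
  unfold psi
  calc
    _ = 𝟙 _ ⊗≫ (μ[H] ▷ Y ≫ H ◁ d) ⊗≫ (β_ H Y).hom ▷ H ⊗≫ Y ◁ μ[H] := by monoidal
    _ = 𝟙 _ ⊗≫ H ◁ H ◁ d ⊗≫ (μ[H] ▷ Y ≫ (β_ H Y).hom) ▷ H ⊗≫ Y ◁ μ[H] := by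
      rw [← whisker_exchange]; monoidal
    _ = 𝟙 _ ⊗≫ H ◁ H ◁ d ⊗≫ H ◁ (β_ H Y).hom ▷ H ⊗≫ (β_ H Y).hom ▷ H ▷ H ⊗≫
          Y ◁ (μ[H] ▷ H ≫ μ[H]) := by
      rw [braiding_naturality_left, braiding_tensor_left_hom]; monoidal
    _ = 𝟙 _ ⊗≫ H ◁ H ◁ d ⊗≫ H ◁ (β_ H Y).hom ▷ H ⊗≫ ((β_ H Y).hom ▷ (H ⊗ H) ≫
          (Y ⊗ H) ◁ μ[H]) ⊗≫ Y ◁ μ[H] := by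
      rw [MonObj.mul_assoc]; monoidal
    _ = _ := by
      rw [← whisker_exchange]; monoidal

/-- The compatibility condition of a right action `a` and a right coaction `c` of `H` on `X`: the
two composites `X ⊗ H ⟶ X ⊗ H`
`(𝟙 ⊗ Δ) ≫ (Ψ ⊗ 𝟙) ≫ (𝟙 ⊗ a) ≫ (𝟙 ⊗ c) ≫ (Ψ ⊗ 𝟙) ≫ (𝟙 ⊗ μ)` and
`(c ⊗ Δ) ≫ (𝟙 ⊗ Ψ ⊗ 𝟙) ≫ (a ⊗ μ)` agree. -/
def IsCrossed [MonObj H] [ComonObj H] (a : X ⊗ H ⟶ X) (c : X ⟶ X ⊗ H) : Prop :=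
  psi a Δ[H] ≫ psi μ[H] c = (c ⊗ₘ Δ[H]) ≫ tensorμ X H H H ≫ (a ⊗ₘ μ[H])

theorem IsCrossed.tensor [BimonObj H] (a : X ⊗ H ⟶ X) (b : Y ⊗ H ⟶ Y)
    (c : X ⟶ X ⊗ H) (d : Y ⟶ Y ⊗ H) (hX : IsCrossed a c) (hY : IsCrossed b d) :
    IsCrossed (tensorAct a b) (tensorCoact c d) := by
  unfold IsCrossed at *
  rw [psi_tensor_left _ _ _ (ComonObj.comul_assoc H), psi_tensor_right _ _ _ (MonObj.mul_assoc H)]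
  trans 𝟙 _ ⊗≫ c ▷ Y ▷ H ⊗≫ X ◁ H ◁ d ▷ H ⊗≫ X ◁ H ◁ Y ◁ H ◁ (Δ[H] ≫ H ◁ Δ[H]) ⊗≫
      X ◁ (𝟙 (H ⊗ Y ⊗ H ⊗ H ⊗ H) ⊗≫ H ◁ (β_ (Y ⊗ H) H).hom ▷ H ⊗≫
      (β_ H H).hom ▷ (Y ⊗ H ⊗ H) ⊗≫
      H ◁ H ◁ Y ◁ (β_ H H).hom ⊗≫ H ◁ (β_ H (Y ⊗ H)).hom ▷ H ⊗≫ 𝟙 (H ⊗ Y ⊗ H ⊗ H ⊗ H)) ▷ H ⊗≫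
      (a ▷ (Y ⊗ H) ≫ X ◁ b) ▷ (H ⊗ H ⊗ H) ⊗≫ X ◁ Y ◁ (H ◁ μ[H] ≫ μ[H]) ⊗≫ 𝟙 _
  · calc
      _ = 𝟙 _ ⊗≫ X ◁ psi b Δ[H] ⊗≫ (psi a Δ[H] ≫ psi μ[H] c) ▷ Y ⊗≫ X ◁ psi μ[H] d ⊗≫ 𝟙 _ := by
          monoidal
      _ = 𝟙 _ ⊗≫ (X ◁ psi b Δ[H] ≫ c ▷ (H ⊗ Y)) ⊗≫ (X ⊗ H) ◁ Δ[H] ▷ Y ⊗≫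
            X ◁ (β_ H H).hom ▷ H ▷ Y ⊗≫ a ▷ (H ⊗ H) ▷ Y ⊗≫ X ◁ μ[H] ▷ Y ⊗≫
            X ◁ psi μ[H] d ⊗≫ 𝟙 _ := by
          rw [hX, tensorμ, MonoidalCategory.tensorHom_def, MonoidalCategory.tensorHom_def]; monoidal
      _ = 𝟙 _ ⊗≫ c ▷ (Y ⊗ H) ⊗≫ (X ⊗ H) ◁ (psi b Δ[H] ≫ Δ[H] ▷ Y) ⊗≫
            X ◁ (β_ H H).hom ▷ H ▷ Y ⊗≫ a ▷ (H ⊗ H) ▷ Y ⊗≫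
            X ◁ (μ[H] ▷ Y ≫ psi μ[H] d) ⊗≫ 𝟙 _ := by
          rw [whisker_exchange]; monoidal
      _ = 𝟙 _ ⊗≫ c ▷ (Y ⊗ H) ⊗≫ X ◁ H ◁ Y ◁ Δ[H] ⊗≫ X ◁ H ◁ (β_ Y H).hom ▷ H ⊗≫
            (((X ⊗ H) ⊗ H) ◁ psi b Δ[H] ≫
              ((α_ X H H).hom ≫ X ◁ (β_ H H).hom ≫ (α_ X H H).inv ≫ a ▷ H) ▷ (H ⊗ Y)) ⊗≫
            X ◁ H ◁ psi μ[H] d ⊗≫ X ◁ (β_ H Y).hom ▷ H ⊗≫ X ◁ Y ◁ μ[H] ⊗≫ 𝟙 _ := by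
          rw [psi_comul, mul_psi]; monoidal
      _ = 𝟙 _ ⊗≫ c ▷ (Y ⊗ H) ⊗≫ X ◁ H ◁ Y ◁ Δ[H] ⊗≫ X ◁ H ◁ (β_ Y H).hom ▷ H ⊗≫
              ((α_ X H H).hom ≫ X ◁ (β_ H H).hom ≫ (α_ X H H).inv ≫ a ▷ H) ▷ (Y ⊗ H) ⊗≫
            X ◁ H ◁ (psi b Δ[H] ≫ psi μ[H] d) ⊗≫ X ◁ (β_ H Y).hom ▷ H ⊗≫
            X ◁ Y ◁ μ[H] ⊗≫ 𝟙 _ := by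
          rw [whisker_exchange]; monoidal
      _ = 𝟙 _ ⊗≫ c ▷ (Y ⊗ H) ⊗≫ X ◁ H ◁ Y ◁ Δ[H] ⊗≫ X ◁ H ◁ (β_ Y H).hom ▷ H ⊗≫
              (((α_ X H H).hom ≫ X ◁ (β_ H H).hom ≫ (α_ X H H).inv ≫ a ▷ H) ▷ (Y ⊗ H) ≫
              (X ⊗ H) ◁ ((d ⊗ₘ Δ[H]) ≫ tensorμ Y H H H ≫ (b ⊗ₘ μ[H]))) ⊗≫
            X ◁ (β_ H Y).hom ▷ H ⊗≫
            X ◁ Y ◁ μ[H] ⊗≫ 𝟙 _ := by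
          rw [hY]; monoidal
      _ = 𝟙 _ ⊗≫ c ▷ (Y ⊗ H) ⊗≫ X ◁ H ◁ Y ◁ Δ[H] ⊗≫ X ◁ H ◁ (β_ Y H).hom ▷ H ⊗≫
            X ◁ H ◁ H ◁ ((d ⊗ₘ Δ[H]) ≫ tensorμ Y H H H ≫ (b ⊗ₘ μ[H])) ⊗≫
            ((X ◁ (β_ H H).hom ≫ (α_ X H H).inv ≫ a ▷ H) ▷ Y ≫ (α_ X H Y).hom ≫
            X ◁ (β_ H Y).hom) ▷ H ⊗≫
            X ◁ Y ◁ μ[H] ⊗≫ 𝟙 _ := by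
          rw [← whisker_exchange]; monoidal
      _ = 𝟙 _ ⊗≫ c ▷ (Y ⊗ H) ⊗≫ X ◁ H ◁ (Y ◁ Δ[H] ≫ (α_ Y H H).inv ≫
              ((β_ Y H).hom ≫ H ◁ d) ▷ H) ⊗≫
            X ◁ H ◁ H ◁ Y ◁ H ◁ Δ[H] ⊗≫ X ◁ H ◁ H ◁ Y ◁ (β_ H H).hom ▷ H ⊗≫
            X ◁ H ◁ H ◁ b ▷ H ▷ H ⊗≫
            ((X ⊗ H ⊗ H ⊗ Y) ◁ μ[H] ≫ (X ◁ (α_ H H Y).inv ≫ (α_ X (H ⊗ H) Y).inv ≫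
              ((X ◁ (β_ H H).hom ≫ (α_ X H H).inv ≫ a ▷ H) ▷ Y ≫ (α_ X H Y).hom ≫
            X ◁ (β_ H Y).hom)) ▷ H) ⊗≫
            X ◁ Y ◁ μ[H] ⊗≫ 𝟙 _ := by
          rw [MonoidalCategory.tensorHom_def, MonoidalCategory.tensorHom_def, tensorμ]; monoidal
      _ = 𝟙 _ ⊗≫ c ▷ (Y ⊗ H) ⊗≫ X ◁ H ◁ (Y ◁ Δ[H] ≫ d ▷ (H ⊗ H)) ⊗≫
            X ◁ H ◁ ((β_ (Y ⊗ H) H).hom ▷ H ≫ (H ⊗ Y ⊗ H) ◁ Δ[H]) ⊗≫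
            X ◁ H ◁ H ◁ Y ◁ (β_ H H).hom ▷ H ⊗≫
            ((X ⊗ H ⊗ H) ◁ b ≫ (X ◁ (β_ H H).hom ≫ (α_ X H H).inv ≫ a ▷ H) ▷ Y) ▷ (H ⊗ H) ⊗≫
            X ◁ (β_ H Y).hom ▷ (H ⊗ H) ⊗≫
            X ◁ Y ◁ H ◁ μ[H] ⊗≫
            X ◁ Y ◁ μ[H] ⊗≫ 𝟙 _ := by
          rw [whisker_exchange _ μ[H], ← braiding_naturality_left]; monoidal
      _ = 𝟙 _ ⊗≫ c ▷ (Y ⊗ H) ⊗≫ X ◁ H ◁ d ▷ H ⊗≫ X ◁ H ◁ Y ◁ H ◁ (Δ[H] ≫ H ◁ Δ[H]) ⊗≫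
            X ◁ H ◁ (β_ (Y ⊗ H) H).hom ▷ (H ⊗ H) ⊗≫
            X ◁ H ◁ H ◁ Y ◁ (β_ H H).hom ▷ H ⊗≫
            (X ◁ (β_ H H).hom) ▷ (Y ⊗ H ⊗ H ⊗ H) ⊗≫
            (a ▷ (H ⊗ Y ⊗ H) ≫ X ◁ (H ◁ b ≫ (β_ H Y).hom)) ▷ (H ⊗ H) ⊗≫
            X ◁ Y ◁ H ◁ μ[H] ⊗≫
            X ◁ Y ◁ μ[H] ⊗≫ 𝟙 _ := by
          rw [whisker_exchange _ b, whisker_exchange d, ← whisker_exchange (β_ (Y ⊗ H) H).hom Δ[H]]; monoidal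
      _ = 𝟙 _ ⊗≫ c ▷ (Y ⊗ H) ⊗≫ X ◁ H ◁ d ▷ H ⊗≫ X ◁ H ◁ Y ◁ H ◁ (Δ[H] ≫ H ◁ Δ[H]) ⊗≫
            X ◁ H ◁ (β_ (Y ⊗ H) H).hom ▷ (H ⊗ H) ⊗≫
            (X ⊗ H) ◁ ((H ⊗ Y) ◁ (β_ H H).hom) ▷ H ⊗≫
            X ◁ (β_ H H).hom ▷ (Y ⊗ H ⊗ H ⊗ H) ⊗≫
            (a ▷ (H ⊗ Y ⊗ H) ≫ X ◁ (β_ H (Y ⊗ H)).hom) ▷ (H ⊗ H) ⊗≫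
            X ◁ b ▷ (H ⊗ H ⊗ H) ⊗≫
            X ◁ Y ◁ H ◁ μ[H] ⊗≫
            X ◁ Y ◁ μ[H] ⊗≫ 𝟙 _ := by
          rw [braiding_naturality_right]; monoidal
      _ = 𝟙 _ ⊗≫ c ▷ (Y ⊗ H) ⊗≫ X ◁ H ◁ d ▷ H ⊗≫ X ◁ H ◁ Y ◁ H ◁ (Δ[H] ≫ H ◁ Δ[H]) ⊗≫
            X ◁ H ◁ (β_ (Y ⊗ H) H).hom ▷ (H ⊗ H) ⊗≫
            X ◁ (H ◁ ((H ⊗ Y) ◁ (β_ H H).hom) ≫ (α_ H (H ⊗ Y) (H ⊗ H)).inv ≫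
              (α_ H H Y).inv ▷ (H ⊗ H) ≫ (α_ (H ⊗ H) Y (H ⊗ H)).hom ≫
              (β_ H H).hom ▷ (Y ⊗ H ⊗ H)) ▷ H ⊗≫
            X ◁ H ◁ (β_ H (Y ⊗ H)).hom ▷ (H ⊗ H) ⊗≫
            (a ▷ (Y ⊗ H) ≫ X ◁ b) ▷ (H ⊗ H ⊗ H) ⊗≫
            X ◁ Y ◁ H ◁ μ[H] ⊗≫
            X ◁ Y ◁ μ[H] ⊗≫ 𝟙 _ := by
          rw [← whisker_exchange a]; monoidal
      _ = 𝟙 _ ⊗≫ c ▷ (Y ⊗ H) ⊗≫ X ◁ H ◁ d ▷ H ⊗≫ X ◁ H ◁ Y ◁ H ◁ (Δ[H] ≫ H ◁ Δ[H]) ⊗≫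
            X ◁ H ◁ (β_ (Y ⊗ H) H).hom ▷ (H ⊗ H) ⊗≫
            X ◁ ((H ⊗ H) ◁ (Y ◁ (β_ H H).hom) ≫
              (β_ H H).hom ▷ (Y ⊗ H ⊗ H)) ▷ H ⊗≫
            X ◁ H ◁ (β_ H (Y ⊗ H)).hom ▷ (H ⊗ H) ⊗≫
            (a ▷ (Y ⊗ H) ≫ X ◁ b) ▷ (H ⊗ H ⊗ H) ⊗≫
            X ◁ Y ◁ H ◁ μ[H] ⊗≫
            X ◁ Y ◁ μ[H] ⊗≫ 𝟙 _ := by monoidal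
      _ = _ := by rw [whisker_exchange (β_ H H).hom]; monoidal
  · rw [braid_aux]
    symm
    calc
      _ = 𝟙 _ ⊗≫ c ▷ Y ▷ H ⊗≫ X ◁ H ◁ d ▷ H ⊗≫ X ◁ (β_ H Y).hom ▷ H ▷ H ⊗≫
            X ◁ Y ◁ (μ[H] ▷ H ≫ H ◁ Δ[H]) ⊗≫
            X ◁ Y ◁ (β_ H H).hom ▷ H ⊗≫ (X ◁ Y ◁ Δ[H] ≫
              X ◁ ((α_ Y H H).inv ≫ (β_ Y H).hom ▷ H ≫ (α_ H Y H).hom) ≫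
              (α_ X H (Y ⊗ H)).inv ≫ a ▷ (Y ⊗ H) ≫ X ◁ b) ▷ (H ⊗ H) ⊗≫
            X ◁ Y ◁ μ[H] ⊗≫ 𝟙 _ := by
          rw [MonoidalCategory.tensorHom_def (tensorCoact c d), MonoidalCategory.tensorHom_def _ μ[H]]
          unfold tensorAct tensorCoact tensorμ
          rw [MonoidalCategory.tensorHom_def, MonoidalCategory.tensorHom_def]
          monoidal
      _ = 𝟙 _ ⊗≫ c ▷ Y ▷ H ⊗≫ X ◁ H ◁ d ▷ H ⊗≫ X ◁ (β_ H Y).hom ▷ H ▷ H ⊗≫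
            X ◁ Y ◁ (H ⊗ H) ◁ Δ[H] ⊗≫
            X ◁ Y ◁ (μ[H] ▷ H ≫ (β_ H H).hom ≫ Δ[H] ▷ H) ▷ H ⊗≫
              (X ◁ ((β_ Y H).hom ▷ H ≫ (α_ H Y H).hom) ≫
              (α_ X H (Y ⊗ H)).inv ≫ a ▷ (Y ⊗ H) ≫ X ◁ b) ▷ (H ⊗ H) ⊗≫
            X ◁ Y ◁ μ[H] ⊗≫ 𝟙 _ := by
          rw [← whisker_exchange]; monoidal
      _ = 𝟙 _ ⊗≫ c ▷ Y ▷ H ⊗≫ X ◁ H ◁ d ▷ H ⊗≫ X ◁ (β_ H Y).hom ▷ H ▷ H ⊗≫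
            X ◁ Y ◁ (H ⊗ H) ◁ (Δ[H] ≫ Δ[H] ▷ H ≫ (α_ H H H).hom) ⊗≫
            X ◁ Y ◁ (β_ (H ⊗ H) (H ⊗ H)).hom ▷ H ⊗≫
              ((X ⊗ Y ⊗ H ⊗ H) ◁ μ[H] ≫ (X ◁ (α_ Y H H).inv ≫ X ◁ ((β_ Y H).hom ▷ H ≫ (α_ H Y H).hom) ≫
              (α_ X H (Y ⊗ H)).inv ≫ a ▷ (Y ⊗ H) ≫ X ◁ b) ▷ H) ▷ H ⊗≫
            X ◁ Y ◁ μ[H] ⊗≫ 𝟙 _ := by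
          rw [← braiding_naturality_right, ← whisker_exchange_assoc,
            braiding_naturality_left]; monoidal
      _ = 𝟙 _ ⊗≫ c ▷ (Y ⊗ H) ⊗≫ X ◁ H ◁ d ▷ H ⊗≫
            X ◁ (((H ⊗ Y) ⊗ H) ◁ (Δ[H] ≫ H ◁ Δ[H]) ≫ ((β_ H Y).hom ▷ H) ▷ (H ⊗ H ⊗ H)) ⊗≫
            X ◁ Y ◁ (β_ (H ⊗ H) (H ⊗ H)).hom ▷ H ⊗≫
            X ◁ (β_ Y H).hom ▷ (H ⊗ H ⊗ H ⊗ H) ⊗≫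
              (a ▷ (Y ⊗ H) ≫ X ◁ b) ▷ (H ⊗ H ⊗ H) ⊗≫
            X ◁ Y ◁ (μ[H] ▷ H ≫ μ[H]) ⊗≫ 𝟙 _ := by
          rw [whisker_exchange _ μ[H], ← ComonObj.comul_assoc, whisker_exchange]; monoidal
      _ = _ := by rw [MonObj.mul_assoc]; monoidal

theorem psi_act [MonObj H] [ComonObj H] (a : X ⊗ H ⟶ X) (b : Y ⊗ H ⟶ Y) (d : Y ⟶ Y ⊗ H)
    (ha : a ▷ H ≫ a = (α_ X H H).hom ≫ X ◁ μ[H] ≫ a) (hY : IsCrossed b d) :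
    tensorAct a b ≫ psi a d = psi a d ▷ H ≫ tensorAct b a := by
  unfold IsCrossed at hY
  calc
    _ = 𝟙 _ ⊗≫ X ◁ Y ◁ Δ[H] ⊗≫ X ◁ (β_ Y H).hom ▷ H ⊗≫
          (a ▷ (Y ⊗ H) ≫ X ◁ (b ≫ d)) ⊗≫ (β_ X Y).hom ▷ H ⊗≫ Y ◁ a ⊗≫ 𝟙 _ := by
        unfold tensorAct tensorμ psi
        rw [MonoidalCategory.tensorHom_def]
        monoidal
    _ = 𝟙 _ ⊗≫ X ◁ Y ◁ Δ[H] ⊗≫ X ◁ (β_ Y H).hom ▷ H ⊗≫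
          X ◁ H ◁ b ⊗≫ X ◁ H ◁ d ⊗≫ (a ▷ Y ≫ (β_ X Y).hom) ▷ H ⊗≫ Y ◁ a ⊗≫ 𝟙 _ := by
        rw [← whisker_exchange]; monoidal
    _ = 𝟙 _ ⊗≫ X ◁ Y ◁ Δ[H] ⊗≫ X ◁ (β_ Y H).hom ▷ H ⊗≫
          X ◁ H ◁ b ⊗≫ X ◁ H ◁ d ⊗≫ X ◁ (β_ H Y).hom ▷ H ⊗≫ (β_ X Y).hom ▷ H ▷ H ⊗≫
          Y ◁ (a ▷ H ≫ a) ⊗≫ 𝟙 _ := by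
        rw [braiding_naturality_left, braiding_tensor_left_hom]; monoidal
    _ = 𝟙 _ ⊗≫ X ◁ Y ◁ Δ[H] ⊗≫ X ◁ (β_ Y H).hom ▷ H ⊗≫
          X ◁ H ◁ b ⊗≫ X ◁ H ◁ d ⊗≫ X ◁ (β_ H Y).hom ▷ H ⊗≫
          ((β_ X Y).hom ▷ (H ⊗ H) ≫ (Y ⊗ X) ◁ μ[H]) ⊗≫
          Y ◁ a ⊗≫ 𝟙 _ := by
        rw [ha]; monoidal
    _ = 𝟙 _ ⊗≫ X ◁ (psi b Δ[H] ≫ psi μ[H] d) ⊗≫ (β_ X Y).hom ▷ H ⊗≫ Y ◁ a ⊗≫ 𝟙 _ := by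
        rw [← whisker_exchange]; unfold psi; monoidal
    _ = 𝟙 _ ⊗≫ X ◁ d ▷ H ⊗≫ X ◁ Y ◁ H ◁ Δ[H] ⊗≫ X ◁ Y ◁ (β_ H H).hom ▷ H ⊗≫
          X ◁ b ▷ (H ⊗ H) ⊗≫ ((X ⊗ Y) ◁ μ[H] ≫ (β_ X Y).hom ▷ H) ⊗≫ Y ◁ a ⊗≫ 𝟙 _ := by
        rw [hY, tensorμ, MonoidalCategory.tensorHom_def, MonoidalCategory.tensorHom_def]; monoidal
    _ = 𝟙 _ ⊗≫ X ◁ d ▷ H ⊗≫ X ◁ Y ◁ H ◁ Δ[H] ⊗≫ X ◁ Y ◁ (β_ H H).hom ▷ H ⊗≫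
          (X ◁ b ≫ (β_ X Y).hom) ▷ (H ⊗ H) ⊗≫ Y ◁ ((α_ X H H).hom ≫ X ◁ μ[H] ≫ a) ⊗≫ 𝟙 _ := by
        rw [whisker_exchange]; monoidal
    _ = 𝟙 _ ⊗≫ X ◁ d ▷ H ⊗≫ X ◁ Y ◁ H ◁ Δ[H] ⊗≫
          ((X ⊗ Y) ◁ (β_ H H).hom ≫ (β_ X Y).hom ▷ (H ⊗ H)) ▷ H ⊗≫
          Y ◁ (β_ X H).hom ▷ (H ⊗ H) ⊗≫ (b ▷ (X ⊗ H) ≫ Y ◁ a) ▷ H ⊗≫ Y ◁ a ⊗≫ 𝟙 _ := by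
        rw [braiding_naturality_right, braiding_tensor_right_hom, ← ha]; monoidal
    _ = 𝟙 _ ⊗≫ X ◁ d ▷ H ⊗≫ (((X ⊗ Y) ⊗ H) ◁ Δ[H] ≫ ((β_ X Y).hom ▷ H) ▷ (H ⊗ H)) ⊗≫
          Y ◁ ((β_ (X ⊗ H) H).hom ≫ H ◁ a) ▷ H ⊗≫ b ▷ X ▷ H ⊗≫ Y ◁ a ⊗≫ 𝟙 _ := by
        rw [whisker_exchange (β_ X Y).hom, ← whisker_exchange b, braiding_tensor_left_hom]; monoidal
    _ = 𝟙 _ ⊗≫ X ◁ d ▷ H ⊗≫ (β_ X Y).hom ▷ H ▷ H ⊗≫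
          Y ◁ ((X ⊗ H) ◁ Δ[H] ≫ a ▷ (H ⊗ H)) ⊗≫ Y ◁ (β_ X H).hom ▷ H ⊗≫
          b ▷ X ▷ H ⊗≫ Y ◁ a ⊗≫ 𝟙 _ := by
        rw [whisker_exchange ((β_ X Y).hom ▷ H), ← braiding_naturality_left]; monoidal
    _ = _ := by
        rw [whisker_exchange a]
        unfold psi tensorAct tensorμ
        rw [MonoidalCategory.tensorHom_def]
        monoidal

theorem psi_coact [MonObj H] [ComonObj H] (a : X ⊗ H ⟶ X) (c : X ⟶ X ⊗ H) (d : Y ⟶ Y ⊗ H)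
    (hd : d ≫ Y ◁ Δ[H] = d ≫ d ▷ H ≫ (α_ Y H H).hom) (hX : IsCrossed a c) :
    psi a d ≫ tensorCoact d c = tensorCoact c d ≫ psi a d ▷ H := by
  unfold IsCrossed at hX
  calc
    _ = 𝟙 _ ⊗≫ X ◁ d ⊗≫ (β_ X Y).hom ▷ H ⊗≫ (Y ◁ (a ≫ c) ≫ d ▷ (X ⊗ H)) ⊗≫
          Y ◁ (β_ H X).hom ▷ H ⊗≫ Y ◁ X ◁ μ[H] ⊗≫ 𝟙 _ := by
        unfold psi tensorCoact tensorμ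
        rw [MonoidalCategory.tensorHom_def']; monoidal
    _ = 𝟙 _ ⊗≫ X ◁ d ⊗≫ ((β_ X Y).hom ≫ d ▷ X) ▷ H ⊗≫ Y ◁ H ◁ (a ≫ c) ⊗≫
          Y ◁ (β_ H X).hom ▷ H ⊗≫ Y ◁ X ◁ μ[H] ⊗≫ 𝟙 _ := by
        rw [whisker_exchange]; monoidal
    _ = 𝟙 _ ⊗≫ X ◁ (d ≫ d ▷ H ≫ (α_ Y H H).hom) ⊗≫ (β_ X Y).hom ▷ H ▷ H ⊗≫
          Y ◁ (β_ X H).hom ▷ H ⊗≫ Y ◁ H ◁ (a ≫ c) ⊗≫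
          Y ◁ (β_ H X).hom ▷ H ⊗≫ Y ◁ X ◁ μ[H] ⊗≫ 𝟙 _ := by
        rw [← braiding_naturality_right, braiding_tensor_right_hom]; monoidal
    _ = 𝟙 _ ⊗≫ X ◁ d ⊗≫ ((X ⊗ Y) ◁ Δ[H] ≫ (β_ X Y).hom ▷ (H ⊗ H)) ⊗≫
          Y ◁ (β_ X H).hom ▷ H ⊗≫ Y ◁ H ◁ (a ≫ c) ⊗≫
          Y ◁ (β_ H X).hom ▷ H ⊗≫ Y ◁ X ◁ μ[H] ⊗≫ 𝟙 _ := by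
        rw [← hd]; monoidal
    _ = 𝟙 _ ⊗≫ X ◁ d ⊗≫ (β_ X Y).hom ▷ H ⊗≫ Y ◁ (psi a Δ[H] ≫ psi μ[H] c) ⊗≫ 𝟙 _ := by
        rw [whisker_exchange]; unfold psi; monoidal
    _ = 𝟙 _ ⊗≫ X ◁ d ⊗≫ ((β_ X Y).hom ≫ Y ◁ c) ▷ H ⊗≫ Y ◁ X ◁ H ◁ Δ[H] ⊗≫
          Y ◁ X ◁ (β_ H H).hom ▷ H ⊗≫ Y ◁ (a ▷ (H ⊗ H) ≫ X ◁ μ[H]) ⊗≫ 𝟙 _ := by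
        rw [hX, tensorμ, MonoidalCategory.tensorHom_def, MonoidalCategory.tensorHom_def]; monoidal
    _ = 𝟙 _ ⊗≫ (X ◁ d ≫ c ▷ (Y ⊗ H)) ⊗≫ X ◁ (β_ H Y).hom ▷ H ⊗≫
          (((β_ X Y).hom ▷ H) ▷ H ≫ ((Y ⊗ X) ⊗ H) ◁ Δ[H]) ⊗≫
          Y ◁ X ◁ (β_ H H).hom ▷ H ⊗≫ Y ◁ (a ▷ (H ⊗ H) ≫ X ◁ μ[H]) ⊗≫ 𝟙 _ := by
        rw [← braiding_naturality_left, braiding_tensor_left_hom]; monoidal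
    _ = 𝟙 _ ⊗≫ c ▷ Y ⊗≫ X ◁ H ◁ d ⊗≫ X ◁ ((β_ H Y).hom ▷ H ≫ (Y ⊗ H) ◁ Δ[H]) ⊗≫
          ((β_ X Y).hom ▷ (H ⊗ H) ≫ (Y ⊗ X) ◁ (β_ H H).hom) ▷ H ⊗≫
          Y ◁ (a ▷ (H ⊗ H) ≫ X ◁ μ[H]) ⊗≫ 𝟙 _ := by
        rw [whisker_exchange c, ← whisker_exchange ((β_ X Y).hom ▷ H)]; monoidal
    _ = 𝟙 _ ⊗≫ c ▷ Y ⊗≫ X ◁ H ◁ (d ≫ Y ◁ Δ[H]) ⊗≫ X ◁ (β_ H Y).hom ▷ (H ⊗ H) ⊗≫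
          X ◁ Y ◁ (β_ H H).hom ▷ H ⊗≫ (β_ X Y).hom ▷ (H ⊗ H ⊗ H) ⊗≫
          Y ◁ (a ▷ (H ⊗ H) ≫ X ◁ μ[H]) ⊗≫ 𝟙 _ := by
        rw [← whisker_exchange (β_ H Y).hom, ← whisker_exchange (β_ X Y).hom]; monoidal
    _ = 𝟙 _ ⊗≫ c ▷ Y ⊗≫ X ◁ H ◁ d ⊗≫ X ◁ (H ◁ d ≫ (β_ H (Y ⊗ H)).hom) ▷ H ⊗≫
          (β_ X Y).hom ▷ (H ⊗ H ⊗ H) ⊗≫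
          Y ◁ (a ▷ (H ⊗ H) ≫ X ◁ μ[H]) ⊗≫ 𝟙 _ := by
        rw [hd, braiding_tensor_right_hom]; monoidal
    _ = 𝟙 _ ⊗≫ c ▷ Y ⊗≫ X ◁ H ◁ d ⊗≫ X ◁ (β_ H Y).hom ▷ H ⊗≫ X ◁ d ▷ (H ⊗ H) ⊗≫
          ((X ⊗ Y ⊗ H) ◁ μ[H] ≫ ((α_ X Y H).inv ≫ (β_ X Y).hom ▷ H ≫ (α_ Y X H).hom ≫ Y ◁ a) ▷ H) ⊗≫
           𝟙 _ := by
        rw [braiding_naturality_right, whisker_exchange _ μ[H]]; monoidal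
    _ = 𝟙 _ ⊗≫ (c ▷ Y ≫ (X ⊗ H) ◁ d) ⊗≫ X ◁ (β_ H Y).hom ▷ H ⊗≫ X ◁ (Y ◁ μ[H] ≫ d ▷ H) ⊗≫
          ((α_ X Y H).inv ≫ (β_ X Y).hom ▷ H ≫ (α_ Y X H).hom ≫ Y ◁ a) ▷ H ⊗≫
           𝟙 _ := by
        rw [whisker_exchange d]; monoidal
    _ = _ := by
        rw [← MonoidalCategory.tensorHom_def]
        unfold psi tensorCoact tensorμ
        rw [MonoidalCategory.tensorHom_def]; monoidal

theorem antipode_inv_left [HopfObj H] [IsIso 𝒮[H]] :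
    Δ[H] ≫ (β_ H H).inv ≫ inv 𝒮[H] ▷ H ≫ μ[H] = ε[H] ≫ η[H] := by
  rw [← cancel_mono 𝒮[H]]
  simp only [Category.assoc, HopfObj.mul_antipode, HopfObj.one_antipode]
  rw [MonoidalCategory.tensorHom_def, Category.assoc, ← comp_whiskerRight_assoc, IsIso.inv_hom_id,
    id_whiskerRight, Category.id_comp, braiding_naturality_right_assoc,
    Iso.inv_hom_id_assoc, HopfObj.antipode_left]

theorem antipode_inv_right [HopfObj H] [IsIso 𝒮[H]] :
    Δ[H] ≫ (β_ H H).inv ≫ H ◁ inv 𝒮[H] ≫ μ[H] = ε[H] ≫ η[H] := by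
  rw [← cancel_mono 𝒮[H]]
  simp only [Category.assoc, HopfObj.mul_antipode, HopfObj.one_antipode]
  rw [MonoidalCategory.tensorHom_def', Category.assoc, ← whiskerLeft_comp_assoc, IsIso.inv_hom_id,
    whiskerLeft_id, Category.id_comp, braiding_naturality_left_assoc,
    Iso.inv_hom_id_assoc, HopfObj.antipode_right]

/-- The inverse of `psi a d`. -/
noncomputable def psiInv [HopfObj H] [IsIso 𝒮[H]] (a : X ⊗ H ⟶ X) (d : Y ⟶ Y ⊗ H) :
    Y ⊗ X ⟶ X ⊗ Y :=
  d ▷ X ≫ (α_ Y H X).hom ≫ Y ◁ (β_ X H).inv ≫ (α_ Y X H).inv ≫ (β_ X Y).inv ▷ H ≫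
    (α_ X Y H).hom ≫ X ◁ (Y ◁ inv 𝒮[H] ≫ (β_ H Y).inv) ≫ (α_ X H Y).inv ≫ a ▷ Y

theorem psi_psiInv [HopfObj H] [IsIso 𝒮[H]] (a : X ⊗ H ⟶ X) (d : Y ⟶ Y ⊗ H)
    (ha1 : X ◁ η[H] ≫ a = (ρ_ X).hom)
    (ha : a ▷ H ≫ a = (α_ X H H).hom ≫ X ◁ μ[H] ≫ a)
    (hd1 : d ≫ Y ◁ ε[H] = (ρ_ Y).inv)
    (hd : d ≫ Y ◁ Δ[H] = d ≫ d ▷ H ≫ (α_ Y H H).hom) :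
    psi a d ≫ psiInv a d = 𝟙 (X ⊗ Y) := by
  calc
    _ = 𝟙 _ ⊗≫ X ◁ d ⊗≫ (β_ X Y).hom ▷ H ⊗≫ (Y ◁ a ≫ d ▷ X) ⊗≫ Y ◁ (β_ X H).inv ⊗≫
          (β_ X Y).inv ▷ H ⊗≫ X ◁ Y ◁ inv 𝒮[H] ⊗≫ X ◁ (β_ H Y).inv ⊗≫ a ▷ Y := by
        unfold psi psiInv; monoidal
    _ = 𝟙 _ ⊗≫ X ◁ d ⊗≫ ((β_ X Y).hom ≫ d ▷ X) ▷ H ⊗≫ ((Y ⊗ H) ◁ a ≫ (β_ X (Y ⊗ H)).inv) ⊗≫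
          X ◁ Y ◁ inv 𝒮[H] ⊗≫ X ◁ (β_ H Y).inv ⊗≫ a ▷ Y := by
        rw [whisker_exchange, braiding_tensor_right_inv]; monoidal
    _ = 𝟙 _ ⊗≫ X ◁ (d ≫ d ▷ H ≫ (α_ Y H H).hom) ⊗≫
          ((β_ X (Y ⊗ H)).hom ≫ (β_ X (Y ⊗ H)).inv) ▷ H ⊗≫
          X ◁ (β_ H (Y ⊗ H)).inv ⊗≫ (a ▷ (Y ⊗ H) ≫
          X ◁ (Y ◁ inv 𝒮[H] ≫ (β_ H Y).inv)) ⊗≫ a ▷ Y := by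
        rw [← braiding_naturality_right, braiding_inv_naturality_right, braiding_tensor_left_inv]
        monoidal
    _ = 𝟙 _ ⊗≫ X ◁ (d ≫ Y ◁ Δ[H]) ⊗≫
          X ◁ Y ◁ (β_ H H).inv ⊗≫ X ◁ ((β_ H Y).inv ▷ H ≫ (α_ H Y H).hom ≫ H ◁ Y ◁ inv 𝒮[H]) ⊗≫
          X ◁ H ◁ (β_ H Y).inv ⊗≫ (a ▷ H ≫ a) ▷ Y := by
        rw [Iso.hom_inv_id, ← hd, ← whisker_exchange a, braiding_tensor_right_inv]; monoidal
    _ = 𝟙 _ ⊗≫ X ◁ d ⊗≫ X ◁ Y ◁ Δ[H] ⊗≫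
          X ◁ Y ◁ (β_ H H).inv ⊗≫ X ◁ ((β_ H Y).inv ▷ H ≫ (H ⊗ Y) ◁ inv 𝒮[H]) ⊗≫
          X ◁ H ◁ (β_ H Y).inv ⊗≫ X ◁ μ[H] ▷ Y ⊗≫ a ▷ Y := by
        rw [ha]; monoidal
    _ = 𝟙 _ ⊗≫ X ◁ d ⊗≫ X ◁ Y ◁ (Δ[H] ≫ (β_ H H).inv ≫ H ◁ inv 𝒮[H]) ⊗≫
          X ◁ ((β_ (H ⊗ H) Y).inv ≫ μ[H] ▷ Y) ⊗≫ a ▷ Y := by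
        rw [← whisker_exchange, braiding_tensor_left_inv]; monoidal
    _ = 𝟙 _ ⊗≫ X ◁ d ⊗≫ X ◁ Y ◁ (Δ[H] ≫ (β_ H H).inv ≫ H ◁ inv 𝒮[H] ≫ μ[H]) ⊗≫
          X ◁ ((β_ H Y).inv) ⊗≫ a ▷ Y := by
        rw [← braiding_inv_naturality_right]; monoidal
    _ = 𝟙 _ ⊗≫ X ◁ (d ≫ Y ◁ ε[H]) ⊗≫ X ◁ (Y ◁ η[H] ≫ (β_ H Y).inv) ⊗≫ a ▷ Y := by
        rw [antipode_inv_right]; monoidal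
    _ = 𝟙 _ ⊗≫ (X ◁ η[H] ≫ a) ▷ Y := by
        rw [hd1, braiding_inv_naturality_right, braiding_inv_tensorUnit_left]; monoidal
    _ = _ := by rw [ha1]; monoidal

theorem psiInv_psi [HopfObj H] [IsIso 𝒮[H]] (a : X ⊗ H ⟶ X) (d : Y ⟶ Y ⊗ H)
    (ha1 : X ◁ η[H] ≫ a = (ρ_ X).hom)
    (ha : a ▷ H ≫ a = (α_ X H H).hom ≫ X ◁ μ[H] ≫ a)
    (hd1 : d ≫ Y ◁ ε[H] = (ρ_ Y).inv)
    (hd : d ≫ Y ◁ Δ[H] = d ≫ d ▷ H ≫ (α_ Y H H).hom) :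
    psiInv a d ≫ psi a d = 𝟙 (Y ⊗ X) := by
  calc
    _ = 𝟙 _ ⊗≫ d ▷ X ⊗≫ Y ◁ (β_ X H).inv ⊗≫ (β_ X Y).inv ▷ H ⊗≫ X ◁ Y ◁ inv 𝒮[H] ⊗≫
          X ◁ (β_ H Y).inv ⊗≫ (a ▷ Y ≫ X ◁ d) ⊗≫ (β_ X Y).hom ▷ H ⊗≫ Y ◁ a := by
        unfold psi psiInv; monoidal
    _ = 𝟙 _ ⊗≫ d ▷ X ⊗≫ Y ◁ (β_ X H).inv ⊗≫ (β_ X Y).inv ▷ H ⊗≫ X ◁ Y ◁ inv 𝒮[H] ⊗≫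
          X ◁ ((β_ H Y).inv ≫ H ◁ d) ⊗≫ (a ▷ Y ≫ (β_ X Y).hom) ▷ H ⊗≫ Y ◁ a := by
        rw [← whisker_exchange]; monoidal
    _ = 𝟙 _ ⊗≫ d ▷ X ⊗≫ Y ◁ (β_ X H).inv ⊗≫ (β_ X Y).inv ▷ H ⊗≫
          X ◁ (Y ◁ inv 𝒮[H] ≫ d ▷ H) ⊗≫
          X ◁ Y ◁ (β_ H H).inv ⊗≫ X ◁ ((β_ H Y).inv ≫ (β_ H Y).hom) ▷ H ⊗≫
          (β_ X Y).hom ▷ (H ⊗ H) ⊗≫ Y ◁ (a ▷ H ≫ a) := by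
        rw [← braiding_inv_naturality_left, braiding_naturality_left, braiding_tensor_left_hom,
          braiding_tensor_right_inv]; monoidal
    _ = 𝟙 _ ⊗≫ d ▷ X ⊗≫ Y ◁ (β_ X H).inv ⊗≫ ((β_ X Y).inv ≫ X ◁ d) ▷ H ⊗≫
          X ◁ Y ◁ H ◁ inv 𝒮[H] ⊗≫
          ((X ⊗ Y) ◁ (β_ H H).inv ≫
          (β_ X Y).hom ▷ (H ⊗ H)) ⊗≫ Y ◁ X ◁ μ[H] ⊗≫ Y ◁ a := by
        rw [Iso.inv_hom_id, ha, whisker_exchange d]; monoidal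
    _ = 𝟙 _ ⊗≫ d ▷ X ⊗≫ (Y ◁ (β_ X H).inv ≫ (α_ Y X H).inv ≫ d ▷ X ▷ H) ⊗≫
          Y ◁ (β_ X H).inv ▷ H ⊗≫
          ((β_ X Y).inv ▷ (H ⊗ H) ≫ (X ⊗ Y) ◁ (H ◁ inv 𝒮[H])) ⊗≫
          ((β_ X Y).hom ▷ (H ⊗ H) ≫ (Y ⊗ X) ◁ (β_ H H).inv) ⊗≫ Y ◁ X ◁ μ[H] ⊗≫ Y ◁ a := by
        rw [← braiding_inv_naturality_left, whisker_exchange (β_ X Y).hom, braiding_tensor_right_inv]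
        monoidal
    _ = 𝟙 _ ⊗≫ d ▷ X ⊗≫ (Y ◁ (β_ X H).inv ≫ d ▷ (X ⊗ H)) ⊗≫
          Y ◁ (β_ X H).inv ▷ H ⊗≫ Y ◁ X ◁ H ◁ inv 𝒮[H] ⊗≫
          ((β_ X Y).inv ≫ (β_ X Y).hom) ▷ (H ⊗ H) ⊗≫
          Y ◁ X ◁ (β_ H H).inv ⊗≫ Y ◁ X ◁ μ[H] ⊗≫ Y ◁ a := by
        rw [← whisker_exchange (β_ X Y).inv]; monoidal
    _ = 𝟙 _ ⊗≫ (d ≫ d ▷ H ≫ (α_ Y H H).hom) ▷ X ⊗≫ Y ◁ H ◁ (β_ X H).inv ⊗≫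
          Y ◁ (β_ X H).inv ▷ H ⊗≫ Y ◁ X ◁ (H ◁ inv 𝒮[H] ≫ (β_ H H).inv) ⊗≫
          Y ◁ X ◁ μ[H] ⊗≫ Y ◁ a := by
        rw [Iso.inv_hom_id, whisker_exchange d]; monoidal
    _ = 𝟙 _ ⊗≫ d ▷ X ⊗≫ Y ◁ (Δ[H] ▷ X ≫ (β_ X (H ⊗ H)).inv ≫
          X ◁ ((β_ H H).inv ≫ inv 𝒮[H] ▷ H ≫ μ[H])) ⊗≫ Y ◁ a := by
        rw [← hd, braiding_inv_naturality_right, braiding_tensor_right_inv]; monoidal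
    _ = 𝟙 _ ⊗≫ d ▷ X ⊗≫ Y ◁ ((Δ[H] ≫ (β_ H H).inv ≫ inv 𝒮[H] ▷ H ≫ μ[H]) ▷ X ≫
          (β_ X H).inv) ⊗≫ Y ◁ a := by
        simp only [braiding_inv_naturality_left, braiding_inv_naturality_left_assoc]; monoidal
    _ = 𝟙 _ ⊗≫ (d ≫ Y ◁ ε[H]) ▷ X ⊗≫ Y ◁ (η[H] ▷ X ≫ (β_ X H).inv) ⊗≫ Y ◁ a := by
        rw [antipode_inv_left]; monoidal
    _ = 𝟙 _ ⊗≫ Y ◁ (X ◁ η[H] ≫ a) := by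
        rw [hd1, braiding_inv_naturality_left, braiding_inv_tensorUnit_right]; monoidal
    _ = _ := by rw [ha1]; monoidal

theorem tensorAct_natural [ComonObj H] {X' Y' : 𝒞} (a : X ⊗ H ⟶ X) (a' : X' ⊗ H ⟶ X')
    (b : Y ⊗ H ⟶ Y) (b' : Y' ⊗ H ⟶ Y') (f : X ⟶ X') (g : Y ⟶ Y')
    (hf : a ≫ f = f ▷ H ≫ a') (hg : b ≫ g = g ▷ H ≫ b') :
    tensorAct a b ≫ (f ⊗ₘ g) = (f ⊗ₘ g) ▷ H ≫ tensorAct a' b' := by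
  unfold tensorAct
  simp only [Category.assoc]
  rw [tensorHom_comp_tensorHom, hf, hg, ← tensorHom_comp_tensorHom, ← tensorμ_natural_left_assoc,
    whisker_exchange_assoc]

theorem tensorCoact_natural [MonObj H] {X' Y' : 𝒞} (c : X ⟶ X ⊗ H) (c' : X' ⟶ X' ⊗ H)
    (d : Y ⟶ Y ⊗ H) (d' : Y' ⟶ Y' ⊗ H) (f : X ⟶ X') (g : Y ⟶ Y')
    (hf : c ≫ f ▷ H = f ≫ c') (hg : d ≫ g ▷ H = g ≫ d') :
    tensorCoact c d ≫ (f ⊗ₘ g) ▷ H = (f ⊗ₘ g) ≫ tensorCoact c' d' := by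
  unfold tensorCoact
  simp only [Category.assoc]
  rw [tensorHom_comp_tensorHom_assoc, ← hf, ← hg, ← tensorHom_comp_tensorHom_assoc,
    whisker_exchange, ← tensorHom_id f, ← tensorHom_id g, tensorμ_natural_assoc,
    id_tensorHom_id, tensorHom_id]

/-- The trivial action on the unit object. -/
def unitAct (H : 𝒞) [ComonObj H] : 𝟙_ 𝒞 ⊗ H ⟶ 𝟙_ 𝒞 := (λ_ H).hom ≫ ε[H]

/-- The trivial coaction on the unit object. -/
def unitCoact (H : 𝒞) [MonObj H] : 𝟙_ 𝒞 ⟶ 𝟙_ 𝒞 ⊗ H := η[H] ≫ (λ_ H).inv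

theorem unitAct_one [BimonObj H] : 𝟙_ 𝒞 ◁ η[H] ≫ unitAct H = (ρ_ (𝟙_ 𝒞)).hom := by
  simp [unitAct, unitors_equal]

theorem unitAct_mul [BimonObj H] : unitAct H ▷ H ≫ unitAct H =
    (α_ (𝟙_ 𝒞) H H).hom ≫ 𝟙_ 𝒞 ◁ μ[H] ≫ unitAct H := by
  simp [unitAct, MonoidalCategory.tensorHom_def]

theorem unitCoact_counit [BimonObj H] : unitCoact H ≫ 𝟙_ 𝒞 ◁ ε[H] = (ρ_ (𝟙_ 𝒞)).inv := by
  simp [unitCoact, unitors_inv_equal]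


theorem tensorAct_assoc [ComonObj H] (a : X ⊗ H ⟶ X) (b : Y ⊗ H ⟶ Y) (c : Z ⊗ H ⟶ Z) :
    tensorAct (tensorAct a b) c ≫ (α_ X Y Z).hom =
      (α_ X Y Z).hom ▷ H ≫ tensorAct a (tensorAct b c) := by
  unfold tensorAct
  have h1 : ((X ⊗ Y) ◁ Δ ≫ tensorμ X Y H H ≫ (a ⊗ₘ b) ⊗ₘ c) =
      ((𝟙 X ⊗ₘ 𝟙 Y) ⊗ₘ Δ) ▷ (Z ⊗ H) ≫ tensorμ X Y H H ▷ (Z ⊗ H) ≫ ((a ⊗ₘ b) ⊗ₘ c) := by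
    rw [id_tensorHom_id, id_tensorHom, ← tensorHom_id, ← tensorHom_id, tensorHom_comp_tensorHom,
      tensorHom_comp_tensorHom, Category.id_comp, Category.id_comp]
  have h2 : (a ⊗ₘ (Y ⊗ Z) ◁ Δ ≫ tensorμ Y Z H H ≫ (b ⊗ₘ c)) =
      (X ⊗ H) ◁ ((𝟙 Y ⊗ₘ 𝟙 Z) ⊗ₘ Δ) ≫ (X ⊗ H) ◁ tensorμ Y Z H H ≫ (a ⊗ₘ (b ⊗ₘ c)) := by
    rw [id_tensorHom_id, id_tensorHom, ← whiskerLeft_comp_assoc, ← id_tensorHom (X ⊗ H),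
      tensorHom_comp_tensorHom, Category.id_comp, Category.assoc]
  have h3 : tensorμ (X ⊗ Y) Z H H ≫ ((𝟙 X ⊗ₘ 𝟙 Y) ⊗ₘ Δ) ▷ (Z ⊗ H) =
      (((𝟙 X ⊗ₘ 𝟙 Y) ⊗ₘ 𝟙 Z) ⊗ₘ (Δ[H] ⊗ₘ 𝟙 H)) ≫ tensorμ (X ⊗ Y) Z (H ⊗ H) H := by
    rw [tensorμ_natural]; simp
  have h4 : tensorμ X (Y ⊗ Z) H H ≫ (X ⊗ H) ◁ ((𝟙 Y ⊗ₘ 𝟙 Z) ⊗ₘ Δ) =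
      ((𝟙 X ⊗ₘ (𝟙 Y ⊗ₘ 𝟙 Z)) ⊗ₘ (𝟙 H ⊗ₘ Δ[H])) ≫ tensorμ X (Y ⊗ Z) H (H ⊗ H) := by
    rw [tensorμ_natural]; simp
  rw [h1, h2]
  simp only [Category.assoc]
  rw [reassoc_of% h3, reassoc_of% h4, associator_naturality, associator_monoidal_assoc]
  simp only [id_tensorHom, tensorHom_id]
  simp only [← Category.assoc]
  congr 3
  calc
    _ = ((X ⊗ Y) ⊗ Z) ◁ (Δ[H] ≫ Δ[H] ▷ H ≫ (α_ H H H).hom) ≫ (α_ X Y Z).hom ▷ (H ⊗ H ⊗ H) := by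
      rw [MonoidalCategory.tensorHom_def']; monoidal
    _ = _ := by
      rw [← ComonObj.comul_assoc]; monoidal

theorem tensorCoact_assoc [MonObj H] (c : X ⟶ X ⊗ H) (d : Y ⟶ Y ⊗ H) (e : Z ⟶ Z ⊗ H) :
    tensorCoact (tensorCoact c d) e ≫ (α_ X Y Z).hom ▷ H =
      (α_ X Y Z).hom ≫ tensorCoact c (tensorCoact d e) := by
  unfold tensorCoact
  have h1 : ((c ⊗ₘ d) ≫ tensorμ X H Y H ≫ (X ⊗ Y) ◁ μ ⊗ₘ e) =
      ((c ⊗ₘ d) ⊗ₘ e) ≫ tensorμ X H Y H ▷ (Z ⊗ H) ≫ ((𝟙 (X ⊗ Y) ⊗ₘ μ) ⊗ₘ (𝟙 Z ⊗ₘ 𝟙 H)) := by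
    rw [id_tensorHom_id, id_tensorHom, ← tensorHom_id, tensorHom_comp_tensorHom,
      tensorHom_comp_tensorHom, Category.id_comp, Category.comp_id]
  have h2 : (c ⊗ₘ (d ⊗ₘ e) ≫ tensorμ Y H Z H ≫ (Y ⊗ Z) ◁ μ) =
      (c ⊗ₘ (d ⊗ₘ e)) ≫ (X ⊗ H) ◁ tensorμ Y H Z H ≫ ((𝟙 X ⊗ₘ 𝟙 H) ⊗ₘ (𝟙 (Y ⊗ Z) ⊗ₘ μ)) := by
    rw [id_tensorHom_id, id_tensorHom, id_tensorHom, ← whiskerLeft_comp, ← id_tensorHom (X ⊗ H),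
      tensorHom_comp_tensorHom, Category.comp_id]
  rw [h1, h2]
  simp only [Category.assoc]
  rw [tensorμ_natural_assoc, tensorμ_natural_assoc, ← associator_naturality_assoc]
  rw [← tensor_associativity_assoc]
  simp only [id_tensorHom, tensorHom_id]
  congr 3
  calc
    _ = (α_ X Y Z).hom ▷ ((H ⊗ H) ⊗ H) ≫ (X ⊗ Y ⊗ Z) ◁ (μ[H] ▷ H ≫ μ[H]) := by monoidal
    _ = _ := by
      rw [MonObj.mul_assoc, MonoidalCategory.tensorHom_def]; monoidal

theorem unitCoact_coassoc [BimonObj H] : unitCoact H ≫ 𝟙_ 𝒞 ◁ Δ[H] =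
    unitCoact H ≫ unitCoact H ▷ H ≫ (α_ (𝟙_ 𝒞) H H).hom := by
  have h : η[H] ≫ Δ[H] = (λ_ (𝟙_ 𝒞)).inv ≫ (η[H] ⊗ₘ η[H]) := by
    simp [MonObj.tensorObj.one_def]
  unfold unitCoact
  calc
    _ = η[H] ≫ Δ[H] ≫ (λ_ _).inv := by simp
    _ = _ := by rw [reassoc_of% h, MonoidalCategory.tensorHom_def']; monoidal

theorem psi_unit_left [BimonObj H] (c : X ⟶ X ⊗ H) (hc : c ≫ X ◁ ε[H] = (ρ_ X).inv) :
    psi (unitAct H) c = (λ_ X).hom ≫ (ρ_ X).inv := by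
  unfold psi unitAct
  rw [braiding_tensorUnit_left]
  calc
    _ = 𝟙 _ ⊗≫ (c ≫ X ◁ ε[H]) ⊗≫ 𝟙 _ := by monoidal
    _ = _ := by rw [hc]; monoidal

theorem psi_unit_right [BimonObj H] (a : X ⊗ H ⟶ X) (ha : X ◁ η[H] ≫ a = (ρ_ X).hom) :
    psi a (unitCoact H) = (ρ_ X).hom ≫ (λ_ X).inv := by
  unfold psi unitCoact
  rw [braiding_tensorUnit_right]
  calc
    _ = 𝟙 _ ⊗≫ (X ◁ η[H] ≫ a) ⊗≫ 𝟙 _ := by monoidal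
    _ = _ := by rw [ha]; monoidal

theorem unit_isCrossed [BimonObj H] : IsCrossed (unitAct H) (unitCoact H) := by
  unfold IsCrossed
  rw [psi_unit_left _ (ComonObj.comul_counit H), psi_unit_right _ (MonObj.mul_one H)]
  unfold unitAct unitCoact tensorμ
  symm
  calc
    _ = 𝟙 _ ⊗≫ ((η[H] ▷ H) ≫ H ◁ Δ[H]) ⊗≫ ((β_ H H).hom ≫ ε[H] ▷ H) ▷ H ⊗≫ μ[H] ⊗≫ 𝟙 _ := by
      rw [MonoidalCategory.tensorHom_def, MonoidalCategory.tensorHom_def]; monoidal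
    _ = 𝟙 _ ⊗≫ Δ[H] ⊗≫ (η[H] ▷ H ≫ H ◁ ε[H]) ▷ H ⊗≫ μ[H] ⊗≫ 𝟙 _ := by
      rw [← whisker_exchange, ← braiding_naturality_right, braiding_tensorUnit_right]; monoidal
    _ = 𝟙 _ ⊗≫ (Δ[H] ≫ ε[H] ▷ H) ⊗≫ (η[H] ▷ H ≫ μ[H]) ⊗≫ 𝟙 _ := by
      rw [← whisker_exchange]; monoidal
    _ = _ := by rw [ComonObj.counit_comul, MonObj.one_mul]; monoidal

theorem tensorAct_leftUnitor [BimonObj H] (a : X ⊗ H ⟶ X) :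
    tensorAct (unitAct H) a ≫ (λ_ X).hom = (λ_ X).hom ▷ H ≫ a := by
  unfold tensorAct tensorμ unitAct
  calc
    _ = 𝟙 _ ⊗≫ X ◁ Δ[H] ⊗≫ ((β_ X H).hom ≫ ε[H] ▷ X) ▷ H ⊗≫ a := by
      rw [MonoidalCategory.tensorHom_def]; monoidal
    _ = 𝟙 _ ⊗≫ X ◁ (Δ[H] ≫ ε[H] ▷ H) ⊗≫ a := by
      rw [← braiding_naturality_right, braiding_tensorUnit_right]; monoidal
    _ = _ := by rw [ComonObj.counit_comul]; monoidal

theorem tensorAct_rightUnitor [BimonObj H] (a : X ⊗ H ⟶ X) :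
    tensorAct a (unitAct H) ≫ (ρ_ X).hom = (ρ_ X).hom ▷ H ≫ a := by
  unfold tensorAct tensorμ unitAct
  rw [braiding_tensorUnit_left]
  calc
    _ = 𝟙 _ ⊗≫ X ◁ (Δ[H] ≫ H ◁ ε[H]) ⊗≫ a := by
      rw [MonoidalCategory.tensorHom_def']; monoidal
    _ = _ := by rw [ComonObj.comul_counit]; monoidal

theorem tensorCoact_leftUnitor [BimonObj H] (c : X ⟶ X ⊗ H) :
    tensorCoact (unitCoact H) c ≫ (λ_ X).hom ▷ H = (λ_ X).hom ≫ c := by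
  unfold tensorCoact tensorμ unitCoact
  calc
    _ = 𝟙 _ ⊗≫ c ⊗≫ (η[H] ▷ X ≫ (β_ H X).hom) ▷ H ⊗≫ X ◁ μ[H] := by
      rw [MonoidalCategory.tensorHom_def']; monoidal
    _ = 𝟙 _ ⊗≫ c ⊗≫ X ◁ (η[H] ▷ H ≫ μ[H]) := by
      rw [braiding_naturality_left, braiding_tensorUnit_left]; monoidal
    _ = _ := by rw [MonObj.one_mul]; monoidal

theorem tensorCoact_rightUnitor [BimonObj H] (c : X ⟶ X ⊗ H) :
    tensorCoact c (unitCoact H) ≫ (ρ_ X).hom ▷ H = (ρ_ X).hom ≫ c := by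
  unfold tensorCoact tensorμ unitCoact
  rw [braiding_tensorUnit_right]
  calc
    _ = 𝟙 _ ⊗≫ c ⊗≫ X ◁ (H ◁ η[H] ≫ μ[H]) := by
      rw [MonoidalCategory.tensorHom_def]; monoidal
    _ = _ := by rw [MonObj.mul_one]; monoidal

end Raw
/-! ### The braided category of crossed modules -/

section Category

variable {𝒞 : Type u} [Category.{v} 𝒞] [MonoidalCategory 𝒞] [BraidedCategory 𝒞]

/-- A right crossed module over the bialgebra `H`: an object with a right action and a right
coaction of `H` that satisfy the compatibility condition `IsCrossed`. -/
structure CrossedMod (H : 𝒞) [BimonObj H] where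
  /-- the underlying object -/
  X : 𝒞
  /-- the action -/
  act : X ⊗ H ⟶ X
  /-- the coaction -/
  coact : X ⟶ X ⊗ H
  act_one : X ◁ η[H] ≫ act = (ρ_ X).hom
  act_mul : act ▷ H ≫ act = (α_ X H H).hom ≫ X ◁ μ[H] ≫ act
  coact_counit : coact ≫ X ◁ ε[H] = (ρ_ X).inv
  coact_comul : coact ≫ X ◁ Δ[H] = coact ≫ coact ▷ H ≫ (α_ X H H).hom
  crossed : IsCrossed act coact

namespace CrossedMod

/-- A morphism of crossed modules: a morphism of modules and of comodules. -/
@[ext]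
structure Hom {H : 𝒞} [BimonObj H] (M N : CrossedMod H) where
  /-- the underlying morphism -/
  hom : M.X ⟶ N.X
  act_hom : M.act ≫ hom = hom ▷ H ≫ N.act
  coact_hom : M.coact ≫ hom ▷ H = hom ≫ N.coact

variable {H : 𝒞}

section Bimon

variable [BimonObj H]

instance : Category (CrossedMod H) where
  Hom M N := Hom M N
  id M := ⟨𝟙 M.X, by simp, by simp⟩
  comp {L M N} f g := ⟨f.hom ≫ g.hom,
    by rw [← Category.assoc, f.act_hom, Category.assoc, g.act_hom, comp_whiskerRight,
      Category.assoc],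
    by rw [comp_whiskerRight, ← Category.assoc, f.coact_hom, Category.assoc, g.coact_hom,
      Category.assoc]⟩

@[ext]
theorem hom_ext {M N : CrossedMod H} {f g : M ⟶ N} (h : f.hom = g.hom) : f = g :=
  Hom.ext h

@[simp]
theorem id_hom (M : CrossedMod H) : (𝟙 M : M ⟶ M).hom = 𝟙 M.X := rfl

@[simp]
theorem comp_hom {L M N : CrossedMod H} (f : L ⟶ M) (g : M ⟶ N) :
    (f ≫ g).hom = f.hom ≫ g.hom := rfl

/-- An invertible morphism of `𝒞` between crossed modules, compatible with the actions and the
coactions, is an isomorphism of crossed modules. -/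
def mkIso {M N : CrossedMod H} (e : M.X ≅ N.X) (h₁ : M.act ≫ e.hom = e.hom ▷ H ≫ N.act)
    (h₂ : M.coact ≫ e.hom ▷ H = e.hom ≫ N.coact) : M ≅ N where
  hom := ⟨e.hom, h₁, h₂⟩
  inv := ⟨e.inv,
    by rw [← cancel_mono e.hom, Category.assoc, Category.assoc, h₁, ← comp_whiskerRight_assoc]
       simp,
    by rw [← cancel_epi e.hom, ← reassoc_of% h₂, ← comp_whiskerRight]
       simp⟩
  hom_inv_id := hom_ext e.hom_inv_id
  inv_hom_id := hom_ext e.inv_hom_id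

/-- The tensor product of crossed modules: diagonal action and codiagonal coaction. -/
def tensor (M N : CrossedMod H) : CrossedMod H where
  X := M.X ⊗ N.X
  act := tensorAct M.act N.act
  coact := tensorCoact M.coact N.coact
  act_one := tensorAct_one _ _ M.act_one N.act_one
  act_mul := tensorAct_mul _ _ M.act_mul N.act_mul
  coact_counit := tensorCoact_counit _ _ M.coact_counit N.coact_counit
  coact_comul := tensorCoact_coassoc _ _ M.coact_comul N.coact_comul
  crossed := M.crossed.tensor _ _ _ _ N.crossed

variable (H) in
/-- The unit crossed module: the unit object with trivial action and coaction. -/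
def unit : CrossedMod H where
  X := 𝟙_ 𝒞
  act := unitAct H
  coact := unitCoact H
  act_one := unitAct_one
  act_mul := unitAct_mul
  coact_counit := unitCoact_counit
  coact_comul := unitCoact_coassoc
  crossed := unit_isCrossed

/-- The tensor product of morphisms of crossed modules. -/
def tensorMap {M M' N N' : CrossedMod H} (f : M ⟶ M') (g : N ⟶ N') : tensor M N ⟶ tensor M' N' :=
  ⟨f.hom ⊗ₘ g.hom, tensorAct_natural _ _ _ _ _ _ f.act_hom g.act_hom,
    tensorCoact_natural _ _ _ _ _ _ f.coact_hom g.coact_hom⟩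

instance : MonoidalCategoryStruct (CrossedMod H) where
  tensorObj := tensor
  tensorHom := tensorMap
  whiskerLeft M _ _ f :=
    ⟨M.X ◁ f.hom, by simpa [tensorMap] using (tensorMap (𝟙 M) f).act_hom,
      by simpa [tensorMap] using (tensorMap (𝟙 M) f).coact_hom⟩
  whiskerRight f N :=
    ⟨f.hom ▷ N.X, by simpa [tensorMap] using (tensorMap f (𝟙 N)).act_hom,
      by simpa [tensorMap] using (tensorMap f (𝟙 N)).coact_hom⟩
  tensorUnit := unit H
  associator L M N := mkIso (α_ L.X M.X N.X) (tensorAct_assoc _ _ _) (tensorCoact_assoc _ _ _)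
  leftUnitor M := mkIso (λ_ M.X) (tensorAct_leftUnitor _) (tensorCoact_leftUnitor _)
  rightUnitor M := mkIso (ρ_ M.X) (tensorAct_rightUnitor _) (tensorCoact_rightUnitor _)

variable (H) in
/-- The forgetful functor. -/
def forget : CrossedMod H ⥤ 𝒞 where
  obj M := M.X
  map f := f.hom

instance : (forget H).Faithful where
  map_injective h := hom_ext h

instance : MonoidalCategory (CrossedMod H) :=
  Monoidal.induced (forget H)
    { μIso := fun M N => Iso.refl (M.X ⊗ N.X)
      εIso := Iso.refl (𝟙_ 𝒞)
      whiskerLeft_eq := fun M _ _ f => by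
        change M.X ◁ f.hom = 𝟙 _ ≫ M.X ◁ f.hom ≫ 𝟙 _
        simp
      whiskerRight_eq := fun f N => by
        change f.hom ▷ N.X = 𝟙 _ ≫ f.hom ▷ N.X ≫ 𝟙 _
        simp
      tensorHom_eq := fun f g => by
        change (f.hom ⊗ₘ g.hom) = 𝟙 _ ≫ (f.hom ⊗ₘ g.hom) ≫ 𝟙 _
        simp
      associator_eq := fun L M N => by
        change (α_ L.X M.X N.X).hom = (𝟙 _ ≫ (𝟙 _ ⊗ₘ 𝟙 _)) ≫ (α_ L.X M.X N.X).hom ≫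
          (𝟙 _ ⊗ₘ 𝟙 _) ≫ 𝟙 _
        simp
      leftUnitor_eq := fun M => by
        change (λ_ M.X).hom = (𝟙 _ ≫ (𝟙 _ ⊗ₘ 𝟙 _)) ≫ (λ_ M.X).hom
        simp
      rightUnitor_eq := fun M => by
        change (ρ_ M.X).hom = (𝟙 _ ≫ (𝟙 _ ⊗ₘ 𝟙 _)) ≫ (ρ_ M.X).hom
        simp }

end Bimon

/-- The braiding of `M ⊗ N` in the category of crossed modules is the composite
`M ⊗ N ⟶ M ⊗ N ⊗ H ⟶ N ⊗ M ⊗ H ⟶ N ⊗ M` of the coaction of `N`, the braiding of `𝒞` and the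
action on `M`. -/
noncomputable instance [HopfObj H] [IsIso 𝒮[H]] : BraidedCategory (CrossedMod H) where
  braiding M N := mkIso
    ⟨psi M.act N.coact, psiInv M.act N.coact,
      psi_psiInv _ _ M.act_one M.act_mul N.coact_counit N.coact_comul,
      psiInv_psi _ _ M.act_one M.act_mul N.coact_counit N.coact_comul⟩
    (psi_act _ _ _ M.act_mul N.crossed)
    (psi_coact _ _ _ N.coact_comul M.crossed).symm
  braiding_naturality_left f N := hom_ext (psi_naturality_left _ _ _ f.hom f.act_hom).symm
  braiding_naturality_right M _ _ f := hom_ext (psi_naturality_right _ _ _ f.hom f.coact_hom).symm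
  hexagon_forward L M N := hom_ext <| by
    change (α_ L.X M.X N.X).hom ≫ psi L.act (tensorCoact M.coact N.coact) ≫
      (α_ M.X N.X L.X).hom = psi L.act M.coact ▷ N.X ≫ (α_ M.X L.X N.X).hom ≫
        M.X ◁ psi L.act N.coact
    rw [psi_tensor_right _ _ _ L.act_mul]
    simp
  hexagon_reverse L M N := hom_ext <| by
    change (α_ L.X M.X N.X).inv ≫ psi (tensorAct L.act M.act) N.coact ≫
      (α_ N.X L.X M.X).inv = L.X ◁ psi M.act N.coact ≫ (α_ L.X N.X M.X).inv ≫
        psi L.act N.coact ▷ M.X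
    rw [psi_tensor_left _ _ _ N.coact_comul]
    simp

end CrossedMod

end Category

/-! ### Hopf algebras and cross products -/

section Hopf

variable {𝒞 : Type u} [Category.{v} 𝒞] [MonoidalCategory 𝒞] [BraidedCategory 𝒞]

variable (𝒞) in
/-- A Hopf algebra, with invertible antipode, in a braided monoidal category. -/
structure HopfAlg where
  /-- the underlying object -/
  X : 𝒞
  [hopf : HopfObj X]
  [isIso_antipode : IsIso 𝒮[X]]

attribute [instance] HopfAlg.hopf HopfAlg.isIso_antipode

/-- The five structure morphisms of a Hopf algebra, without axioms. Two Hopf algebra structures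
on the same object are equal if and only if these five morphisms are equal. -/
@[ext]
structure HopfMaps (X : 𝒞) where
  /-- the unit -/
  one : 𝟙_ 𝒞 ⟶ X
  /-- the multiplication -/
  mul : X ⊗ X ⟶ X
  /-- the counit -/
  counit : X ⟶ 𝟙_ 𝒞
  /-- the comultiplication -/
  comul : X ⟶ X ⊗ X
  /-- the antipode -/
  antipode : X ⟶ X

/-- The five structure morphisms of a Hopf algebra structure on `X`. -/
def hopfMaps {X : 𝒞} (h : HopfObj X) : HopfMaps X where
  one := h.toBimonObj.toMonObj.one
  mul := h.toBimonObj.toMonObj.mul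
  counit := h.toBimonObj.toComonObj.counit
  comul := h.toBimonObj.toComonObj.comul
  antipode := h.antipode

/-- Transport of the five structure morphisms along an isomorphism. -/
def HopfMaps.transport {X Y : 𝒞} (m : HopfMaps X) (e : X ≅ Y) : HopfMaps Y where
  one := m.one ≫ e.hom
  mul := (e.inv ⊗ₘ e.inv) ≫ m.mul ≫ e.hom
  counit := e.inv ≫ m.counit
  comul := e.inv ≫ m.comul ≫ (e.hom ⊗ₘ e.hom)
  antipode := e.inv ≫ m.antipode ≫ e.hom

/-- The morphism `(X ⊗ Y) ⊗ (Z ⊗ W) ⟶ (X ⊗ Z) ⊗ (Y ⊗ W)` induced by `f : Y ⊗ Z ⟶ Z ⊗ Y`. -/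
def interchange (X : 𝒞) {Y Z : 𝒞} (W : 𝒞) (f : Y ⊗ Z ⟶ Z ⊗ Y) :
    (X ⊗ Y) ⊗ (Z ⊗ W) ⟶ (X ⊗ Z) ⊗ (Y ⊗ W) :=
  (α_ X Y (Z ⊗ W)).hom ≫ X ◁ ((α_ Y Z W).inv ≫ f ▷ W ≫ (α_ Z Y W).hom) ≫
    (α_ X Z (Y ⊗ W)).inv

/-- The structure morphisms of the cross product `A ⋉ B` of a Hopf algebra `A` in `𝒞` and a Hopf
algebra `B` in the category of crossed modules over `A`. In element notation, with `◁` the action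
of `A` on `B` and `b ↦ b₀ ⊗ b₁` the coaction,
`(a ⊗ b)(a' ⊗ b') = a a'₁ ⊗ (b ◁ a'₂) b'` and
`Δ(a ⊗ b) = (a₁ ⊗ (b₁)₀) ⊗ (a₂ (b₁)₁ ⊗ b₂)`. -/
def crossMaps (A : HopfAlg 𝒞) (B : HopfAlg (CrossedMod A.X)) : HopfMaps (A.X ⊗ B.X.X) where
  one := (λ_ (𝟙_ 𝒞)).inv ≫ (η[A.X] ⊗ₘ η[B.X].hom)
  mul := interchange A.X B.X.X (psi B.X.act Δ[A.X]) ≫ (μ[A.X] ⊗ₘ μ[B.X].hom)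
  counit := (ε[A.X] ⊗ₘ ε[B.X].hom) ≫ (λ_ (𝟙_ 𝒞)).hom
  comul := (Δ[A.X] ⊗ₘ Δ[B.X].hom) ≫ interchange A.X B.X.X (psi μ[A.X] B.X.coact)
  antipode := psi μ[A.X] B.X.coact ≫ (𝒮[B.X].hom ⊗ₘ 𝒮[A.X]) ≫ psi B.X.act Δ[A.X]

/-- The assertion that the structure morphisms of the cross product make `A ⊗ B` into a Hopf
algebra with invertible antipode, i.e. that the Hopf algebra `A ⋉ B` exists. The Hopf algebra
structure is uniquely determined, see the instance below. -/
structure CrossProduct (A : HopfAlg 𝒞) (B : HopfAlg (CrossedMod A.X)) where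
  /-- the Hopf algebra structure -/
  hopf : HopfObj (A.X ⊗ B.X.X)
  isIso_antipode : IsIso hopf.antipode
  maps_eq : hopfMaps hopf = crossMaps A B

theorem hopfMaps_injective {X : 𝒞} : Function.Injective (hopfMaps (X := X)) := by
  intro h₁ h₂ h
  obtain @⟨@⟨@⟨_, _, _, _, _⟩, @⟨_, _, _, _, _⟩, _, _, _, _⟩, _, _, _⟩ := h₁
  obtain @⟨@⟨@⟨_, _, _, _, _⟩, @⟨_, _, _, _, _⟩, _, _, _, _⟩, _, _, _⟩ := h₂
  simp only [hopfMaps, HopfMaps.mk.injEq] at h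
  obtain ⟨rfl, rfl, rfl, rfl, rfl⟩ := h
  rfl

instance (A : HopfAlg 𝒞) (B : HopfAlg (CrossedMod A.X)) : Subsingleton (CrossProduct A B) where
  allEq P Q := by
    obtain ⟨hP, _, eP⟩ := P
    obtain ⟨hQ, _, eQ⟩ := Q
    obtain rfl := hopfMaps_injective (eP.trans eQ.symm)
    rfl

/-- The cross product `A ⋉ B` as a Hopf algebra in `𝒞`. -/
def CrossProduct.hopfAlg {A : HopfAlg 𝒞} {B : HopfAlg (CrossedMod A.X)} (P : CrossProduct A B) :
    HopfAlg 𝒞 :=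
  @HopfAlg.mk 𝒞 _ _ _ (A.X ⊗ B.X.X) P.hopf P.isIso_antipode

/-- The structure morphisms in `𝒞` that underlie structure morphisms in the category of crossed
modules. -/
def HopfMaps.forget {H : 𝒞} [BimonObj H] {M : CrossedMod H} (m : HopfMaps M) : HopfMaps M.X where
  one := m.one.hom
  mul := m.mul.hom
  counit := m.counit.hom
  comul := m.comul.hom
  antipode := m.antipode.hom

/-- The action of `A ⋉ B` on a crossed module `M` over `B` in the category of crossed modules over
`A`: first `A` acts, then `B`. -/
def totalAct {A : HopfAlg 𝒞} {B : HopfAlg (CrossedMod A.X)} (M : CrossedMod B.X) :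
    M.X.X ⊗ (A.X ⊗ B.X.X) ⟶ M.X.X :=
  (α_ M.X.X A.X B.X.X).inv ≫ M.X.act ▷ B.X.X ≫ M.act.hom

/-- The coaction of `A ⋉ B` on a crossed module `M` over `B` in the category of crossed modules
over `A`: first `B` coacts, then `A`. -/
def totalCoact {A : HopfAlg 𝒞} {B : HopfAlg (CrossedMod A.X)} (M : CrossedMod B.X) :
    M.X.X ⟶ M.X.X ⊗ (A.X ⊗ B.X.X) :=
  M.coact.hom ≫ M.X.coact ▷ B.X.X ≫ (α_ M.X.X A.X B.X.X).hom

/-- A Hopf algebra `C'` in the category of crossed modules over `A ⋉ B` and a Hopf algebra `C` in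
the category of crossed modules over `B` in the category of crossed modules over `A` are the same:
their underlying objects of `𝒞` are equal, `A ⋉ B` acts and coacts on this object through `A` and
`B`, and the five structure morphisms are the same in `𝒞`. -/
structure SameHopf {A : HopfAlg 𝒞} {B : HopfAlg (CrossedMod A.X)} (P : CrossProduct A B)
    (C' : HopfAlg (CrossedMod P.hopfAlg.X)) (C : HopfAlg (CrossedMod B.X)) : Prop where
  obj_eq : C'.X.X = C.X.X.X
  act_eq : C'.X.act ≫ eqToHom obj_eq = eqToHom obj_eq ▷ (A.X ⊗ B.X.X) ≫ totalAct C.X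
  coact_eq : C'.X.coact ≫ eqToHom obj_eq ▷ (A.X ⊗ B.X.X) = eqToHom obj_eq ≫ totalCoact C.X
  maps_eq : (hopfMaps C'.hopf).forget.transport (eqToIso obj_eq) =
    (hopfMaps C.hopf).forget.forget

/-- The identification `(A ⊗ B) ⊗ C' ≅ A ⊗ (B ⊗ C)` when `C'` and `C` are the same. -/
def SameHopf.assoc {A : HopfAlg 𝒞} {B : HopfAlg (CrossedMod A.X)} {P : CrossProduct A B}
    {C' : HopfAlg (CrossedMod P.hopfAlg.X)} {C : HopfAlg (CrossedMod B.X)}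
    (h : SameHopf P C' C) : (A.X ⊗ B.X.X) ⊗ C'.X.X ≅ A.X ⊗ (B.X.X ⊗ C.X.X.X) :=
  whiskerLeftIso (A.X ⊗ B.X.X) (eqToIso h.obj_eq) ≪≫ α_ A.X B.X.X C.X.X.X

end Hopf

end CrossProd

namespace CrossProd

/-! ### Distributive laws -/

section Distributive

variable {𝒞 : Type u} [Category.{v} 𝒞] [MonoidalCategory 𝒞] {A B M X Y Z : 𝒞}

/-! The whole proof works with a cross product `E` of `A` and `B` through four morphisms: the
inclusions `i : A ⟶ E`, `j : B ⟶ E`, which are multiplicative, and the projections `p : E ⟶ A`, `q :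
E ⟶ B`, which are comultiplicative. The product `i ⋆ j : A ⊗ B ⟶ E` and `Δ[E] ≫ (p ⊗ₘ q)` are
mutually inverse, a product `j b * i a` is reordered by `psi b Δ[A]`, and dually for the coproduct.
`IsCrossProd` records these relations.

Existence of the Hopf algebra. The swap `psi` obeys naturality and hexagon laws, which make `psi b
Δ[A]` a distributive law and `psi μ[A] c` a codistributive one; this gives an algebra and a
coalgebra. For the bialgebra axiom, the coproduct of `i a * j b` is written in `E ⊗ E` as a product
of values of multiplicative maps that commute by the same rules (`IsCrossedBimon.mul_comul_aux`).
The identity of `E` is the convolution product of `p ≫ i` and `q ≫ j`, so the convolution product of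
their inverses in reverse order is an antipode. It is invertible because both swaps are.

Equality of the two kinds of Hopf algebras. Acting by `i a * j b` means acting by `a`, then by `b`.
Thus an action of `E` is a pair of actions of `A` and `B` obeying a commutation rule, and this rule
says that `B` acts by a morphism of `A`-modules; dually for coactions. The compatibility condition
over `E` is stable under products (`crossed_mulHom`), so it can be tested on `i` and `j`.
Restricting it by `i` or `j` and projecting it by `p` or `q` gives four conditions: compatibility
over `A`, linearity of the `B`-coaction, colinearity of the `B`-action, and compatibility over `B`.
Hence `toTotal` is a bijection on crossed modules. It keeps underlying objects and respects tensor
products, and the swap over `E` is the iterated swap `psi₂` (`psi_eq`), so Hopf algebra structures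
correspond as well.

Transitivity. The swap of `C` with `A ⋉ B` splits into swaps with `A` and with `B`; the swap of `B ⊗
C` with `A` splits by the hexagon. Both iterated products then arise from the same three swaps
(`mul_assoc_cross`, `comul_assoc_cross`). The antipodes agree because an isomorphism of bialgebras
preserves antipodes. -/

theorem interchange_eq (X W : 𝒞) {Y Z : 𝒞} (f : Y ⊗ Z ⟶ Z ⊗ Y) :
    interchange X W f = (α_ X Y (Z ⊗ W)).hom ≫ X ◁ (α_ Y Z W).inv ≫ X ◁ f ▷ W ≫
      X ◁ (α_ Z Y W).hom ≫ (α_ X Z (Y ⊗ W)).inv := by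
  simp [interchange]

/-- The compatibility conditions that make `A ⊗ B` a monoid with multiplication
`interchange A B φ ≫ (μ ⊗ μ)`. -/
structure IsDistributive [MonObj A] [MonObj B] (φ : B ⊗ A ⟶ A ⊗ B) : Prop where
  left_one : B ◁ η[A] ≫ φ = (ρ_ B).hom ≫ (λ_ B).inv ≫ η[A] ▷ B
  right_one : η[B] ▷ A ≫ φ = (λ_ A).hom ≫ (ρ_ A).inv ≫ A ◁ η[B]
  left_mul : B ◁ μ[A] ≫ φ =
    (α_ B A A).inv ≫ φ ▷ A ≫ (α_ A B A).hom ≫ A ◁ φ ≫ (α_ A A B).inv ≫ μ[A] ▷ B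
  right_mul : μ[B] ▷ A ≫ φ =
    (α_ B B A).hom ≫ B ◁ φ ≫ (α_ B A B).inv ≫ φ ▷ B ≫ (α_ A B B).hom ≫ A ◁ μ[B]

/-- The compatibility conditions that make `A ⊗ B` a comonoid with comultiplication
`(Δ ⊗ Δ) ≫ interchange A B θ`. -/
structure IsCodistributive [ComonObj A] [ComonObj B] (θ : A ⊗ B ⟶ B ⊗ A) : Prop where
  left_counit : θ ≫ B ◁ ε[A] = ε[A] ▷ B ≫ (λ_ B).hom ≫ (ρ_ B).inv
  right_counit : θ ≫ ε[B] ▷ A = A ◁ ε[B] ≫ (ρ_ A).hom ≫ (λ_ A).inv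
  left_comul : θ ≫ B ◁ Δ[A] =
    Δ[A] ▷ B ≫ (α_ A A B).hom ≫ A ◁ θ ≫ (α_ A B A).inv ≫ θ ▷ A ≫ (α_ B A A).hom
  right_comul : θ ≫ Δ[B] ▷ A =
    A ◁ Δ[B] ≫ (α_ A B B).inv ≫ θ ▷ B ≫ (α_ B A B).hom ≫ B ◁ θ ≫ (α_ B B A).inv

namespace IsDistributive

variable [MonObj A] [MonObj B] {φ : B ⊗ A ⟶ A ⊗ B}

theorem one_mul (h : IsDistributive φ) :
    ((λ_ (𝟙_ 𝒞)).inv ≫ (η[A] ⊗ₘ η[B])) ▷ (A ⊗ B) ≫ interchange A B φ ≫ (μ[A] ⊗ₘ μ[B]) =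
      (λ_ (A ⊗ B)).hom := by
  calc
    _ = 𝟙 _ ⊗≫ η[A] ▷ (A ⊗ B) ⊗≫ A ◁ (η[B] ▷ A ≫ φ) ▷ B ⊗≫ μ[A] ▷ (B ⊗ B) ⊗≫ A ◁ μ[B] := by
      rw [MonoidalCategory.tensorHom_def, MonoidalCategory.tensorHom_def]
      unfold interchange; monoidal
    _ = 𝟙 _ ⊗≫ η[A] ▷ (A ⊗ B) ⊗≫ (((A ⊗ A) ◁ η[B] ≫ μ[A] ▷ B) ▷ B) ⊗≫ A ◁ μ[B] := by
      rw [h.right_one]; monoidal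
    _ = 𝟙 _ ⊗≫ (η[A] ▷ A ≫ μ[A]) ▷ B ⊗≫ A ◁ (η[B] ▷ B ≫ μ[B]) := by
      rw [whisker_exchange]; monoidal
    _ = _ := by rw [MonObj.one_mul, MonObj.one_mul]; monoidal

theorem mul_one (h : IsDistributive φ) :
    (A ⊗ B) ◁ ((λ_ (𝟙_ 𝒞)).inv ≫ (η[A] ⊗ₘ η[B])) ≫ interchange A B φ ≫ (μ[A] ⊗ₘ μ[B]) =
      (ρ_ (A ⊗ B)).hom := by
  calc
    _ = 𝟙 _ ⊗≫ A ◁ B ◁ η[B] ⊗≫ A ◁ (B ◁ η[A] ≫ φ) ▷ B ⊗≫ A ◁ A ◁ μ[B] ⊗≫ μ[A] ▷ B := by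
      rw [MonoidalCategory.tensorHom_def', MonoidalCategory.tensorHom_def']
      unfold interchange; monoidal
    _ = 𝟙 _ ⊗≫ A ◁ B ◁ η[B] ⊗≫ A ◁ (η[A] ▷ (B ⊗ B) ≫ A ◁ μ[B]) ⊗≫ μ[A] ▷ B := by
      rw [h.left_one]; monoidal
    _ = 𝟙 _ ⊗≫ A ◁ (B ◁ η[B] ≫ μ[B]) ⊗≫ (A ◁ η[A] ≫ μ[A]) ▷ B := by
      rw [← whisker_exchange]; monoidal
    _ = _ := by rw [MonObj.mul_one, MonObj.mul_one]; monoidal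

/-- Both sides are brought to the form where all three reorderings `ABABAB → AAABBB` precede all
multiplications. One side needs `right_mul`, the other `left_mul`; what remains is associativity in
`A` and in `B`. -/
theorem mul_assoc (h : IsDistributive φ) :
    (interchange A B φ ≫ (μ[A] ⊗ₘ μ[B])) ▷ (A ⊗ B) ≫ interchange A B φ ≫ (μ[A] ⊗ₘ μ[B]) =
      (α_ (A ⊗ B) (A ⊗ B) (A ⊗ B)).hom ≫ (A ⊗ B) ◁ (interchange A B φ ≫ (μ[A] ⊗ₘ μ[B])) ≫
        interchange A B φ ≫ (μ[A] ⊗ₘ μ[B]) := by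
  trans 𝟙 (((A ⊗ B) ⊗ (A ⊗ B)) ⊗ (A ⊗ B)) ⊗≫ A ◁ φ ▷ (B ⊗ A ⊗ B) ⊗≫ A ◁ A ◁ B ◁ φ ▷ B ⊗≫ A ◁ A ◁ φ ▷ (B ⊗ B) ⊗≫
      (A ◁ μ[A] ≫ μ[A]) ▷ (B ⊗ B ⊗ B) ⊗≫ A ◁ (μ[B] ▷ B ≫ μ[B])
  · calc
      _ = 𝟙 _ ⊗≫ A ◁ φ ▷ (B ⊗ A ⊗ B) ⊗≫
            (μ[A] ▷ ((B ⊗ B) ⊗ A) ≫ A ◁ (μ[B] ▷ A ≫ φ)) ▷ B ⊗≫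
            μ[A] ▷ (B ⊗ B) ⊗≫ A ◁ μ[B] := by
        rw [MonoidalCategory.tensorHom_def]
        unfold interchange; monoidal
      _ = 𝟙 _ ⊗≫ A ◁ φ ▷ (B ⊗ A ⊗ B) ⊗≫ A ◁ A ◁ B ◁ φ ▷ B ⊗≫ A ◁ A ◁ φ ▷ (B ⊗ B) ⊗≫
            (((A ⊗ A) ⊗ A) ◁ μ[B] ≫ (μ[A] ▷ A ≫ μ[A]) ▷ B) ▷ B ⊗≫ A ◁ μ[B] := by
        rw [← whisker_exchange, h.right_mul]; monoidal
      _ = _ := by rw [whisker_exchange, MonObj.mul_assoc]; monoidal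
  · symm
    calc
      _ = 𝟙 _ ⊗≫ A ◁ B ◁ A ◁ φ ▷ B ⊗≫
            A ◁ ((B ⊗ (A ⊗ A)) ◁ μ[B] ≫ (B ◁ μ[A] ≫ φ) ▷ B) ⊗≫
            A ◁ A ◁ μ[B] ⊗≫ μ[A] ▷ B := by
        rw [MonoidalCategory.tensorHom_def']
        unfold interchange; monoidal
      _ = 𝟙 _ ⊗≫ A ◁ ((B ⊗ A) ◁ φ ≫ φ ▷ (A ⊗ B)) ▷ B ⊗≫ A ◁ A ◁ φ ▷ (B ⊗ B) ⊗≫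
            A ◁ μ[A] ▷ (B ⊗ B ⊗ B) ⊗≫ ((A ⊗ A) ◁ (B ◁ μ[B] ≫ μ[B]) ≫ μ[A] ▷ B) := by
        rw [whisker_exchange, h.left_mul]; monoidal
      _ = _ := by
        rw [whisker_exchange φ, whisker_exchange, MonObj.mul_assoc]; monoidal

end IsDistributive

namespace IsCodistributive

variable [ComonObj A] [ComonObj B] {θ : A ⊗ B ⟶ B ⊗ A}

theorem counit_comul (h : IsCodistributive θ) :
    ((Δ[A] ⊗ₘ Δ[B]) ≫ interchange A B θ) ≫ ((ε[A] ⊗ₘ ε[B]) ≫ (λ_ (𝟙_ 𝒞)).hom) ▷ (A ⊗ B) =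
      (λ_ (A ⊗ B)).inv := by
  calc
    _ = 𝟙 _ ⊗≫ A ◁ Δ[B] ⊗≫ Δ[A] ▷ (B ⊗ B) ⊗≫ A ◁ (θ ≫ ε[B] ▷ A) ▷ B ⊗≫ ε[A] ▷ (A ⊗ B) ⊗≫ 𝟙 _ := by
      rw [MonoidalCategory.tensorHom_def', MonoidalCategory.tensorHom_def']
      unfold interchange; monoidal
    _ = 𝟙 _ ⊗≫ A ◁ Δ[B] ⊗≫ ((Δ[A] ▷ B ≫ (A ⊗ A) ◁ ε[B]) ▷ B) ⊗≫ ε[A] ▷ (A ⊗ B) ⊗≫ 𝟙 _ := by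
      rw [h.right_counit]; monoidal
    _ = 𝟙 _ ⊗≫ A ◁ (Δ[B] ≫ ε[B] ▷ B) ⊗≫ (Δ[A] ≫ ε[A] ▷ A) ▷ B ⊗≫ 𝟙 _ := by
      rw [← whisker_exchange]; monoidal
    _ = _ := by rw [ComonObj.counit_comul, ComonObj.counit_comul]; monoidal

theorem comul_counit (h : IsCodistributive θ) :
    ((Δ[A] ⊗ₘ Δ[B]) ≫ interchange A B θ) ≫ (A ⊗ B) ◁ ((ε[A] ⊗ₘ ε[B]) ≫ (λ_ (𝟙_ 𝒞)).hom) =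
      (ρ_ (A ⊗ B)).inv := by
  calc
    _ = 𝟙 _ ⊗≫ Δ[A] ▷ B ⊗≫ A ◁ A ◁ Δ[B] ⊗≫ A ◁ (θ ≫ B ◁ ε[A]) ▷ B ⊗≫ A ◁ B ◁ ε[B] ⊗≫ 𝟙 _ := by
      rw [MonoidalCategory.tensorHom_def, MonoidalCategory.tensorHom_def]
      unfold interchange; monoidal
    _ = 𝟙 _ ⊗≫ Δ[A] ▷ B ⊗≫ A ◁ (A ◁ Δ[B] ≫ ε[A] ▷ (B ⊗ B)) ⊗≫ A ◁ B ◁ ε[B] ⊗≫ 𝟙 _ := by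
      rw [h.left_counit]; monoidal
    _ = 𝟙 _ ⊗≫ (Δ[A] ≫ A ◁ ε[A]) ▷ B ⊗≫ A ◁ (Δ[B] ≫ B ◁ ε[B]) ⊗≫ 𝟙 _ := by
      rw [whisker_exchange]; monoidal
    _ = _ := by rw [ComonObj.comul_counit, ComonObj.comul_counit]; monoidal

/-- The mirror image of `IsDistributive.mul_assoc`: all comultiplications come first, then the three
reorderings. -/
theorem comul_assoc (h : IsCodistributive θ) :
    ((Δ[A] ⊗ₘ Δ[B]) ≫ interchange A B θ) ≫ (A ⊗ B) ◁ ((Δ[A] ⊗ₘ Δ[B]) ≫ interchange A B θ) =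
      ((Δ[A] ⊗ₘ Δ[B]) ≫ interchange A B θ) ≫ ((Δ[A] ⊗ₘ Δ[B]) ≫ interchange A B θ) ▷ (A ⊗ B) ≫
        (α_ (A ⊗ B) (A ⊗ B) (A ⊗ B)).hom := by
  symm
  trans 𝟙 (A ⊗ B) ⊗≫ A ◁ (Δ[B] ≫ Δ[B] ▷ B) ⊗≫ (Δ[A] ≫ A ◁ Δ[A]) ▷ (B ⊗ B ⊗ B) ⊗≫
      A ◁ A ◁ θ ▷ (B ⊗ B) ⊗≫ A ◁ A ◁ B ◁ θ ▷ B ⊗≫ A ◁ θ ▷ (B ⊗ A ⊗ B) ⊗≫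
      𝟙 ((A ⊗ B) ⊗ (A ⊗ B) ⊗ (A ⊗ B))
  · calc
      _ = 𝟙 _ ⊗≫ A ◁ Δ[B] ⊗≫ Δ[A] ▷ (B ⊗ B) ⊗≫
            (A ◁ (θ ≫ Δ[B] ▷ A) ≫ Δ[A] ▷ ((B ⊗ B) ⊗ A)) ▷ B ⊗≫
            A ◁ θ ▷ (B ⊗ A ⊗ B) ⊗≫ 𝟙 _ := by
        rw [MonoidalCategory.tensorHom_def']
        unfold interchange; monoidal
      _ = 𝟙 _ ⊗≫ A ◁ Δ[B] ⊗≫ ((Δ[A] ≫ Δ[A] ▷ A) ▷ B ≫ ((A ⊗ A) ⊗ A) ◁ Δ[B]) ▷ B ⊗≫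
            A ◁ A ◁ θ ▷ (B ⊗ B) ⊗≫ A ◁ A ◁ B ◁ θ ▷ B ⊗≫ A ◁ θ ▷ (B ⊗ A ⊗ B) ⊗≫ 𝟙 _ := by
        rw [whisker_exchange, h.right_comul]; monoidal
      _ = _ := by
        rw [← whisker_exchange, ComonObj.comul_assoc_flip]; monoidal
  · symm
    calc
      _ = 𝟙 _ ⊗≫ Δ[A] ▷ B ⊗≫ A ◁ A ◁ Δ[B] ⊗≫
            A ◁ ((θ ≫ B ◁ Δ[A]) ▷ B ≫ (B ⊗ (A ⊗ A)) ◁ Δ[B]) ⊗≫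
            A ◁ B ◁ A ◁ θ ▷ B ⊗≫ 𝟙 _ := by
        rw [MonoidalCategory.tensorHom_def]
        unfold interchange; monoidal
      _ = 𝟙 _ ⊗≫ (Δ[A] ▷ B ≫ (A ⊗ A) ◁ (Δ[B] ≫ B ◁ Δ[B])) ⊗≫ A ◁ Δ[A] ▷ (B ⊗ B ⊗ B) ⊗≫
            A ◁ A ◁ θ ▷ (B ⊗ B) ⊗≫ A ◁ (θ ▷ (A ⊗ B) ≫ (B ⊗ A) ◁ θ) ▷ B ⊗≫ 𝟙 _ := by
        rw [← whisker_exchange, h.left_comul]; monoidal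
      _ = 𝟙 _ ⊗≫ (Δ[A] ▷ B ≫ (A ⊗ A) ◁ (Δ[B] ≫ B ◁ Δ[B])) ⊗≫ A ◁ Δ[A] ▷ (B ⊗ B ⊗ B) ⊗≫
            A ◁ A ◁ θ ▷ (B ⊗ B) ⊗≫ A ◁ A ◁ B ◁ θ ▷ B ⊗≫ A ◁ θ ▷ (B ⊗ A ⊗ B) ⊗≫ 𝟙 _ := by
        rw [← whisker_exchange θ]; monoidal
      _ = _ := by
        rw [← whisker_exchange, ComonObj.comul_assoc]; monoidal

end IsCodistributive

end Distributive

/-! ### Products of morphisms into a monoid -/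

section MulHom

variable {𝒞 : Type u} [Category.{v} 𝒞] [MonoidalCategory 𝒞] {A B E M W X Y Z : 𝒞}

/-- The product `x ⊗ y ↦ f x * g y` of two morphisms into a monoid. -/
def mulHom [MonObj M] (f : X ⟶ M) (g : Y ⟶ M) : X ⊗ Y ⟶ M := (f ⊗ₘ g) ≫ μ[M]

infixl:90 " ⋆ " => mulHom

theorem mulHom_assoc [MonObj M] (f : X ⟶ M) (g : Y ⟶ M) (h : Z ⟶ M) :
    (f ⋆ g) ⋆ h = (α_ X Y Z).hom ≫ f ⋆ (g ⋆ h) := by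
  unfold mulHom
  have h1 : ((f ⊗ₘ g) ≫ μ[M] ⊗ₘ h) = ((f ⊗ₘ g) ⊗ₘ h) ≫ μ[M] ▷ M := by
    rw [← tensorHom_id, tensorHom_comp_tensorHom, Category.comp_id]
  have h2 : (f ⊗ₘ (g ⊗ₘ h) ≫ μ[M]) = (f ⊗ₘ (g ⊗ₘ h)) ≫ M ◁ μ[M] := by
    rw [← id_tensorHom, tensorHom_comp_tensorHom, Category.comp_id]
  rw [h1, h2, Category.assoc, MonObj.mul_assoc, associator_naturality_assoc, Category.assoc]

theorem tensor_comp_mulHom [MonObj M] {X' Y' : 𝒞} (u : X' ⟶ X) (v : Y' ⟶ Y) (f : X ⟶ M)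
    (g : Y ⟶ M) : (u ⊗ₘ v) ≫ f ⋆ g = (u ≫ f) ⋆ (v ≫ g) := by
  simp [mulHom]

theorem whiskerRight_comp_mulHom [MonObj M] {X' : 𝒞} (u : X' ⟶ X) (f : X ⟶ M) (g : Y ⟶ M) :
    u ▷ Y ≫ f ⋆ g = (u ≫ f) ⋆ g := by
  rw [← tensorHom_id, tensor_comp_mulHom, Category.id_comp]

theorem whiskerLeft_comp_mulHom [MonObj M] {Y' : 𝒞} (v : Y' ⟶ Y) (f : X ⟶ M) (g : Y ⟶ M) :
    X ◁ v ≫ f ⋆ g = f ⋆ (v ≫ g) := by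
  rw [← id_tensorHom, tensor_comp_mulHom, Category.id_comp]

theorem one_mulHom [MonObj M] (f : X ⟶ M) : η[M] ⋆ f = (λ_ X).hom ≫ f := by
  simp [mulHom, MonoidalCategory.tensorHom_def']

theorem mulHom_one [MonObj M] (f : X ⟶ M) : f ⋆ η[M] = (ρ_ X).hom ≫ f := by
  simp [mulHom, MonoidalCategory.tensorHom_def]

/-- If `f` and `g` are multiplicative and `g y * f x` is the value of `f ⋆ g` at `φ (y ⊗ x)`, then
`f ⋆ g` is multiplicative on the monoid given by the distributive law `φ`. -/
theorem mulHom_mulHom_mulHom [MonObj A] [MonObj B] [MonObj M] {φ : B ⊗ A ⟶ A ⊗ B} {f : A ⟶ M}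
    {g : B ⟶ M} (hf : μ[A] ≫ f = f ⋆ f) (hg : μ[B] ≫ g = g ⋆ g) (h : g ⋆ f = φ ≫ f ⋆ g) :
    (f ⋆ g) ⋆ (f ⋆ g) = (interchange A B φ ≫ (μ[A] ⊗ₘ μ[B])) ≫ f ⋆ g := by
  have key : g ⋆ (f ⋆ g) = (α_ B A B).inv ≫ φ ▷ B ≫ (α_ A B B).hom ≫ f ⋆ (g ⋆ g) := by
    rw [← mulHom_assoc, whiskerRight_comp_mulHom, ← h, mulHom_assoc, Iso.inv_hom_id_assoc]
  rw [mulHom_assoc, key, Category.assoc, tensor_comp_mulHom, hf, hg, mulHom_assoc f f, interchange]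
  simp only [← whiskerLeft_comp_mulHom, Category.assoc, Iso.inv_hom_id_assoc, whiskerLeft_comp]

theorem tensorHom_comp_right {X X' Y Y' Y'' : 𝒞} (f : X ⟶ X') (u : Y ⟶ Y') (g : Y' ⟶ Y'') :
    (f ⊗ₘ u ≫ g) = X ◁ u ≫ (f ⊗ₘ g) := by
  rw [← id_tensorHom, tensorHom_comp_tensorHom, Category.id_comp]

theorem tensorHom_comp_left {X X' X'' Y Y' : 𝒞} (u : X ⟶ X') (f : X' ⟶ X'') (g : Y ⟶ Y') :
    (u ≫ f ⊗ₘ g) = u ▷ Y ≫ (f ⊗ₘ g) := by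
  rw [← tensorHom_id, tensorHom_comp_tensorHom, Category.id_comp]

/-- By associativity, acting by a product is acting by the factors in turn. When every element of
`E` is such a product, the action is determined by its restrictions along `i` and `j`. -/
theorem act_split [MonObj E] {a : X ⊗ E ⟶ X}
    (ha : a ▷ E ≫ a = (α_ X E E).hom ≫ X ◁ μ[E] ≫ a) (i : A ⟶ E) (j : B ⟶ E) :
    X ◁ (i ⋆ j) ≫ a = (α_ X A B).inv ≫ (X ◁ i ≫ a) ▷ B ≫ X ◁ j ≫ a := by
  symm
  calc
    _ = 𝟙 _ ⊗≫ X ◁ i ▷ B ⊗≫ (a ▷ B ≫ X ◁ j) ≫ a := by monoidal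
    _ = 𝟙 _ ⊗≫ X ◁ (i ⊗ₘ j) ⊗≫ a ▷ E ≫ a := by
      rw [← whisker_exchange, MonoidalCategory.tensorHom_def]; monoidal
    _ = _ := by rw [ha, mulHom]; monoidal

/-- Coassociativity in dual form. The second projection `q` belongs to the coaction that is applied
first. -/
theorem coact_split [ComonObj E] {d : X ⟶ X ⊗ E}
    (hd : d ≫ X ◁ Δ[E] = d ≫ d ▷ E ≫ (α_ X E E).hom) (p : E ⟶ A) (q : E ⟶ B) :
    d ≫ X ◁ (Δ[E] ≫ (p ⊗ₘ q)) = (d ≫ X ◁ q) ≫ (d ≫ X ◁ p) ▷ B ≫ (α_ X A B).hom := by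
  symm
  calc
    _ = 𝟙 _ ⊗≫ d ⊗≫ (X ◁ q ≫ d ▷ B) ⊗≫ X ◁ p ▷ B ⊗≫ 𝟙 _ := by monoidal
    _ = 𝟙 _ ⊗≫ (d ≫ d ▷ E ≫ (α_ X E E).hom) ⊗≫ X ◁ (p ⊗ₘ q) := by
      rw [whisker_exchange, MonoidalCategory.tensorHom_def']; monoidal
    _ = _ := by rw [← hd]; monoidal

end MulHom

/-! ### Products of morphisms into a tensor product of monoids -/

section TensorMulHom

variable {𝒞 : Type u} [Category.{v} 𝒞] [MonoidalCategory 𝒞] [BraidedCategory 𝒞]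
  {M N U V W X Y Z : 𝒞}

theorem tensorHom_mulHom_tensorHom [MonObj M] [MonObj N] (u : U ⟶ M) (v : V ⟶ N) (w : W ⟶ M)
    (z : Z ⟶ N) :
    (u ⊗ₘ v) ⋆ (w ⊗ₘ z) = tensorμ U V W Z ≫ (u ⋆ w ⊗ₘ v ⋆ z) := by
  unfold mulHom
  rw [MonObj.tensorObj.mul_def, tensorμ_natural_assoc, tensorHom_comp_tensorHom]

/-- The morphism `z ↦ 1 ⊗ z`. -/
def oneTensor (M : 𝒞) [MonObj M] (z : Z ⟶ N) : Z ⟶ M ⊗ N := (λ_ Z).inv ≫ (η[M] ⊗ₘ z)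

/-- In `(u ⊗ v)(1 ⊗ z)` the braiding only crosses `V` with the unit, so it disappears. In the
opposite order, `oneTensor_mulHom_tensorHom`, one genuine braiding survives. -/
theorem tensorHom_mulHom_oneTensor [MonObj M] [MonObj N] (u : U ⟶ M) (v : V ⟶ N) (z : Z ⟶ N) :
    (u ⊗ₘ v) ⋆ oneTensor M z = (α_ U V Z).hom ≫ (u ⊗ₘ v ⋆ z) := by
  unfold oneTensor
  rw [← whiskerLeft_comp_mulHom, tensorHom_mulHom_tensorHom, mulHom_one, tensorμ,
    braiding_tensorUnit_right]
  have : ((ρ_ U).hom ≫ u ⊗ₘ v ⋆ z) = (ρ_ U).hom ▷ (V ⊗ Z) ≫ (u ⊗ₘ v ⋆ z) := by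
    rw [← tensorHom_id, tensorHom_comp_tensorHom, Category.id_comp]
  rw [this]
  simp only [← Category.assoc]
  congr 1
  monoidal

theorem oneTensor_mulHom_tensorHom [MonObj M] [MonObj N] (u : U ⟶ M) (v : V ⟶ N) (z : Z ⟶ N) :
    oneTensor M z ⋆ (u ⊗ₘ v) =
      (α_ Z U V).inv ≫ (β_ Z U).hom ▷ V ≫ (α_ U Z V).hom ≫ (u ⊗ₘ z ⋆ v) := by
  unfold oneTensor
  rw [← whiskerRight_comp_mulHom, tensorHom_mulHom_tensorHom, one_mulHom, tensorμ]
  have : ((λ_ U).hom ≫ u ⊗ₘ z ⋆ v) = (λ_ U).hom ▷ (Z ⊗ V) ≫ (u ⊗ₘ z ⋆ v) := by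
    rw [← tensorHom_id, tensorHom_comp_tensorHom, Category.id_comp]
  rw [this]
  simp only [← Category.assoc]
  congr 1
  monoidal

theorem mul_comp_oneTensor [MonObj M] [MonObj N] [MonObj Z] (z : Z ⟶ N) (hz : μ[Z] ≫ z = z ⋆ z) :
    μ[Z] ≫ oneTensor M z = oneTensor M z ⋆ oneTensor M z := by
  have h : oneTensor M z ⋆ oneTensor M z = (λ_ Z).inv ▷ Z ≫ (η[M] ⊗ₘ z) ⋆ oneTensor M z :=
    (whiskerRight_comp_mulHom _ _ _).symm
  rw [h, tensorHom_mulHom_oneTensor, ← hz]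
  unfold oneTensor
  rw [leftUnitor_inv_naturality_assoc, ← id_tensorHom, tensorHom_comp_tensorHom, Category.id_comp]
  simp

end TensorMulHom

/-! ### The distributive laws of a cross product -/

section Psi

variable {𝒞 : Type u} [Category.{v} 𝒞] [MonoidalCategory 𝒞] [BraidedCategory 𝒞]
  {A B H X Y Z : 𝒞}

theorem one_comul_eq [BimonObj H] : η[H] ≫ Δ[H] = (λ_ (𝟙_ 𝒞)).inv ≫ (η[H] ⊗ₘ η[H]) := by
  simp [MonObj.tensorObj.one_def]

theorem mul_counit_eq [BimonObj H] : μ[H] ≫ ε[H] = (ε[H] ⊗ₘ ε[H]) ≫ (λ_ (𝟙_ 𝒞)).hom := by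
  simp

theorem one_coact_comul [BimonObj A] : unitCoact A ≫ η[A] ▷ A = η[A] ≫ Δ[A] := by
  rw [one_comul_eq, unitCoact, MonoidalCategory.tensorHom_def']
  simp

theorem mul_coact_comul [BimonObj A] : tensorCoact Δ[A] Δ[A] ≫ μ[A] ▷ A = μ[A] ≫ Δ[A] := by
  simp [tensorCoact, MonoidalCategory.tensorHom_def']

theorem counit_act_mul [BimonObj A] : μ[A] ≫ ε[A] = ε[A] ▷ A ≫ unitAct A := by
  simp [unitAct, MonoidalCategory.tensorHom_def]

theorem comul_act_mul [BimonObj A] : μ[A] ≫ Δ[A] = Δ[A] ▷ A ≫ tensorAct μ[A] μ[A] := by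
  simp [tensorAct, MonoidalCategory.tensorHom_def]

/-- Let `A` coact on itself by `Δ[A]`. The unit and multiplication of `A` are then colinear, those
of `B` are linear, and the four conditions are naturality of `psi` combined with its unit and
hexagon laws. -/
theorem isDistributive_psi [BimonObj A] [MonObj B] {b : B ⊗ A ⟶ B}
    (act_one : B ◁ η[A] ≫ b = (ρ_ B).hom) (act_mul : b ▷ A ≫ b = (α_ B A A).hom ≫ B ◁ μ[A] ≫ b)
    (one_act : unitAct A ≫ η[B] = η[B] ▷ A ≫ b) (mul_act : tensorAct b b ≫ μ[B] = μ[B] ▷ A ≫ b) :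
    IsDistributive (psi b Δ[A]) where
  left_one := by
    rw [← psi_naturality_right b (unitCoact A) Δ[A] η[A] one_coact_comul, psi_unit_right _ act_one,
      Category.assoc]
  right_one := by
    rw [← psi_naturality_left (unitAct A) b Δ[A] η[B] one_act,
      psi_unit_left _ (ComonObj.comul_counit A), Category.assoc]
  left_mul := by
    rw [← psi_naturality_right b (tensorCoact Δ[A] Δ[A]) Δ[A] μ[A] mul_coact_comul,
      psi_tensor_right _ _ _ act_mul]
    simp only [Category.assoc]
  right_mul := by
    rw [← psi_naturality_left (tensorAct b b) b Δ[A] μ[B] mul_act,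
      psi_tensor_left _ _ _ (ComonObj.comul_assoc A)]
    simp only [Category.assoc]

/-- Here `A` acts on itself by `μ[A]`: its counit and comultiplication are linear, those of `B` are
colinear, and naturality of `psi` applies as before. -/
theorem isCodistributive_psi [BimonObj A] [ComonObj B] {c : B ⟶ B ⊗ A}
    (coact_counit : c ≫ B ◁ ε[A] = (ρ_ B).inv)
    (coact_comul : c ≫ B ◁ Δ[A] = c ≫ c ▷ A ≫ (α_ B A A).hom)
    (counit_coact : c ≫ ε[B] ▷ A = ε[B] ≫ unitCoact A)
    (comul_coact : c ≫ Δ[B] ▷ A = Δ[B] ≫ tensorCoact c c) :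
    IsCodistributive (psi μ[A] c) where
  left_counit := by
    rw [psi_naturality_left μ[A] (unitAct A) c ε[A] counit_act_mul, psi_unit_left _ coact_counit]
  right_counit := by
    rw [psi_naturality_right μ[A] c (unitCoact A) ε[B] counit_coact,
      psi_unit_right _ (MonObj.mul_one A)]
  left_comul := by
    rw [psi_naturality_left μ[A] (tensorAct μ[A] μ[A]) c Δ[A] comul_act_mul,
      psi_tensor_left _ _ _ coact_comul]
  right_comul := by
    rw [psi_naturality_right μ[A] c (tensorCoact c c) Δ[B] comul_coact,
      psi_tensor_right _ _ _ (MonObj.mul_assoc A)]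

/-- Coassociativity turns a second coaction after the swap into a comultiplication of the strand
that acts. This is how a factor `j` is carried past a coacted factor in
`IsCrossedBimon.mul_comul_aux` and in `IsCrossProd.j_psi`. -/
theorem psi_comp_coact [ComonObj H] (a : X ⊗ H ⟶ X) (c : Y ⟶ Y ⊗ H)
    (hc : c ≫ Y ◁ Δ[H] = c ≫ c ▷ H ≫ (α_ Y H H).hom) :
    psi a c ≫ c ▷ X ≫ (α_ Y H X).hom =
      X ◁ c ≫ (α_ X Y H).inv ≫ (β_ X Y).hom ▷ H ≫ (α_ Y X H).hom ≫ Y ◁ psi a Δ[H] := by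
  unfold psi
  calc
    _ = 𝟙 _ ⊗≫ X ◁ c ⊗≫ (β_ X Y).hom ▷ H ⊗≫ (Y ◁ a ≫ c ▷ X) ⊗≫ 𝟙 _ := by monoidal
    _ = 𝟙 _ ⊗≫ X ◁ c ⊗≫ ((β_ X Y).hom ≫ c ▷ X) ▷ H ⊗≫ (Y ⊗ H) ◁ a ⊗≫ 𝟙 _ := by
      rw [whisker_exchange]; monoidal
    _ = 𝟙 _ ⊗≫ X ◁ (c ≫ c ▷ H ≫ (α_ Y H H).hom) ⊗≫ (β_ X Y).hom ▷ H ▷ H ⊗≫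
          Y ◁ (β_ X H).hom ▷ H ⊗≫ Y ◁ H ◁ a ⊗≫ 𝟙 _ := by
      rw [← braiding_naturality_right, braiding_tensor_right_hom]; monoidal
    _ = 𝟙 _ ⊗≫ X ◁ c ⊗≫ ((X ⊗ Y) ◁ Δ[H] ≫ (β_ X Y).hom ▷ (H ⊗ H)) ⊗≫
          Y ◁ (β_ X H).hom ▷ H ⊗≫ Y ◁ H ◁ a ⊗≫ 𝟙 _ := by
      rw [← hc]; monoidal
    _ = _ := by rw [whisker_exchange]; monoidal

/-- The comultiplication on the left factor and the coaction on the right one, then the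
multiplication of the two middle factors. -/
theorem tensorHom_comp_tensorμ_comp_mul [MonObj H] {X' : 𝒞} (d : X' ⟶ X ⊗ H) (c : Y ⟶ Y ⊗ H) :
    (d ⊗ₘ c) ≫ tensorμ X H Y H ≫ (X ⊗ Y) ◁ μ[H] =
      d ▷ Y ≫ (α_ X H Y).hom ≫ X ◁ psi μ[H] c ≫ (α_ X Y H).inv := by
  unfold tensorμ psi
  rw [MonoidalCategory.tensorHom_def]
  monoidal

theorem tensorHom_comp_tensorμ_comp_act [ComonObj H] {X' : 𝒞} (a : X ⊗ H ⟶ X')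
    (b : Y ⊗ H ⟶ Y) :
    (X ⊗ Y) ◁ Δ[H] ≫ tensorμ X Y H H ≫ (a ⊗ₘ b) =
      (α_ X Y H).hom ≫ X ◁ psi b Δ[H] ≫ (α_ X H Y).inv ≫ a ▷ Y := by
  unfold tensorμ psi
  rw [MonoidalCategory.tensorHom_def']
  monoidal

end Psi

/-! ### The bialgebra axiom for a cross product -/

section Bialgebra

variable {𝒞 : Type u} [Category.{v} 𝒞] [MonoidalCategory 𝒞] [BraidedCategory 𝒞] {A B : 𝒞}

/-- The axioms of a bialgebra `B` in the category of crossed modules over `A`, in terms of the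
action `b` and the coaction `c` of `A` on `B`. -/
structure IsCrossedBimon [BimonObj A] [MonObj B] [ComonObj B] (b : B ⊗ A ⟶ B) (c : B ⟶ B ⊗ A) :
    Prop where
  act_one : B ◁ η[A] ≫ b = (ρ_ B).hom
  act_mul : b ▷ A ≫ b = (α_ B A A).hom ≫ B ◁ μ[A] ≫ b
  coact_counit : c ≫ B ◁ ε[A] = (ρ_ B).inv
  coact_comul : c ≫ B ◁ Δ[A] = c ≫ c ▷ A ≫ (α_ B A A).hom
  crossed : IsCrossed b c
  one_act : unitAct A ≫ η[B] = η[B] ▷ A ≫ b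
  mul_act : tensorAct b b ≫ μ[B] = μ[B] ▷ A ≫ b
  counit_act : b ≫ ε[B] = ε[B] ▷ A ≫ unitAct A
  comul_act : b ≫ Δ[B] = Δ[B] ▷ A ≫ tensorAct b b
  one_coact : unitCoact A ≫ η[B] ▷ A = η[B] ≫ c
  mul_coact : tensorCoact c c ≫ μ[B] ▷ A = μ[B] ≫ c
  counit_coact : c ≫ ε[B] ▷ A = ε[B] ≫ unitCoact A
  comul_coact : c ≫ Δ[B] ▷ A = Δ[B] ≫ tensorCoact c c
  mul_comul : μ[B] ≫ Δ[B] = (Δ[B] ⊗ₘ Δ[B]) ≫ interchange B B (psi b c) ≫ (μ[B] ⊗ₘ μ[B])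
  one_comul : η[B] ≫ Δ[B] = (λ_ (𝟙_ 𝒞)).inv ≫ (η[B] ⊗ₘ η[B])
  mul_counit : μ[B] ≫ ε[B] = (ε[B] ⊗ₘ ε[B]) ≫ (λ_ (𝟙_ 𝒞)).hom
  one_counit : η[B] ≫ ε[B] = 𝟙 (𝟙_ 𝒞)

/-- The compatibility condition with one more `A`-strand split off to the left. In this form it is
the commutation rule between `b ↦ j b₀ ⊗ i b₁` and `a ↦ i a₁ ⊗ i a₂` in `E ⊗ E`. -/
theorem IsCrossed.aux [BimonObj A] {b : B ⊗ A ⟶ B} {c : B ⟶ B ⊗ A}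
    (crossed : IsCrossed b c) :
    (c ⊗ₘ Δ[A]) ≫ tensorμ B A A A ≫ (psi b Δ[A] ⊗ₘ μ[A]) =
      psi b Δ[A] ≫ (Δ[A] ⊗ₘ c) ≫ tensorμ A A B A ≫ (A ⊗ B) ◁ μ[A] := by
  rw [tensorHom_comp_tensorμ_comp_mul, ← Category.assoc (psi b Δ[A]), psi_comul]
  unfold IsCrossed at crossed
  symm
  calc
    _ = 𝟙 _ ⊗≫ B ◁ Δ[A] ⊗≫ (β_ B A).hom ▷ A ⊗≫ A ◁ (psi b Δ[A] ≫ psi μ[A] c) ⊗≫ 𝟙 _ := by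
      monoidal
    _ = 𝟙 _ ⊗≫ B ◁ Δ[A] ⊗≫ ((β_ B A).hom ≫ A ◁ c) ▷ A ⊗≫ A ◁ B ◁ A ◁ Δ[A] ⊗≫
          A ◁ B ◁ (β_ A A).hom ▷ A ⊗≫ A ◁ b ▷ (A ⊗ A) ⊗≫ A ◁ B ◁ μ[A] ⊗≫ 𝟙 _ := by
      rw [crossed, tensorμ, MonoidalCategory.tensorHom_def, MonoidalCategory.tensorHom_def]
      monoidal
    _ = 𝟙 _ ⊗≫ (B ◁ Δ[A] ≫ c ▷ (A ⊗ A)) ⊗≫ ((β_ (B ⊗ A) A).hom ▷ A ≫ (A ⊗ (B ⊗ A)) ◁ Δ[A]) ⊗≫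
          A ◁ B ◁ (β_ A A).hom ▷ A ⊗≫ A ◁ b ▷ (A ⊗ A) ⊗≫ A ◁ B ◁ μ[A] ⊗≫ 𝟙 _ := by
      rw [← braiding_naturality_left]; monoidal
    _ = 𝟙 _ ⊗≫ c ▷ A ⊗≫ (B ⊗ A) ◁ (Δ[A] ≫ A ◁ Δ[A]) ⊗≫ B ◁ (β_ A A).hom ▷ (A ⊗ A) ⊗≫
          (β_ B A).hom ▷ (A ⊗ A ⊗ A) ⊗≫
          A ◁ B ◁ (β_ A A).hom ▷ A ⊗≫ A ◁ b ▷ (A ⊗ A) ⊗≫ A ◁ B ◁ μ[A] ⊗≫ 𝟙 _ := by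
      rw [whisker_exchange, ← whisker_exchange (β_ (B ⊗ A) A).hom, braiding_tensor_left_hom]
      monoidal
    _ = 𝟙 _ ⊗≫ c ▷ A ⊗≫ (B ⊗ A) ◁ (Δ[A] ≫ Δ[A] ▷ A) ⊗≫ B ◁ (β_ A A).hom ▷ (A ⊗ A) ⊗≫
          ((β_ B A).hom ▷ (A ⊗ A) ≫ (A ⊗ B) ◁ (β_ A A).hom) ▷ A ⊗≫
          A ◁ b ▷ (A ⊗ A) ⊗≫ A ◁ B ◁ μ[A] ⊗≫ 𝟙 _ := by
      rw [ComonObj.comul_assoc_flip]; monoidal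
    _ = 𝟙 _ ⊗≫ c ▷ A ⊗≫ (B ⊗ A) ◁ Δ[A] ⊗≫ B ◁ (A ◁ Δ[A] ≫ (β_ A (A ⊗ A)).hom) ▷ A ⊗≫
          (β_ B A).hom ▷ (A ⊗ A ⊗ A) ⊗≫
          A ◁ b ▷ (A ⊗ A) ⊗≫ A ◁ B ◁ μ[A] ⊗≫ 𝟙 _ := by
      rw [← whisker_exchange, braiding_tensor_right_hom]; monoidal
    _ = _ := by
      rw [braiding_naturality_right, MonoidalCategory.tensorHom_def c,
        MonoidalCategory.tensorHom_def _ μ[A]]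
      unfold psi tensorμ
      monoidal

variable {E : 𝒞}

/-- If the multiplication of `E` is given by commutation rules for `i : A ⟶ E` and `j : B ⟶ E`, then
so is its comultiplication multiplicative on the image of `i ⋆ j`. -/
theorem IsCrossedBimon.mul_comul_aux [BimonObj A] [MonObj B] [ComonObj B] [MonObj E] [ComonObj E]
    {b : B ⊗ A ⟶ B} {c : B ⟶ B ⊗ A} (H : IsCrossedBimon b c) {i : A ⟶ E} {j : B ⟶ E}
    (hi : μ[A] ≫ i = i ⋆ i) (hj : μ[B] ≫ j = j ⋆ j) (hji : j ⋆ i = psi b Δ[A] ≫ i ⋆ j)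
    (hΔ : i ⋆ j ≫ Δ[E] = ((Δ[A] ⊗ₘ Δ[B]) ≫ interchange A B (psi μ[A] c)) ≫ (i ⋆ j ⊗ₘ i ⋆ j)) :
    (i ⋆ j) ⋆ (i ⋆ j) ≫ Δ[E] = (i ⋆ j ≫ Δ[E]) ⋆ (i ⋆ j ≫ Δ[E]) := by
  -- The coproduct of `i a * j b` equals `f a * g₁ b₁ * g₂ b₂`, where `f a = i a₁ ⊗ i a₂`, `g₁ b = j
  -- b₀ ⊗ i b₁` uses the coaction, and `g₂ b = 1 ⊗ j b`. Once these maps are multiplicative and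
  -- commute by the rule `psi`, `mulHom_mulHom_mulHom` makes the whole product multiplicative.
  set f : A ⟶ E ⊗ E := Δ[A] ≫ (i ⊗ₘ i) with hf
  set g₁ : B ⟶ E ⊗ E := c ≫ (j ⊗ₘ i) with hg₁
  set g₂ : B ⟶ E ⊗ E := oneTensor E j with hg₂
  set g : B ⟶ E ⊗ E := Δ[B] ≫ g₁ ⋆ g₂ with hg
  have f_mul : μ[A] ≫ f = f ⋆ f := by
    rw [hf, ← tensor_comp_mulHom, tensorHom_mulHom_tensorHom, ← hi, BimonObj.mul_comul_assoc]
    simp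
  have g₁_mul : μ[B] ≫ g₁ = g₁ ⋆ g₁ := by
    rw [hg₁, ← tensor_comp_mulHom, tensorHom_mulHom_tensorHom, ← hi, ← hj, ← reassoc_of% H.mul_coact,
      tensorCoact, ← tensorHom_comp_tensorHom, MonoidalCategory.tensorHom_def' μ[B]]
    simp
  have g₂_mul : μ[B] ≫ g₂ = g₂ ⋆ g₂ := mul_comp_oneTensor j hj
  have g₂_g₁ : g₂ ⋆ g₁ = psi b c ≫ g₁ ⋆ g₂ := by
    rw [hg₁, ← whiskerLeft_comp_mulHom, hg₂, oneTensor_mulHom_tensorHom, hji,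
      ← whiskerRight_comp_mulHom, tensorHom_mulHom_oneTensor, tensorHom_comp_right,
      ← reassoc_of% (psi_comp_coact b c H.coact_comul)]
  -- The swap in the bialgebra axiom of `B` is `psi b c`, which is precisely the rule `g₂_g₁` for
  -- reordering `g₂` and `g₁`.
  have g_mul : μ[B] ≫ g = g ⋆ g := by
    have := mulHom_mulHom_mulHom g₁_mul g₂_mul g₂_g₁
    rw [hg, ← tensor_comp_mulHom, this, reassoc_of% H.mul_comul]
    simp
  have g₂_f : g₂ ⋆ f = psi b Δ[A] ≫ f ⋆ g₂ := by
    rw [hf, ← whiskerLeft_comp_mulHom, hg₂, oneTensor_mulHom_tensorHom, hji,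
      ← whiskerRight_comp_mulHom, tensorHom_mulHom_oneTensor, tensorHom_comp_right,
      ← reassoc_of% (psi_comp_coact b Δ[A] (ComonObj.comul_assoc A))]
  -- This commutation is where the compatibility of action and coaction enters.
  have g₁_f : g₁ ⋆ f = psi b Δ[A] ≫ f ⋆ g₁ := by
    have := IsCrossed.aux H.crossed
    rw [hg₁, hf, ← tensor_comp_mulHom, ← tensor_comp_mulHom, tensorHom_mulHom_tensorHom,
      tensorHom_mulHom_tensorHom, hji, ← hi, ← tensorHom_comp_tensorHom, reassoc_of% this,
      tensorHom_comp_right]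
  -- Linearity of `Δ[B]` and the hexagon split the rule for `g` into the rules for `g₂` and `g₁`.
  have g_f : g ⋆ f = psi b Δ[A] ≫ f ⋆ g := by
    rw [hg, ← whiskerRight_comp_mulHom, mulHom_assoc, g₂_f, ← whiskerLeft_comp_mulHom,
      ← whiskerLeft_comp_mulHom,
      reassoc_of% (psi_naturality_left b (tensorAct b b) Δ[A] Δ[B] H.comul_act),
      psi_tensor_left b b _ (ComonObj.comul_assoc A)]
    rw [← Iso.inv_hom_id_assoc (α_ B A B) (g₁ ⋆ (f ⋆ g₂)), ← mulHom_assoc, g₁_f,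
      ← whiskerRight_comp_mulHom, mulHom_assoc]
    simp only [Category.assoc]
  have key : i ⋆ j ≫ Δ[E] = f ⋆ g := by
    have h := tensorHom_comp_tensorμ_comp_mul (𝟙 (A ⊗ A)) c
    rw [id_tensorHom, id_whiskerRight, Category.id_comp] at h
    have h' : (i ⊗ₘ i) ⋆ g₁ =
        ((α_ A A B).hom ≫ A ◁ psi μ[A] c ≫ (α_ A B A).inv) ≫ (i ⋆ j ⊗ₘ i) := by
      rw [← h, hg₁, ← whiskerLeft_comp_mulHom, tensorHom_mulHom_tensorHom, ← hi,
        tensorHom_comp_right]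
      simp only [Category.assoc]
    rw [hΔ, hf, hg, ← tensor_comp_mulHom,
      ← Iso.inv_hom_id_assoc (α_ (A ⊗ A) B B) ((i ⊗ₘ i) ⋆ (g₁ ⋆ g₂)), ← mulHom_assoc, h',
      ← whiskerRight_comp_mulHom, tensorHom_mulHom_oneTensor, interchange]
    simp only [← Category.assoc]
    congr 1
    monoidal
  have epi : (i ⋆ j) ⋆ (i ⋆ j) = (interchange A B (psi b Δ[A]) ≫ (μ[A] ⊗ₘ μ[B])) ≫ i ⋆ j :=
    mulHom_mulHom_mulHom hi hj hji
  rw [epi, key, mulHom_mulHom_mulHom f_mul g_mul g_f, Category.assoc, key]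

end Bialgebra

/-! ### The inclusions and projections of a cross product -/

section Inclusions

variable {𝒞 : Type u} [Category.{v} 𝒞] [MonoidalCategory 𝒞] {A B : 𝒞}

variable (A B) in
/-- The morphism `a ↦ a ⊗ 1`. -/
def inl [MonObj B] : A ⟶ A ⊗ B := (ρ_ A).inv ≫ A ◁ η[B]

variable (A B) in
/-- The morphism `b ↦ 1 ⊗ b`. -/
def inr [MonObj A] : B ⟶ A ⊗ B := (λ_ B).inv ≫ η[A] ▷ B

variable (A B) in
/-- The morphism `a ⊗ b ↦ a ε(b)`. -/
def fst [ComonObj B] : A ⊗ B ⟶ A := A ◁ ε[B] ≫ (ρ_ A).hom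

variable (A B) in
/-- The morphism `a ⊗ b ↦ ε(a) b`. -/
def snd [ComonObj A] : A ⊗ B ⟶ B := ε[A] ▷ B ≫ (λ_ B).hom

namespace IsDistributive

variable [MonObj A] [MonObj B] {φ : B ⊗ A ⟶ A ⊗ B}

theorem inl_inl (h : IsDistributive φ) :
    (inl A B ⊗ₘ inl A B) ≫ interchange A B φ ≫ (μ[A] ⊗ₘ μ[B]) = μ[A] ≫ inl A B := by
  unfold inl interchange
  calc
    _ = 𝟙 _ ⊗≫ A ◁ A ◁ η[B] ⊗≫ A ◁ (η[B] ▷ A ≫ φ) ▷ B ⊗≫ A ◁ A ◁ μ[B] ⊗≫ μ[A] ▷ B := by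
      rw [MonoidalCategory.tensorHom_def', MonoidalCategory.tensorHom_def']; monoidal
    _ = 𝟙 _ ⊗≫ A ◁ A ◁ η[B] ⊗≫ A ◁ A ◁ (η[B] ▷ B ≫ μ[B]) ⊗≫ μ[A] ▷ B := by
      rw [h.right_one]; monoidal
    _ = 𝟙 _ ⊗≫ ((A ⊗ A) ◁ η[B] ≫ μ[A] ▷ B) := by
      rw [MonObj.one_mul]; monoidal
    _ = _ := by rw [whisker_exchange]; monoidal

theorem inl_inr (h : IsDistributive φ) :
    (inl A B ⊗ₘ inr A B) ≫ interchange A B φ ≫ (μ[A] ⊗ₘ μ[B]) = 𝟙 (A ⊗ B) := by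
  unfold inl inr interchange
  calc
    _ = 𝟙 _ ⊗≫ A ◁ η[A] ▷ B ⊗≫ A ◁ (η[B] ▷ A ≫ φ) ▷ B ⊗≫ A ◁ A ◁ μ[B] ⊗≫ μ[A] ▷ B := by
      rw [MonoidalCategory.tensorHom_def', MonoidalCategory.tensorHom_def']; monoidal
    _ = 𝟙 _ ⊗≫ A ◁ η[A] ▷ B ⊗≫ A ◁ A ◁ (η[B] ▷ B ≫ μ[B]) ⊗≫ μ[A] ▷ B := by
      rw [h.right_one]; monoidal
    _ = 𝟙 _ ⊗≫ (A ◁ η[A] ≫ μ[A]) ▷ B := by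
      rw [MonObj.one_mul]; monoidal
    _ = _ := by rw [MonObj.mul_one]; monoidal

theorem inr_inr (h : IsDistributive φ) :
    (inr A B ⊗ₘ inr A B) ≫ interchange A B φ ≫ (μ[A] ⊗ₘ μ[B]) = μ[B] ≫ inr A B := by
  unfold inr interchange
  calc
    _ = 𝟙 _ ⊗≫ η[A] ▷ (B ⊗ B) ⊗≫ A ◁ (B ◁ η[A] ≫ φ) ▷ B ⊗≫ μ[A] ▷ (B ⊗ B) ⊗≫ A ◁ μ[B] := by
      rw [MonoidalCategory.tensorHom_def, MonoidalCategory.tensorHom_def]; monoidal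
    _ = 𝟙 _ ⊗≫ η[A] ▷ (B ⊗ B) ⊗≫ (A ◁ η[A] ≫ μ[A]) ▷ (B ⊗ B) ⊗≫ A ◁ μ[B] := by
      rw [h.left_one]; monoidal
    _ = 𝟙 _ ⊗≫ (η[A] ▷ (B ⊗ B) ≫ A ◁ μ[B]) := by
      rw [MonObj.mul_one]; monoidal
    _ = _ := by rw [← whisker_exchange]; monoidal

/-- Only the unit laws enter, so any `φ` can be read off from the product it defines. The dual
statement `snd_fst` recovers `θ` from the coproduct. -/
theorem inr_inl :
    (inr A B ⊗ₘ inl A B) ≫ interchange A B φ ≫ (μ[A] ⊗ₘ μ[B]) = φ := by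
  unfold inl inr interchange
  calc
    _ = 𝟙 _ ⊗≫ (η[A] ▷ (B ⊗ A) ≫ A ◁ (𝟙 (B ⊗ A) ⊗≫ (B ⊗ A) ◁ η[B] ≫ φ ▷ B)) ⊗≫
          μ[A] ▷ (B ⊗ B) ⊗≫ A ◁ μ[B] := by
      rw [MonoidalCategory.tensorHom_def, MonoidalCategory.tensorHom_def]; monoidal
    _ = 𝟙 _ ⊗≫ φ ⊗≫ A ◁ B ◁ η[B] ⊗≫ (η[A] ▷ A ≫ μ[A]) ▷ (B ⊗ B) ⊗≫ A ◁ μ[B] := by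
      rw [whisker_exchange, ← whisker_exchange]; monoidal
    _ = 𝟙 _ ⊗≫ φ ⊗≫ A ◁ (B ◁ η[B] ≫ μ[B]) := by
      rw [MonObj.one_mul]; monoidal
    _ = _ := by rw [MonObj.mul_one]; monoidal

end IsDistributive

namespace IsCodistributive

variable [ComonObj A] [ComonObj B] {θ : A ⊗ B ⟶ B ⊗ A}

theorem fst_fst (h : IsCodistributive θ) :
    ((Δ[A] ⊗ₘ Δ[B]) ≫ interchange A B θ) ≫ (fst A B ⊗ₘ fst A B) = fst A B ≫ Δ[A] := by
  unfold fst interchange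
  symm
  calc
    _ = 𝟙 _ ⊗≫ (A ◁ ε[B] ≫ Δ[A] ▷ 𝟙_ 𝒞) ⊗≫ 𝟙 _ := by monoidal
    _ = 𝟙 _ ⊗≫ Δ[A] ▷ B ⊗≫ A ◁ A ◁ ε[B] ⊗≫ 𝟙 _ := by
      rw [whisker_exchange]; monoidal
    _ = 𝟙 _ ⊗≫ Δ[A] ▷ B ⊗≫ A ◁ A ◁ (Δ[B] ≫ ε[B] ▷ B) ⊗≫ A ◁ A ◁ ε[B] ⊗≫ 𝟙 _ := by
      rw [ComonObj.counit_comul]; monoidal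
    _ = 𝟙 _ ⊗≫ Δ[A] ▷ B ⊗≫ A ◁ A ◁ Δ[B] ⊗≫ A ◁ (θ ≫ ε[B] ▷ A) ▷ B ⊗≫ A ◁ A ◁ ε[B] ⊗≫ 𝟙 _ := by
      rw [h.right_counit]; monoidal
    _ = _ := by
      rw [MonoidalCategory.tensorHom_def, MonoidalCategory.tensorHom_def]; monoidal

theorem fst_snd (h : IsCodistributive θ) :
    ((Δ[A] ⊗ₘ Δ[B]) ≫ interchange A B θ) ≫ (fst A B ⊗ₘ snd A B) = 𝟙 (A ⊗ B) := by
  unfold fst snd interchange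
  symm
  calc
    _ = 𝟙 _ ⊗≫ (Δ[A] ≫ A ◁ ε[A]) ▷ B ⊗≫ 𝟙 _ := by rw [ComonObj.comul_counit]; monoidal
    _ = 𝟙 _ ⊗≫ Δ[A] ▷ B ⊗≫ A ◁ A ◁ (Δ[B] ≫ ε[B] ▷ B) ⊗≫ A ◁ ε[A] ▷ B ⊗≫ 𝟙 _ := by
      rw [ComonObj.counit_comul]; monoidal
    _ = 𝟙 _ ⊗≫ Δ[A] ▷ B ⊗≫ A ◁ A ◁ Δ[B] ⊗≫ A ◁ (θ ≫ ε[B] ▷ A) ▷ B ⊗≫ A ◁ ε[A] ▷ B ⊗≫ 𝟙 _ := by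
      rw [h.right_counit]; monoidal
    _ = _ := by
      rw [MonoidalCategory.tensorHom_def, MonoidalCategory.tensorHom_def]; monoidal

theorem snd_snd (h : IsCodistributive θ) :
    ((Δ[A] ⊗ₘ Δ[B]) ≫ interchange A B θ) ≫ (snd A B ⊗ₘ snd A B) = snd A B ≫ Δ[B] := by
  unfold snd interchange
  symm
  calc
    _ = 𝟙 _ ⊗≫ (ε[A] ▷ B ≫ 𝟙_ 𝒞 ◁ Δ[B]) ⊗≫ 𝟙 _ := by monoidal
    _ = 𝟙 _ ⊗≫ A ◁ Δ[B] ⊗≫ ε[A] ▷ (B ⊗ B) ⊗≫ 𝟙 _ := by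
      rw [← whisker_exchange]; monoidal
    _ = 𝟙 _ ⊗≫ A ◁ Δ[B] ⊗≫ (Δ[A] ≫ A ◁ ε[A]) ▷ (B ⊗ B) ⊗≫ ε[A] ▷ (B ⊗ B) ⊗≫ 𝟙 _ := by
      rw [ComonObj.comul_counit]; monoidal
    _ = 𝟙 _ ⊗≫ A ◁ Δ[B] ⊗≫ Δ[A] ▷ (B ⊗ B) ⊗≫ A ◁ (θ ≫ B ◁ ε[A]) ▷ B ⊗≫ ε[A] ▷ (B ⊗ B) ⊗≫ 𝟙 _ := by
      rw [h.left_counit]; monoidal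
    _ = _ := by
      rw [MonoidalCategory.tensorHom_def', MonoidalCategory.tensorHom_def']; monoidal

theorem snd_fst :
    ((Δ[A] ⊗ₘ Δ[B]) ≫ interchange A B θ) ≫ (snd A B ⊗ₘ fst A B) = θ := by
  unfold fst snd interchange
  symm
  calc
    _ = 𝟙 _ ⊗≫ A ◁ (Δ[B] ≫ B ◁ ε[B]) ⊗≫ θ ⊗≫ 𝟙 _ := by rw [ComonObj.comul_counit]; monoidal
    _ = 𝟙 _ ⊗≫ A ◁ Δ[B] ⊗≫ (Δ[A] ≫ ε[A] ▷ A) ▷ (B ⊗ B) ⊗≫ A ◁ B ◁ ε[B] ⊗≫ θ ⊗≫ 𝟙 _ := by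
      rw [ComonObj.counit_comul]; monoidal
    _ = 𝟙 _ ⊗≫ A ◁ Δ[B] ⊗≫ Δ[A] ▷ (B ⊗ B) ⊗≫
          (ε[A] ▷ ((A ⊗ B) ⊗ B) ≫ 𝟙_ 𝒞 ◁ ((A ⊗ B) ◁ ε[B] ≫ θ ▷ 𝟙_ 𝒞)) ⊗≫ 𝟙 _ := by
      monoidal
    _ = 𝟙 _ ⊗≫ A ◁ Δ[B] ⊗≫ Δ[A] ▷ (B ⊗ B) ⊗≫ A ◁ θ ▷ B ⊗≫ A ◁ B ◁ A ◁ ε[B] ⊗≫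
          ε[A] ▷ (B ⊗ A) ⊗≫ 𝟙 _ := by
      rw [whisker_exchange, ← whisker_exchange]; monoidal
    _ = _ := by
      rw [MonoidalCategory.tensorHom_def', MonoidalCategory.tensorHom_def']; monoidal

end IsCodistributive

theorem cross_comul_aux (f : A ⊗ B ⟶ (A ⊗ B) ⊗ (A ⊗ B)) :
    𝟙 (A ⊗ B) ≫ f = f ≫ (𝟙 (A ⊗ B) ⊗ₘ 𝟙 (A ⊗ B)) := by
  simp

theorem cross_one_counit [MonObj A] [MonObj B] [ComonObj A] [ComonObj B]
    (hA : η[A] ≫ ε[A] = 𝟙 (𝟙_ 𝒞)) (hB : η[B] ≫ ε[B] = 𝟙 (𝟙_ 𝒞)) :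
    ((λ_ (𝟙_ 𝒞)).inv ≫ (η[A] ⊗ₘ η[B])) ≫ (ε[A] ⊗ₘ ε[B]) ≫ (λ_ (𝟙_ 𝒞)).hom = 𝟙 (𝟙_ 𝒞) := by
  simp [hA, hB]

theorem inl_fst [MonObj B] [ComonObj B] (h : η[B] ≫ ε[B] = 𝟙 (𝟙_ 𝒞)) :
    inl A B ≫ fst A B = 𝟙 A := by
  simp only [inl, fst, Category.assoc, ← whiskerLeft_comp_assoc, h]
  simp

theorem inr_snd [MonObj A] [ComonObj A] (h : η[A] ≫ ε[A] = 𝟙 (𝟙_ 𝒞)) :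
    inr A B ≫ snd A B = 𝟙 B := by
  simp only [inr, snd, Category.assoc, ← comp_whiskerRight_assoc, h]
  simp

theorem inl_snd [MonObj B] [ComonObj A] : inl A B ≫ snd A B = ε[A] ≫ η[B] := by
  simp only [inl, snd, Category.assoc]
  rw [whisker_exchange_assoc, leftUnitor_naturality, unitors_equal,
    ← rightUnitor_inv_naturality_assoc, Iso.inv_hom_id_assoc]

theorem inr_fst [MonObj A] [ComonObj B] : inr A B ≫ fst A B = ε[B] ≫ η[A] := by
  simp only [inr, fst, Category.assoc]
  rw [← whisker_exchange_assoc, rightUnitor_naturality, ← unitors_equal,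
    ← leftUnitor_inv_naturality_assoc, Iso.inv_hom_id_assoc]

theorem inl_comul [ComonObj A] [ComonObj B] [MonObj B] {θ : A ⊗ B ⟶ B ⊗ A}
    (hθ : A ◁ η[B] ≫ θ = (ρ_ A).hom ≫ (λ_ A).inv ≫ η[B] ▷ A)
    (hB : η[B] ≫ Δ[B] = (λ_ (𝟙_ 𝒞)).inv ≫ (η[B] ⊗ₘ η[B])) :
    inl A B ≫ (Δ[A] ⊗ₘ Δ[B]) ≫ interchange A B θ = Δ[A] ≫ (inl A B ⊗ₘ inl A B) := by
  unfold inl interchange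
  calc
    _ = 𝟙 _ ⊗≫ A ◁ (η[B] ≫ Δ[B]) ⊗≫ Δ[A] ▷ (B ⊗ B) ⊗≫ A ◁ θ ▷ B ⊗≫ 𝟙 _ := by
      rw [MonoidalCategory.tensorHom_def']; monoidal
    _ = 𝟙 _ ⊗≫ (A ◁ ((λ_ (𝟙_ 𝒞)).inv ≫ (𝟙_ 𝒞 ◁ η[B] ≫ η[B] ▷ B)) ≫ Δ[A] ▷ (B ⊗ B)) ⊗≫
          A ◁ θ ▷ B ⊗≫ 𝟙 _ := by
      rw [hB, MonoidalCategory.tensorHom_def' η[B]]; monoidal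
    _ = 𝟙 _ ⊗≫ Δ[A] ⊗≫ A ◁ A ◁ η[B] ⊗≫ A ◁ (A ◁ η[B] ≫ θ) ▷ B ⊗≫ 𝟙 _ := by
      rw [whisker_exchange]; monoidal
    _ = 𝟙 _ ⊗≫ Δ[A] ⊗≫ A ◁ A ◁ η[B] ⊗≫ A ◁ η[B] ▷ (A ⊗ B) ⊗≫ 𝟙 ((A ⊗ B) ⊗ (A ⊗ B)) := by
      rw [hθ]; monoidal
    _ = _ := by rw [MonoidalCategory.tensorHom_def']; monoidal

theorem inr_comul [ComonObj A] [ComonObj B] [MonObj A] {θ : A ⊗ B ⟶ B ⊗ A} {c : B ⟶ B ⊗ A}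
    (hθ : η[A] ▷ B ≫ θ = (λ_ B).hom ≫ c)
    (hA : η[A] ≫ Δ[A] = (λ_ (𝟙_ 𝒞)).inv ≫ (η[A] ⊗ₘ η[A])) :
    inr A B ≫ (Δ[A] ⊗ₘ Δ[B]) ≫ interchange A B θ =
      Δ[B] ≫ c ▷ B ≫ (α_ B A B).hom ≫ (inr A B ⊗ₘ 𝟙 (A ⊗ B)) := by
  unfold inr interchange
  calc
    _ = 𝟙 _ ⊗≫ (η[A] ≫ Δ[A]) ▷ B ⊗≫ A ◁ A ◁ Δ[B] ⊗≫ A ◁ θ ▷ B ⊗≫ 𝟙 _ := by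
      rw [MonoidalCategory.tensorHom_def]; monoidal
    _ = 𝟙 _ ⊗≫ (((λ_ (𝟙_ 𝒞)).inv ≫ (η[A] ▷ 𝟙_ 𝒞 ≫ A ◁ η[A])) ▷ B ≫ (A ⊗ A) ◁ Δ[B]) ⊗≫
          A ◁ θ ▷ B ⊗≫ 𝟙 _ := by
      rw [hA, MonoidalCategory.tensorHom_def η[A]]; monoidal
    _ = 𝟙 _ ⊗≫ Δ[B] ⊗≫ η[A] ▷ (B ⊗ B) ⊗≫ A ◁ (η[A] ▷ B ≫ θ) ▷ B ⊗≫ 𝟙 _ := by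
      rw [← whisker_exchange]; monoidal
    _ = 𝟙 _ ⊗≫ Δ[B] ⊗≫ (η[A] ▷ (B ⊗ B) ≫ A ◁ (c ▷ B)) ⊗≫ 𝟙 _ := by
      rw [hθ]; monoidal
    _ = _ := by rw [← whisker_exchange, tensorHom_id]; monoidal

theorem mul_fst [MonObj A] [MonObj B] [ComonObj B] {φ : B ⊗ A ⟶ A ⊗ B}
    (hφ : φ ≫ A ◁ ε[B] = ε[B] ▷ A ≫ (λ_ A).hom ≫ (ρ_ A).inv)
    (hB : μ[B] ≫ ε[B] = (ε[B] ⊗ₘ ε[B]) ≫ (λ_ (𝟙_ 𝒞)).hom) :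
    (interchange A B φ ≫ (μ[A] ⊗ₘ μ[B])) ≫ fst A B = (fst A B ⊗ₘ fst A B) ≫ μ[A] := by
  unfold fst interchange
  symm
  calc
    _ = 𝟙 _ ⊗≫ A ◁ ε[B] ▷ (A ⊗ B) ⊗≫ A ◁ A ◁ ε[B] ⊗≫ μ[A] := by
      rw [MonoidalCategory.tensorHom_def]; monoidal
    _ = 𝟙 _ ⊗≫ A ◁ (ε[B] ▷ A ≫ (λ_ A).hom ≫ (ρ_ A).inv) ▷ B ⊗≫ A ◁ A ◁ ε[B] ⊗≫ μ[A] := by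
      monoidal
    _ = 𝟙 _ ⊗≫ A ◁ φ ▷ B ⊗≫ ((A ⊗ A) ◁ ((ε[B] ▷ B ≫ 𝟙_ 𝒞 ◁ ε[B]) ≫ (λ_ (𝟙_ 𝒞)).hom) ≫
          μ[A] ▷ 𝟙_ 𝒞) ⊗≫ 𝟙 _ := by
      rw [← hφ]; monoidal
    _ = 𝟙 _ ⊗≫ A ◁ φ ▷ B ⊗≫ μ[A] ▷ (B ⊗ B) ⊗≫ A ◁ (μ[B] ≫ ε[B]) ⊗≫ 𝟙 _ := by
      rw [whisker_exchange, hB, MonoidalCategory.tensorHom_def ε[B]]; monoidal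
    _ = _ := by rw [MonoidalCategory.tensorHom_def]; monoidal

theorem mul_snd [MonObj A] [MonObj B] [ComonObj A] {φ : B ⊗ A ⟶ A ⊗ B} {b : B ⊗ A ⟶ B}
    (hφ : φ ≫ ε[A] ▷ B = b ≫ (λ_ B).inv)
    (hA : μ[A] ≫ ε[A] = (ε[A] ⊗ₘ ε[A]) ≫ (λ_ (𝟙_ 𝒞)).hom) :
    (interchange A B φ ≫ (μ[A] ⊗ₘ μ[B])) ≫ snd A B =
      (snd A B ⊗ₘ 𝟙 (A ⊗ B)) ≫ (α_ B A B).inv ≫ b ▷ B ≫ μ[B] := by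
  unfold snd interchange
  symm
  calc
    _ = 𝟙 _ ⊗≫ (ε[A] ▷ (B ⊗ A ⊗ B) ≫ 𝟙_ 𝒞 ◁ ((α_ B A B).inv ≫ (b ≫ (λ_ B).inv) ▷ B)) ⊗≫ μ[B] := by
      rw [tensorHom_id]; monoidal
    _ = 𝟙 _ ⊗≫ A ◁ φ ▷ B ⊗≫ A ◁ ε[A] ▷ (B ⊗ B) ⊗≫ ε[A] ▷ (B ⊗ B) ⊗≫ μ[B] := by
      rw [← whisker_exchange, ← hφ]; monoidal
    _ = 𝟙 _ ⊗≫ A ◁ φ ▷ B ⊗≫ ((A ◁ ε[A] ≫ ε[A] ▷ 𝟙_ 𝒞) ≫ (λ_ (𝟙_ 𝒞)).hom) ▷ (B ⊗ B) ⊗≫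
          μ[B] := by
      monoidal
    _ = 𝟙 _ ⊗≫ A ◁ φ ▷ B ⊗≫ μ[A] ▷ (B ⊗ B) ⊗≫ (ε[A] ▷ (B ⊗ B) ≫ 𝟙_ 𝒞 ◁ μ[B]) ⊗≫ 𝟙 _ := by
      rw [← MonoidalCategory.tensorHom_def', ← hA]; monoidal
    _ = _ := by rw [← whisker_exchange, MonoidalCategory.tensorHom_def]; monoidal

end Inclusions

/-! ### The swap against units and counits -/

section PsiUnit

variable {𝒞 : Type u} [Category.{v} 𝒞] [MonoidalCategory 𝒞] [BraidedCategory 𝒞] {H X Y : 𝒞}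

theorem one_psi [MonObj H] (c : Y ⟶ Y ⊗ H) : η[H] ▷ Y ≫ psi μ[H] c = (λ_ Y).hom ≫ c := by
  unfold psi
  calc
    _ = 𝟙 _ ⊗≫ (η[H] ▷ Y ≫ H ◁ c) ⊗≫ (β_ H Y).hom ▷ H ⊗≫ Y ◁ μ[H] := by monoidal
    _ = 𝟙 _ ⊗≫ c ⊗≫ (η[H] ▷ Y ≫ (β_ H Y).hom) ▷ H ⊗≫ Y ◁ μ[H] := by
      rw [← whisker_exchange]; monoidal
    _ = 𝟙 _ ⊗≫ c ⊗≫ Y ◁ (η[H] ▷ H ≫ μ[H]) := by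
      rw [braiding_naturality_left, braiding_tensorUnit_left]; monoidal
    _ = _ := by rw [MonObj.one_mul]; monoidal

theorem psi_counit [ComonObj H] (a : X ⊗ H ⟶ X) : psi a Δ[H] ≫ ε[H] ▷ X = a ≫ (λ_ X).inv := by
  unfold psi
  calc
    _ = 𝟙 _ ⊗≫ X ◁ Δ[H] ⊗≫ (β_ X H).hom ▷ H ⊗≫ (H ◁ a ≫ ε[H] ▷ X) ⊗≫ 𝟙 _ := by monoidal
    _ = 𝟙 _ ⊗≫ X ◁ Δ[H] ⊗≫ ((β_ X H).hom ≫ ε[H] ▷ X) ▷ H ⊗≫ a ⊗≫ 𝟙 _ := by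
      rw [whisker_exchange]; monoidal
    _ = 𝟙 _ ⊗≫ X ◁ (Δ[H] ≫ ε[H] ▷ H) ⊗≫ a ⊗≫ 𝟙 _ := by
      rw [← braiding_naturality_right, braiding_tensorUnit_right]; monoidal
    _ = _ := by rw [ComonObj.counit_comul]; monoidal

end PsiUnit

/-! ### Convolution -/

section Conv

variable {𝒞 : Type u} [Category.{v} 𝒞] [MonoidalCategory 𝒞] {X M : 𝒞} [ComonObj X] [MonObj M]

/-- The convolution product. -/
def conv (f g : X ⟶ M) : X ⟶ M := Δ[X] ≫ f ⋆ g

theorem conv_assoc (f g h : X ⟶ M) : conv (conv f g) h = conv f (conv g h) := by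
  simp only [conv]
  rw [← whiskerRight_comp_mulHom, ← whiskerLeft_comp_mulHom, mulHom_assoc,
    ComonObj.comul_assoc_assoc]

theorem one_conv (f : X ⟶ M) : conv (ε[X] ≫ η[M]) f = f := by
  rw [conv, ← whiskerRight_comp_mulHom, one_mulHom, ComonObj.counit_comul_assoc,
    Iso.inv_hom_id_assoc]

end Conv

/-! ### The cross product as a Hopf algebra -/

section CrossProd

variable {𝒞 : Type u} [Category.{v} 𝒞] [MonoidalCategory 𝒞] [BraidedCategory 𝒞] {A B E : 𝒞}

/-- The relations between a cross product `E` of `A` and `B`, the inclusions `i` and `j` of the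
factors and the projections `p` and `q` onto them. -/
structure IsCrossProd [BimonObj A] [MonObj B] [ComonObj B] [MonObj E] [ComonObj E] (b : B ⊗ A ⟶ B)
    (c : B ⟶ B ⊗ A) (i : A ⟶ E) (j : B ⟶ E) (p : E ⟶ A) (q : E ⟶ B) : Prop where
  one_i : η[A] ≫ i = η[E]
  one_j : η[B] ≫ j = η[E]
  mul_i : μ[A] ≫ i = i ⋆ i
  mul_j : μ[B] ≫ j = j ⋆ j
  p_counit : p ≫ ε[A] = ε[E]
  q_counit : q ≫ ε[B] = ε[E]
  p_comul : p ≫ Δ[A] = Δ[E] ≫ (p ⊗ₘ p)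
  q_comul : q ≫ Δ[B] = Δ[E] ≫ (q ⊗ₘ q)
  j_i : j ⋆ i = psi b Δ[A] ≫ i ⋆ j
  q_p : Δ[E] ≫ (q ⊗ₘ p) = Δ[E] ≫ (p ⊗ₘ q) ≫ psi μ[A] c
  split : Δ[E] ≫ (p ⊗ₘ q) ≫ i ⋆ j = 𝟙 E
  split' : i ⋆ j ≫ Δ[E] ≫ (p ⊗ₘ q) = 𝟙 (A ⊗ B)
  comul : i ⋆ j ≫ Δ[E] =
    ((Δ[A] ⊗ₘ Δ[B]) ≫ interchange A B (psi μ[A] c)) ≫ (i ⋆ j ⊗ₘ i ⋆ j)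
  i_p : i ≫ p = 𝟙 A
  j_q : j ≫ q = 𝟙 B
  i_q : i ≫ q = ε[A] ≫ η[B]
  j_p : j ≫ p = ε[B] ≫ η[A]
  i_comul : i ≫ Δ[E] = Δ[A] ≫ (i ⊗ₘ i)
  j_comul : j ≫ Δ[E] = Δ[B] ≫ c ▷ B ≫ (α_ B A B).hom ≫ (j ⊗ₘ i ⋆ j)
  p_mul : μ[E] ≫ p = (p ⊗ₘ p) ≫ μ[A]
  mul_q : μ[E] ≫ q = (q ⊗ₘ Δ[E] ≫ (p ⊗ₘ q)) ≫ (α_ B A B).inv ≫ b ▷ B ≫ μ[B]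

/-- A copy of `A ⊗ B` that does not carry the structure of the tensor product algebra. -/
def CrossObj (A B : 𝒞) : 𝒞 := A ⊗ B

variable [BimonObj A] [MonObj B] [ComonObj B] {b : B ⊗ A ⟶ B} {c : B ⟶ B ⊗ A}

theorem IsCrossedBimon.isDistributive (H : IsCrossedBimon b c) : IsDistributive (psi b Δ[A]) :=
  isDistributive_psi H.act_one H.act_mul H.one_act H.mul_act

theorem IsCrossedBimon.isCodistributive (H : IsCrossedBimon b c) :
    IsCodistributive (psi μ[A] c) :=
  isCodistributive_psi H.coact_counit H.coact_comul H.counit_coact H.comul_coact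

theorem IsCrossedBimon.isCodistributive_right_one (H : IsCrossedBimon b c) :
    A ◁ η[B] ≫ psi μ[A] c = (ρ_ A).hom ≫ (λ_ A).inv ≫ η[B] ▷ A := by
  rw [← psi_naturality_right μ[A] (unitCoact A) c η[B] H.one_coact,
    psi_unit_right _ (MonObj.mul_one A), Category.assoc]

theorem IsCrossedBimon.isDistributive_right_counit (H : IsCrossedBimon b c) :
    psi b Δ[A] ≫ A ◁ ε[B] = ε[B] ▷ A ≫ (λ_ A).hom ≫ (ρ_ A).inv := by
  rw [psi_naturality_left b (unitAct A) Δ[A] ε[B] H.counit_act,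
    psi_unit_left _ (ComonObj.comul_counit A)]

/-- The explicit formulas on `A ⊗ B` are used here to obtain the relations. The bialgebra and
antipode laws, and the comparison of crossed modules, are then deduced from the relations for an
arbitrary `E`. -/
theorem IsCrossedBimon.isCrossProd (H : IsCrossedBimon b c) [MonObj (CrossObj A B)]
    [ComonObj (CrossObj A B)]
    (h₁ : η[CrossObj A B] = (λ_ (𝟙_ 𝒞)).inv ≫ (η[A] ⊗ₘ η[B]))
    (h₂ : μ[CrossObj A B] = interchange A B (psi b Δ[A]) ≫ (μ[A] ⊗ₘ μ[B]))
    (h₃ : ε[CrossObj A B] = (ε[A] ⊗ₘ ε[B]) ≫ (λ_ (𝟙_ 𝒞)).hom)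
    (h₄ : Δ[CrossObj A B] = (Δ[A] ⊗ₘ Δ[B]) ≫ interchange A B (psi μ[A] c)) :
    IsCrossProd (E := CrossObj A B) b c (inl A B) (inr A B) (fst A B) (snd A B) := by
  have hφ := H.isDistributive
  have hθ := H.isCodistributive
  have ij : mulHom (M := CrossObj A B) (inl A B) (inr A B) = 𝟙 (A ⊗ B) := by
    unfold mulHom; rw [h₂]; exact hφ.inl_inr
  have pq : Δ[CrossObj A B] ≫ (fst A B ⊗ₘ snd A B) = 𝟙 (A ⊗ B) := by
    rw [h₄]; exact hθ.fst_snd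
  constructor
  · rw [h₁, inl, MonoidalCategory.tensorHom_def]; monoidal
  · rw [h₁, inr, MonoidalCategory.tensorHom_def']; monoidal
  · unfold mulHom; rw [h₂]; exact hφ.inl_inl.symm
  · unfold mulHom; rw [h₂]; exact hφ.inr_inr.symm
  · rw [h₃, fst, MonoidalCategory.tensorHom_def']; monoidal
  · rw [h₃, snd, MonoidalCategory.tensorHom_def]; monoidal
  · rw [h₄]; exact hθ.fst_fst.symm
  · rw [h₄]; exact hθ.snd_snd.symm
  · rw [ij]; unfold mulHom; rw [h₂]; exact IsDistributive.inr_inl.trans (Category.comp_id _).symm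
  · rw [reassoc_of% pq, h₄]; exact IsCodistributive.snd_fst.trans (Category.id_comp _).symm
  · rw [reassoc_of% pq, ij]; exact Category.id_comp _
  · rw [pq, ij]; exact Category.id_comp _
  · rw [ij, h₄]
    exact cross_comul_aux _
  · exact inl_fst H.one_counit
  · exact inr_snd (BimonObj.one_counit A)
  · exact inl_snd
  · exact inr_fst
  · rw [h₄]; exact inl_comul H.isCodistributive_right_one H.one_comul
  · rw [h₄, ij]; exact inr_comul (one_psi c) one_comul_eq
  · rw [h₂]; exact mul_fst H.isDistributive_right_counit H.mul_counit
  · rw [h₂, pq]; exact mul_snd (psi_counit b) mul_counit_eq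

namespace IsCrossProd

variable [MonObj E] [ComonObj E] {i : A ⟶ E} {j : B ⟶ E} {p : E ⟶ A} {q : E ⟶ B}

/-- By `split` the morphism `i ⋆ j` has the section `Δ[E] ≫ (p ⊗ₘ q)`. Precomposing `mul_comul_aux`
with two copies of the section gives the axiom on all of `E ⊗ E`. -/
theorem mul_comul (h : IsCrossProd b c i j p q) (H : IsCrossedBimon b c) :
    μ[E] ≫ Δ[E] = (Δ[E] ⊗ₘ Δ[E]) ≫ tensorμ E E E E ≫ (μ[E] ⊗ₘ μ[E]) := by
  have key := H.mul_comul_aux h.mul_i h.mul_j h.j_i h.comul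
  have hs : (Δ[E] ≫ (p ⊗ₘ q)) ≫ i ⋆ j = 𝟙 E := by rw [Category.assoc, h.split]
  have := congrArg (fun t => ((Δ[E] ≫ (p ⊗ₘ q)) ⊗ₘ (Δ[E] ≫ (p ⊗ₘ q))) ≫ t) key
  rw [← Category.assoc, tensor_comp_mulHom, tensor_comp_mulHom, ← Category.assoc _ (i ⋆ j) Δ[E],
    hs, Category.id_comp] at this
  rw [mulHom, mulHom, id_tensorHom_id, Category.id_comp,
    MonObj.tensorObj.mul_def] at this
  exact this

theorem id_eq_conv (h : IsCrossProd b c i j p q) : conv (p ≫ i) (q ≫ j) = 𝟙 E := by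
  rw [conv, ← tensor_comp_mulHom, h.split]

/-- Since `p` is comultiplicative and `i` multiplicative, `s ↦ p ≫ s ≫ i` respects convolution; it
carries the antipode of `A` to a convolution inverse of `p ≫ i`. -/
theorem conv_i (h : IsCrossProd b c i j p q) (s t : A ⟶ A) :
    conv (p ≫ s ≫ i) (p ≫ t ≫ i) = p ≫ conv s t ≫ i := by
  simp only [conv, Category.assoc]
  rw [← tensor_comp_mulHom, ← reassoc_of% h.p_comul, ← tensor_comp_mulHom, ← h.mul_i, mulHom,
    Category.assoc]

theorem conv_j (h : IsCrossProd b c i j p q) (s t : B ⟶ B) :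
    conv (q ≫ s ≫ j) (q ≫ t ≫ j) = q ≫ conv s t ≫ j := by
  simp only [conv, Category.assoc]
  rw [← tensor_comp_mulHom, ← reassoc_of% h.q_comul, ← tensor_comp_mulHom, ← h.mul_j, mulHom,
    Category.assoc]

/-- `S` is the convolution of `q ≫ t ≫ j` and `p ≫ s ≫ i`, and the identity is that of `p ≫ i` and
`q ≫ j`. In the fourfold product the two middle factors cancel, then the two outer ones. -/
theorem antipode_left (h : IsCrossProd b c i j p q) {s : A ⟶ A} {t : B ⟶ B} {S : E ⟶ E}
    (hS : S = Δ[E] ≫ (q ⊗ₘ p) ≫ (t ⊗ₘ s) ≫ j ⋆ i)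
    (hs : conv s (𝟙 A) = ε[A] ≫ η[A]) (ht : conv t (𝟙 B) = ε[B] ≫ η[B]) :
    Δ[E] ≫ S ▷ E ≫ μ[E] = ε[E] ≫ η[E] := by
  have hS' : S = conv (q ≫ t ≫ j) (p ≫ s ≫ i) := by
    rw [hS, conv, ← tensor_comp_mulHom, ← tensor_comp_mulHom]
  rw [← tensorHom_id]
  change conv S (𝟙 E) = _
  rw [hS']
  have h1 := h.conv_i s (𝟙 A)
  have h2 := h.conv_j t (𝟙 B)
  rw [Category.id_comp, hs, Category.assoc, h.one_i, reassoc_of% h.p_counit] at h1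
  rw [Category.id_comp, ht, Category.assoc, h.one_j, reassoc_of% h.q_counit] at h2
  rw [← h.id_eq_conv, conv_assoc, ← conv_assoc (p ≫ s ≫ i), h1, one_conv, h2]

theorem antipode_right (h : IsCrossProd b c i j p q) {s : A ⟶ A} {t : B ⟶ B} {S : E ⟶ E}
    (hS : S = Δ[E] ≫ (q ⊗ₘ p) ≫ (t ⊗ₘ s) ≫ j ⋆ i)
    (hs : conv (𝟙 A) s = ε[A] ≫ η[A]) (ht : conv (𝟙 B) t = ε[B] ≫ η[B]) :
    Δ[E] ≫ E ◁ S ≫ μ[E] = ε[E] ≫ η[E] := by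
  have hS' : S = conv (q ≫ t ≫ j) (p ≫ s ≫ i) := by
    rw [hS, conv, ← tensor_comp_mulHom, ← tensor_comp_mulHom]
  rw [← id_tensorHom]
  change conv (𝟙 E) S = _
  rw [hS']
  have h1 := h.conv_i (𝟙 A) s
  have h2 := h.conv_j (𝟙 B) t
  rw [Category.id_comp, hs, Category.assoc, h.one_i, reassoc_of% h.p_counit] at h1
  rw [Category.id_comp, ht, Category.assoc, h.one_j, reassoc_of% h.q_counit] at h2
  rw [← h.id_eq_conv, conv_assoc, ← conv_assoc (q ≫ j), h2, one_conv, h1]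

end IsCrossProd

end CrossProd

/-! ### Existence of the cross product -/

section Exists

variable {𝒞 : Type u} [Category.{v} 𝒞] [MonoidalCategory 𝒞] [BraidedCategory 𝒞] {A B : 𝒞}

namespace IsCrossedBimon

theorem one_comul_cross [BimonObj A] [MonObj B] [ComonObj B] {b : B ⊗ A ⟶ B} {c : B ⟶ B ⊗ A}
    (H : IsCrossedBimon b c) :
    ((λ_ (𝟙_ 𝒞)).inv ≫ (η[A] ⊗ₘ η[B])) ≫ (Δ[A] ⊗ₘ Δ[B]) ≫ interchange A B (psi μ[A] c) =
      (λ_ (𝟙_ 𝒞)).inv ≫ (((λ_ (𝟙_ 𝒞)).inv ≫ (η[A] ⊗ₘ η[B])) ⊗ₘ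
        ((λ_ (𝟙_ 𝒞)).inv ≫ (η[A] ⊗ₘ η[B]))) := by
  have hA : η[A] ≫ Δ[A] = (λ_ (𝟙_ 𝒞)).inv ≫ (η[A] ⊗ₘ η[A]) := one_comul_eq
  have hθ := H.isCodistributive_right_one
  rw [Category.assoc, tensorHom_comp_tensorHom_assoc, hA, H.one_comul, interchange]
  calc
    _ = 𝟙 _ ⊗≫ η[A] ⊗≫ A ◁ η[A] ⊗≫ A ◁ A ◁ η[B] ⊗≫ A ◁ (A ◁ η[B] ≫ psi μ[A] c) ▷ B ⊗≫
          𝟙 ((A ⊗ B) ⊗ (A ⊗ B)) := by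
      rw [MonoidalCategory.tensorHom_def, MonoidalCategory.tensorHom_def,
        MonoidalCategory.tensorHom_def' η[B]]
      monoidal
    _ = 𝟙 _ ⊗≫ (η[A] ▷ 𝟙_ 𝒞 ≫ A ◁ ((λ_ (𝟙_ 𝒞)).inv ≫ η[A] ▷ 𝟙_ 𝒞 ≫ A ◁ η[B])) ⊗≫
          A ◁ η[B] ▷ (A ⊗ B) ⊗≫ 𝟙 ((A ⊗ B) ⊗ (A ⊗ B)) := by
      rw [hθ]; monoidal
    _ = _ := by
      rw [← whisker_exchange, MonoidalCategory.tensorHom_def' _ ((λ_ (𝟙_ 𝒞)).inv ≫ _),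
        MonoidalCategory.tensorHom_def η[A]]
      monoidal

/-- The counit is `ε[A] ⋆ ε[B]` with values in the unit object, so multiplicativity is an instance
of `mulHom_mulHom_mulHom`; the commutation rule follows from linearity of `ε[B]`. -/
theorem mul_counit_cross [BimonObj A] [MonObj B] [ComonObj B] {b : B ⊗ A ⟶ B} {c : B ⟶ B ⊗ A}
    (H : IsCrossedBimon b c) :
    (interchange A B (psi b Δ[A]) ≫ (μ[A] ⊗ₘ μ[B])) ≫ (ε[A] ⊗ₘ ε[B]) ≫ (λ_ (𝟙_ 𝒞)).hom =
      (((ε[A] ⊗ₘ ε[B]) ≫ (λ_ (𝟙_ 𝒞)).hom) ⊗ₘ ((ε[A] ⊗ₘ ε[B]) ≫ (λ_ (𝟙_ 𝒞)).hom)) ≫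
        (λ_ (𝟙_ 𝒞)).hom := by
  have hA : μ[A] ≫ ε[A] = ε[A] ⋆ ε[A] := by simp [mulHom]
  have hB : μ[B] ≫ ε[B] = ε[B] ⋆ ε[B] := H.mul_counit
  have hφ : ε[B] ⋆ ε[A] = psi b Δ[A] ≫ ε[A] ⋆ ε[B] := by
    have : (ε[A] ⋆ ε[B]) = A ◁ ε[B] ≫ ε[A] ▷ 𝟙_ 𝒞 ≫ (λ_ (𝟙_ 𝒞)).hom := by
      rw [← Category.assoc, ← MonoidalCategory.tensorHom_def']; rfl
    rw [this, reassoc_of% (psi_naturality_left b (unitAct A) Δ[A] ε[B] H.counit_act),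
      psi_unit_left _ (ComonObj.comul_counit A)]
    rw [mulHom, MonoidalCategory.tensorHom_def]
    simp only [Category.assoc, ← rightUnitor_inv_naturality_assoc]
    rw [unitors_equal (C := 𝒞), Iso.inv_hom_id, Category.comp_id]
    exact congrArg (ε[B] ▷ A ≫ ·) (leftUnitor_naturality ε[A])
  exact (mulHom_mulHom_mulHom hA hB hφ).symm

/-- The antipode of `B` enters as a bare morphism `t` with its two convolution identities, because
`B` satisfies the bialgebra axiom only for the swap `psi b c`, not for the braiding of `𝒞`. -/
theorem exists_hopfObj [HopfObj A] [IsIso 𝒮[A]] [MonObj B] [ComonObj B] {b : B ⊗ A ⟶ B}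
    {c : B ⟶ B ⊗ A} (H : IsCrossedBimon b c) (t : B ⟶ B) [IsIso t]
    (ht : Δ[B] ≫ t ▷ B ≫ μ[B] = ε[B] ≫ η[B]) (ht' : Δ[B] ≫ B ◁ t ≫ μ[B] = ε[B] ≫ η[B]) :
    ∃ h : HopfObj (A ⊗ B), IsIso h.antipode ∧ hopfMaps h =
      { one := (λ_ (𝟙_ 𝒞)).inv ≫ (η[A] ⊗ₘ η[B])
        mul := interchange A B (psi b Δ[A]) ≫ (μ[A] ⊗ₘ μ[B])
        counit := (ε[A] ⊗ₘ ε[B]) ≫ (λ_ (𝟙_ 𝒞)).hom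
        comul := (Δ[A] ⊗ₘ Δ[B]) ≫ interchange A B (psi μ[A] c)
        antipode := psi μ[A] c ≫ (t ⊗ₘ 𝒮[A]) ≫ psi b Δ[A] } := by
  let : MonObj (CrossObj A B) :=
    { one := (λ_ (𝟙_ 𝒞)).inv ≫ (η[A] ⊗ₘ η[B])
      mul := interchange A B (psi b Δ[A]) ≫ (μ[A] ⊗ₘ μ[B])
      one_mul := H.isDistributive.one_mul
      mul_one := H.isDistributive.mul_one
      mul_assoc := H.isDistributive.mul_assoc }
  let : ComonObj (CrossObj A B) :=
    { counit := (ε[A] ⊗ₘ ε[B]) ≫ (λ_ (𝟙_ 𝒞)).hom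
      comul := (Δ[A] ⊗ₘ Δ[B]) ≫ interchange A B (psi μ[A] c)
      counit_comul := H.isCodistributive.counit_comul
      comul_counit := H.isCodistributive.comul_counit
      comul_assoc := H.isCodistributive.comul_assoc }
  have h := H.isCrossProd rfl rfl rfl rfl
  have hs : conv (𝒮[A]) (𝟙 A) = ε[A] ≫ η[A] := by
    rw [conv, mulHom, tensorHom_id, HopfObj.antipode_left]
  have hs' : conv (𝟙 A) (𝒮[A]) = ε[A] ≫ η[A] := by
    rw [conv, mulHom, id_tensorHom, HopfObj.antipode_right]
  replace ht : conv t (𝟙 B) = ε[B] ≫ η[B] := by rw [conv, mulHom, tensorHom_id, ht]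
  replace ht' : conv (𝟙 B) t = ε[B] ≫ η[B] := by rw [conv, mulHom, id_tensorHom, ht']
  -- The outer swaps in the antipode are `Δ ≫ (q ⊗ₘ p)` and `j ⋆ i`, so the formula is the reversed
  -- convolution product required by `antipode_left` and `antipode_right`.
  have hS : (psi μ[A] c ≫ (t ⊗ₘ 𝒮[A]) ≫ psi b Δ[A] : CrossObj A B ⟶ CrossObj A B) =
      Δ[CrossObj A B] ≫ (snd A B ⊗ₘ fst A B) ≫ (t ⊗ₘ 𝒮[A]) ≫
        mulHom (M := CrossObj A B) (inr A B) (inl A B) := by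
    have h₁ : (psi μ[A] c : CrossObj A B ⟶ B ⊗ A) = Δ[CrossObj A B] ≫ (snd A B ⊗ₘ fst A B) :=
      IsCodistributive.snd_fst.symm
    have h₂ : (psi b Δ[A] : B ⊗ A ⟶ CrossObj A B) = mulHom (M := CrossObj A B) (inr A B) (inl A B) :=
      IsDistributive.inr_inl.symm
    exact (congrArg₂ (· ≫ (t ⊗ₘ 𝒮[A]) ≫ ·) h₁ h₂).trans (Category.assoc _ _ _)
  let : BimonObj (CrossObj A B) :=
    { mul_comul := h.mul_comul H
      one_comul := H.one_comul_cross
      mul_counit := H.mul_counit_cross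
      one_counit := cross_one_counit (BimonObj.one_counit A) H.one_counit }
  let : HopfObj (CrossObj A B) :=
    { antipode := psi μ[A] c ≫ (t ⊗ₘ 𝒮[A]) ≫ psi b Δ[A]
      antipode_left := h.antipode_left hS hs ht
      antipode_right := h.antipode_right hS hs' ht' }
  refine ⟨this, ?_, rfl⟩
  -- Both swaps are invertible because the antipode of `A` is; hence so is the composite antipode.
  have h₁ : IsIso (psi μ[A] c) := ⟨psiInv μ[A] c,
    psi_psiInv _ _ (MonObj.mul_one A) (MonObj.mul_assoc A) H.coact_counit H.coact_comul,
    psiInv_psi _ _ (MonObj.mul_one A) (MonObj.mul_assoc A) H.coact_counit H.coact_comul⟩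
  have h₂ : IsIso (psi b Δ[A]) := ⟨psiInv b Δ[A],
    psi_psiInv _ _ H.act_one H.act_mul (ComonObj.comul_counit A) (ComonObj.comul_assoc A),
    psiInv_psi _ _ H.act_one H.act_mul (ComonObj.comul_counit A) (ComonObj.comul_assoc A)⟩
  have : IsIso (psi μ[A] c ≫ (t ⊗ₘ 𝒮[A]) ≫ psi b Δ[A]) := inferInstance
  exact this

end IsCrossedBimon

end Exists

/-! ### Bialgebras of crossed modules seen in `𝒞` -/

section Underlying

variable {𝒞 : Type u} [Category.{v} 𝒞] [MonoidalCategory 𝒞] [BraidedCategory 𝒞] {H : 𝒞}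

/-- The monoid in `𝒞` underlying a monoid in the category of crossed modules. -/
@[reducible]
def CrossedMod.monObjX [BimonObj H] (M : CrossedMod H) [MonObj M] : MonObj M.X where
  one := η[M].hom
  mul := μ[M].hom
  one_mul := congrArg Hom.hom (MonObj.one_mul M)
  mul_one := congrArg Hom.hom (MonObj.mul_one M)
  mul_assoc := congrArg Hom.hom (MonObj.mul_assoc M)

/-- The comonoid in `𝒞` underlying a comonoid in the category of crossed modules. -/
@[reducible]
def CrossedMod.comonObjX [BimonObj H] (M : CrossedMod H) [ComonObj M] : ComonObj M.X where
  counit := ε[M].hom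
  comul := Δ[M].hom
  counit_comul := congrArg Hom.hom (ComonObj.counit_comul M)
  comul_counit := congrArg Hom.hom (ComonObj.comul_counit M)
  comul_assoc := congrArg Hom.hom (ComonObj.comul_assoc M)

attribute [local instance] CrossedMod.monObjX CrossedMod.comonObjX

/-- Linearity and colinearity of the structure morphisms are part of their being morphisms of
crossed modules; the remaining axioms are the underlying equations, with `psi` as the braiding. -/
theorem CrossedMod.isCrossedBimon [HopfObj H] [IsIso 𝒮[H]] (M : CrossedMod H) [BimonObj M] :
    IsCrossedBimon M.act M.coact where
  act_one := M.act_one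
  act_mul := M.act_mul
  coact_counit := M.coact_counit
  coact_comul := M.coact_comul
  crossed := M.crossed
  one_act := η[M].act_hom
  mul_act := μ[M].act_hom
  counit_act := ε[M].act_hom
  comul_act := Δ[M].act_hom
  one_coact := η[M].coact_hom
  mul_coact := μ[M].coact_hom
  counit_coact := ε[M].coact_hom
  comul_coact := Δ[M].coact_hom
  mul_comul := by
    rw [interchange_eq]
    simp only [Category.assoc]
    have := congrArg Hom.hom (BimonObj.mul_comul M)
    rw [tensorμ] at this
    simp only [Category.assoc] at this
    exact this
  one_comul := congrArg Hom.hom (one_comul_eq (H := M))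
  mul_counit := congrArg Hom.hom (mul_counit_eq (H := M))
  one_counit := congrArg Hom.hom (BimonObj.one_counit M)

theorem isIso_hom [BimonObj H] {M N : CrossedMod H} (f : M ⟶ N) [IsIso f] : IsIso f.hom :=
  ⟨(inv f).hom, congrArg CrossedMod.Hom.hom (IsIso.hom_inv_id f),
    congrArg CrossedMod.Hom.hom (IsIso.inv_hom_id f)⟩

theorem nonempty_crossProduct (A : HopfAlg 𝒞) (B : HopfAlg (CrossedMod A.X)) :
    Nonempty (CrossProduct A B) := by
  have := isIso_hom 𝒮[B.X]
  obtain ⟨h, hi, hm⟩ := B.X.isCrossedBimon.exists_hopfObj 𝒮[B.X].hom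
    (congrArg CrossedMod.Hom.hom (HopfObj.antipode_left B.X))
    (congrArg CrossedMod.Hom.hom (HopfObj.antipode_right B.X))
  exact ⟨⟨h, hi, hm⟩⟩

theorem CrossProduct.isCrossProd {A : HopfAlg 𝒞} {B : HopfAlg (CrossedMod A.X)}
    (P : CrossProduct A B) :
    IsCrossProd (E := P.hopfAlg.X) B.X.act B.X.coact (inl A.X B.X.X) (inr A.X B.X.X)
      (fst A.X B.X.X) (snd A.X B.X.X) := by
  have h := P.maps_eq
  exact @IsCrossedBimon.isCrossProd 𝒞 _ _ _ A.X B.X.X _ _ _ _ _ B.X.isCrossedBimon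
    P.hopf.toMonObj P.hopf.toComonObj (congrArg HopfMaps.one h) (congrArg HopfMaps.mul h)
    (congrArg HopfMaps.counit h) (congrArg HopfMaps.comul h)

end Underlying

/-! ### Actions and coactions of a cross product -/

section Change

variable {𝒞 : Type u} [Category.{v} 𝒞] [MonoidalCategory 𝒞] [BraidedCategory 𝒞]
  {A B H K X Y : 𝒞}

/-- No algebraic structure on `H` or `K` is used. This permits restriction along `i`, but also `K =
A ⊗ B` with `f = i ⋆ j`. -/
theorem psi_comp_left {Y' : 𝒞} (a : X ⊗ H ⟶ X) (c : Y' ⟶ Y' ⊗ H) (d : Y ⟶ Y ⊗ K) (g : Y ⟶ Y')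
    (f : K ⟶ H) (hg : g ≫ c = d ≫ (g ⊗ₘ f)) :
    X ◁ g ≫ psi a c = psi (X ◁ f ≫ a) d ≫ g ▷ X := by
  unfold psi
  calc
    _ = 𝟙 _ ⊗≫ X ◁ (d ≫ (g ⊗ₘ f)) ⊗≫ (β_ X Y').hom ▷ H ⊗≫ Y' ◁ a := by rw [← hg]; monoidal
    _ = 𝟙 _ ⊗≫ X ◁ d ⊗≫ ((X ⊗ Y) ◁ f ≫ (X ◁ g ≫ (β_ X Y').hom) ▷ H) ⊗≫ Y' ◁ a := by
      rw [MonoidalCategory.tensorHom_def']; monoidal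
    _ = 𝟙 _ ⊗≫ X ◁ d ⊗≫ (β_ X Y).hom ▷ K ⊗≫ (Y ◁ (X ◁ f ≫ a) ≫ g ▷ X) := by
      rw [whisker_exchange, braiding_naturality_right, whisker_exchange g]; monoidal
    _ = _ := by monoidal

theorem psi_comp_right {X' : 𝒞} (a : X' ⊗ H ⟶ X') (c : Y ⟶ Y ⊗ H) (d : X ⊗ K ⟶ X) (g : X' ⟶ X)
    (f : H ⟶ K) (hg : a ≫ g = (g ⊗ₘ f) ≫ d) :
    psi a c ≫ Y ◁ g = g ▷ Y ≫ psi d (c ≫ Y ◁ f) := by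
  unfold psi
  calc
    _ = 𝟙 _ ⊗≫ X' ◁ c ⊗≫ (β_ X' Y).hom ▷ H ⊗≫ Y ◁ (g ▷ H ≫ X ◁ f ≫ d) := by
      have : (g ⊗ₘ f) ≫ d = g ▷ H ≫ X ◁ f ≫ d := by
        rw [MonoidalCategory.tensorHom_def, Category.assoc]
      rw [← this, ← hg]; monoidal
    _ = 𝟙 _ ⊗≫ X' ◁ c ⊗≫ ((β_ X' Y).hom ≫ Y ◁ g) ▷ H ⊗≫ (Y ⊗ X) ◁ f ⊗≫ Y ◁ d := by monoidal
    _ = 𝟙 _ ⊗≫ (X' ◁ c ≫ g ▷ (Y ⊗ H)) ⊗≫ ((β_ X Y).hom ▷ H ≫ (Y ⊗ X) ◁ f) ⊗≫ Y ◁ d := by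
      rw [← braiding_naturality_left]; monoidal
    _ = _ := by rw [whisker_exchange, ← whisker_exchange (β_ X Y).hom]; monoidal

/-- The braiding in the category of crossed modules over `A` of a module and a comodule over `B`. -/
def psi₂ (xA : X ⊗ A ⟶ X) (xB : X ⊗ B ⟶ X) (yA : Y ⟶ Y ⊗ A) (yB : Y ⟶ Y ⊗ B) : X ⊗ Y ⟶ Y ⊗ X :=
  X ◁ yB ≫ (α_ X Y B).inv ≫ psi xA yA ▷ B ≫ (α_ Y X B).hom ≫ Y ◁ xB

/-- A pure regrouping of strands: the inner `A`-coaction and `A`-action form a swap over `A`,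
enclosed by those of `B`. This is why the two braidings agree. -/
theorem psi_eq_psi₂ (xA : X ⊗ A ⟶ X) (xB : X ⊗ B ⟶ X) (yA : Y ⟶ Y ⊗ A) (yB : Y ⟶ Y ⊗ B) :
    psi ((α_ X A B).inv ≫ xA ▷ B ≫ xB) (yB ≫ yA ▷ B ≫ (α_ Y A B).hom) = psi₂ xA xB yA yB := by
  unfold psi₂ psi
  monoidal

theorem tensorAct_eq [ComonObj H] (a : X ⊗ H ⟶ X) (b : Y ⊗ H ⟶ Y) :
    tensorAct a b = (α_ X Y H).hom ≫ X ◁ psi b Δ[H] ≫ (α_ X H Y).inv ≫ a ▷ Y :=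
  tensorHom_comp_tensorμ_comp_act a b

theorem tensorCoact_eq [MonObj H] (c : X ⟶ X ⊗ H) (d : Y ⟶ Y ⊗ H) :
    tensorCoact c d = c ▷ Y ≫ (α_ X H Y).hom ≫ X ◁ psi μ[H] d ≫ (α_ X Y H).inv :=
  tensorHom_comp_tensorμ_comp_mul c d

theorem tensorAct_comp [ComonObj H] [ComonObj K] (f : K ⟶ H) (hf : f ≫ Δ[H] = Δ[K] ≫ (f ⊗ₘ f))
    (a : X ⊗ H ⟶ X) (b : Y ⊗ H ⟶ Y) :
    (X ⊗ Y) ◁ f ≫ tensorAct a b = tensorAct (X ◁ f ≫ a) (Y ◁ f ≫ b) := by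
  rw [tensorAct_eq, tensorAct_eq]
  simp only [comp_whiskerRight]
  calc
    _ = 𝟙 _ ⊗≫ X ◁ (Y ◁ f ≫ psi b Δ[H]) ⊗≫ a ▷ Y := by monoidal
    _ = _ := by rw [psi_comp_left b Δ[H] Δ[K] f f hf]; monoidal

theorem tensorCoact_comp [MonObj H] [MonObj K] (f : H ⟶ K) (hf : μ[H] ≫ f = (f ⊗ₘ f) ≫ μ[K])
    (c : X ⟶ X ⊗ H) (d : Y ⟶ Y ⊗ H) :
    tensorCoact c d ≫ (X ⊗ Y) ◁ f = tensorCoact (c ≫ X ◁ f) (d ≫ Y ◁ f) := by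
  rw [tensorCoact_eq, tensorCoact_eq]
  calc
    _ = 𝟙 _ ⊗≫ c ▷ Y ⊗≫ X ◁ (psi μ[H] d ≫ Y ◁ f) ⊗≫ 𝟙 _ := by monoidal
    _ = _ := by rw [psi_comp_right μ[H] d μ[K] f f hf]; monoidal

/-- With `H` acting on itself by multiplication, the right side contains a diagonal action, so
naturality of `tensorAct` becomes available. -/
theorem isCrossed_iff [MonObj H] [ComonObj H] (a : X ⊗ H ⟶ X) (c : X ⟶ X ⊗ H) :
    IsCrossed a c ↔ psi a Δ[H] ≫ psi μ[H] c = c ▷ H ≫ tensorAct a μ[H] := by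
  unfold IsCrossed tensorAct
  rw [MonoidalCategory.tensorHom_def, Category.assoc]

/-- The same composite read through the codiagonal coaction of `X ⊗ H`, the form suited to
colinearity arguments. -/
theorem act_tensorAct [MonObj H] [ComonObj H] (a : X ⊗ H ⟶ X) (c : X ⟶ X ⊗ H) :
    c ▷ H ≫ tensorAct a μ[H] = tensorCoact c Δ[H] ≫ a ▷ H := by
  unfold tensorAct tensorCoact
  rw [← Category.assoc (c ▷ H), ← MonoidalCategory.tensorHom_def,
    MonoidalCategory.tensorHom_def' a]
  simp only [Category.assoc]

end Change

/-! ### Total actions and coactions; linearity of inclusions and projections -/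

section Total

variable {𝒞 : Type u} [Category.{v} 𝒞] [MonoidalCategory 𝒞] [BraidedCategory 𝒞]
  {A B E X Y : 𝒞} [BimonObj A] {b : B ⊗ A ⟶ B} {c : B ⟶ B ⊗ A}

/-- The multiplication of the cross product is `interchange A B (psi b Δ[A]) ≫ (μ[A] ⊗ₘ μ[B])`. -/
theorem total_act_mul [MonObj B] {xA : X ⊗ A ⟶ X} {xB : X ⊗ B ⟶ X}
    (hA : xA ▷ A ≫ xA = (α_ X A A).hom ≫ X ◁ μ[A] ≫ xA)
    (hB : xB ▷ B ≫ xB = (α_ X B B).hom ≫ X ◁ μ[B] ≫ xB)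
    (hAB : tensorAct xA b ≫ xB = xB ▷ A ≫ xA) {t : X ⊗ (A ⊗ B) ⟶ X}
    (ht : t = (α_ X A B).inv ≫ xA ▷ B ≫ xB) :
    t ▷ (A ⊗ B) ≫ t =
      (α_ X (A ⊗ B) (A ⊗ B)).hom ≫ X ◁ (interchange A B (psi b Δ[A]) ≫ (μ[A] ⊗ₘ μ[B])) ≫ t := by
  subst ht
  calc
    _ = 𝟙 _ ⊗≫ xA ▷ B ▷ A ▷ B ⊗≫ (xB ▷ A ≫ xA) ▷ B ⊗≫ xB := by monoidal
    _ = 𝟙 _ ⊗≫ (xA ▷ (B ⊗ A) ≫ X ◁ psi b Δ[A]) ▷ B ⊗≫ xA ▷ B ▷ B ⊗≫ xB ▷ B ⊗≫ xB := by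
      rw [← hAB, tensorAct_eq]; monoidal
    _ = 𝟙 _ ⊗≫ X ◁ A ◁ psi b Δ[A] ▷ B ⊗≫ (xA ▷ A ≫ xA) ▷ (B ⊗ B) ⊗≫ xB ▷ B ≫ xB := by
      rw [← whisker_exchange]; monoidal
    _ = 𝟙 _ ⊗≫ X ◁ A ◁ psi b Δ[A] ▷ B ⊗≫ X ◁ μ[A] ▷ (B ⊗ B) ⊗≫ (xA ▷ (B ⊗ B) ≫ X ◁ μ[B]) ⊗≫ xB := by
      rw [hA, hB]; monoidal
    _ = _ := by
      rw [← whisker_exchange, interchange, MonoidalCategory.tensorHom_def]; monoidal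

/-- Colinearity of `yB`, the hypothesis `hAB`, exchanges an `A`-coaction with a later `B`-coaction
at the cost of the swap `psi μ[A] c`, the one in the coproduct of `A ⋉ B`. -/
theorem total_coact_comul [ComonObj B] {yA : X ⟶ X ⊗ A} {yB : X ⟶ X ⊗ B}
    (hA : yA ≫ X ◁ Δ[A] = yA ≫ yA ▷ A ≫ (α_ X A A).hom)
    (hB : yB ≫ X ◁ Δ[B] = yB ≫ yB ▷ B ≫ (α_ X B B).hom)
    (hAB : yB ≫ tensorCoact yA c = yA ≫ yB ▷ A) {t : X ⟶ X ⊗ (A ⊗ B)}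
    (ht : t = yB ≫ yA ▷ B ≫ (α_ X A B).hom) :
    t ≫ X ◁ ((Δ[A] ⊗ₘ Δ[B]) ≫ interchange A B (psi μ[A] c)) =
      t ≫ t ▷ (A ⊗ B) ≫ (α_ X (A ⊗ B) (A ⊗ B)).hom := by
  subst ht
  symm
  calc
    _ = 𝟙 _ ⊗≫ yB ⊗≫ (yA ≫ yB ▷ A) ▷ B ⊗≫ yA ▷ B ▷ A ▷ B ⊗≫ 𝟙 _ := by monoidal
    _ = 𝟙 _ ⊗≫ yB ⊗≫ yB ▷ B ⊗≫ yA ▷ (B ⊗ B) ⊗≫ (X ◁ psi μ[A] c ≫ yA ▷ (B ⊗ A)) ▷ B ⊗≫ 𝟙 _ := by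
      rw [← hAB, tensorCoact_eq]; monoidal
    _ = 𝟙 _ ⊗≫ (yB ≫ yB ▷ B) ⊗≫ (yA ≫ yA ▷ A) ▷ (B ⊗ B) ⊗≫ X ◁ A ◁ psi μ[A] c ▷ B ⊗≫ 𝟙 _ := by
      rw [whisker_exchange]; monoidal
    _ = 𝟙 _ ⊗≫ (yB ≫ yB ▷ B ≫ (α_ X B B).hom) ⊗≫
          (yA ≫ yA ▷ A ≫ (α_ X A A).hom) ▷ (B ⊗ B) ⊗≫ X ◁ A ◁ psi μ[A] c ▷ B ⊗≫ 𝟙 _ := by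
      monoidal
    _ = 𝟙 _ ⊗≫ yB ⊗≫ (X ◁ Δ[B] ≫ yA ▷ (B ⊗ B)) ⊗≫ X ◁ Δ[A] ▷ (B ⊗ B) ⊗≫
          X ◁ A ◁ psi μ[A] c ▷ B ⊗≫ 𝟙 _ := by
      rw [← hA, ← hB]; monoidal
    _ = _ := by
      rw [whisker_exchange, interchange, MonoidalCategory.tensorHom_def']; monoidal

variable [MonObj B] [ComonObj B]

namespace IsCrossProd

section Mon

variable [MonObj E] [ComonObj E] {i : A ⟶ E} {j : B ⟶ E} {p : E ⟶ A} {q : E ⟶ B}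

theorem i_eq (h : IsCrossProd b c i j p q) : i = (ρ_ A).inv ≫ A ◁ η[B] ≫ i ⋆ j := by
  rw [whiskerLeft_comp_mulHom, h.one_j, mulHom_one, Iso.inv_hom_id_assoc]

theorem j_eq (h : IsCrossProd b c i j p q) : j = (λ_ B).inv ≫ η[A] ▷ B ≫ i ⋆ j := by
  rw [whiskerRight_comp_mulHom, h.one_i, one_mulHom, Iso.inv_hom_id_assoc]

theorem i_split (h : IsCrossProd b c i j p q) :
    i ≫ Δ[E] ≫ (p ⊗ₘ q) = (ρ_ A).inv ≫ A ◁ η[B] := by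
  conv_lhs => rw [h.i_eq]
  simp only [Category.assoc, h.split', Category.comp_id]

theorem j_split (h : IsCrossProd b c i j p q) :
    j ≫ Δ[E] ≫ (p ⊗ₘ q) = (λ_ B).inv ≫ η[A] ▷ B := by
  conv_lhs => rw [h.j_eq]
  simp only [Category.assoc, h.split', Category.comp_id]

theorem split_fst (h : IsCrossProd b c i j p q) :
    (Δ[E] ≫ (p ⊗ₘ q)) ≫ A ◁ ε[B] ≫ (ρ_ A).hom = p := by
  rw [Category.assoc, ← id_tensorHom, tensorHom_comp_tensorHom_assoc, h.q_counit,
    Category.comp_id, MonoidalCategory.tensorHom_def', Category.assoc, rightUnitor_naturality,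
    ComonObj.comul_counit_assoc, Iso.inv_hom_id_assoc]

theorem split_snd (h : IsCrossProd b c i j p q) :
    (Δ[E] ≫ (p ⊗ₘ q)) ≫ ε[A] ▷ B ≫ (λ_ B).hom = q := by
  rw [Category.assoc, ← tensorHom_id, tensorHom_comp_tensorHom_assoc, h.p_counit,
    Category.comp_id, MonoidalCategory.tensorHom_def, Category.assoc, leftUnitor_naturality,
    ComonObj.counit_comul_assoc, Iso.inv_hom_id_assoc]

theorem mulHom_p (h : IsCrossProd b c i j p q) : i ⋆ j ≫ p = A ◁ ε[B] ≫ (ρ_ A).hom := by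
  conv_lhs => rw [← h.split_fst]
  rw [← Category.assoc (i ⋆ j), h.split', Category.id_comp]

theorem mulHom_q (h : IsCrossProd b c i j p q) : i ⋆ j ≫ q = ε[A] ▷ B ≫ (λ_ B).hom := by
  conv_lhs => rw [← h.split_snd]
  rw [← Category.assoc (i ⋆ j), h.split', Category.id_comp]

theorem mul_i_p (h : IsCrossProd b c i j p q) : (E ◁ i ≫ μ[E]) ≫ p = p ▷ A ≫ μ[A] := by
  rw [Category.assoc, h.p_mul, ← id_tensorHom, tensorHom_comp_tensorHom_assoc, h.i_p,
    Category.id_comp, tensorHom_id]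

/-- By `i_split`, `i a` has components `a` and `1`, so `mul_q` leaves only the action of `a`. Thus
`q` is linear for right multiplication through `i`. -/
theorem mul_i_q (h : IsCrossProd b c i j p q) : (E ◁ i ≫ μ[E]) ≫ q = q ▷ A ≫ b := by
  rw [Category.assoc, h.mul_q, ← id_tensorHom, tensorHom_comp_tensorHom_assoc, h.i_split,
    Category.id_comp]
  calc
    _ = 𝟙 _ ⊗≫ q ▷ A ⊗≫ ((B ⊗ A) ◁ η[B] ≫ b ▷ B) ⊗≫ μ[B] := by
      rw [MonoidalCategory.tensorHom_def]; monoidal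
    _ = 𝟙 _ ⊗≫ (q ▷ A ≫ b) ⊗≫ (B ◁ η[B] ≫ μ[B]) := by
      rw [whisker_exchange]; monoidal
    _ = _ := by rw [MonObj.mul_one]; monoidal

theorem mul_j_q (h : IsCrossProd b c i j p q) (hb : B ◁ η[A] ≫ b = (ρ_ B).hom) :
    (E ◁ j ≫ μ[E]) ≫ q = q ▷ B ≫ μ[B] := by
  rw [Category.assoc, h.mul_q, ← id_tensorHom, tensorHom_comp_tensorHom_assoc, h.j_split,
    Category.id_comp]
  calc
    _ = 𝟙 _ ⊗≫ q ▷ B ⊗≫ (B ◁ η[A] ≫ b) ▷ B ⊗≫ μ[B] := by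
      rw [MonoidalCategory.tensorHom_def]; monoidal
    _ = _ := by rw [hb]; monoidal

theorem i_mul_q (h : IsCrossProd b c i j p q) (hb : unitAct A ≫ η[B] = η[B] ▷ A ≫ b) :
    (i ▷ E ≫ μ[E]) ≫ q = ε[A] ▷ E ≫ (λ_ E).hom ≫ q := by
  rw [Category.assoc, h.mul_q, ← tensorHom_id, tensorHom_comp_tensorHom_assoc, h.i_q,
    Category.id_comp]
  calc
    _ = 𝟙 _ ⊗≫ (A ◁ (Δ[E] ≫ (p ⊗ₘ q)) ≫ ε[A] ▷ (A ⊗ B)) ⊗≫ (η[B] ▷ A ≫ b) ▷ B ⊗≫ μ[B] := by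
      rw [MonoidalCategory.tensorHom_def' (ε[A] ≫ η[B])]
      monoidal
    _ = 𝟙 _ ⊗≫ ε[A] ▷ E ⊗≫ ((Δ[E] ≫ (p ⊗ₘ q)) ≫ ε[A] ▷ B ≫ (λ_ B).hom) ⊗≫
          (η[B] ▷ B ≫ μ[B]) := by
      rw [← hb, unitAct, whisker_exchange]; monoidal
    _ = _ := by rw [h.split_snd, MonObj.one_mul]; monoidal

/-- The first leg of the coproduct of `j b` lies in the image of `j`, where `p` reduces to the
counit by `j_p`. Colinearity of `ε[B]` then removes the leftover coaction. -/
theorem j_comul_fst (h : IsCrossProd b c i j p q) (hc : c ≫ ε[B] ▷ A = ε[B] ≫ unitCoact A) :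
    j ≫ Δ[E] ≫ p ▷ E = j ≫ (λ_ E).inv ≫ η[A] ▷ E := by
  rw [reassoc_of% h.j_comul, ← tensorHom_id p, tensorHom_comp_tensorHom, h.j_p, Category.comp_id]
  calc
    _ = 𝟙 _ ⊗≫ Δ[B] ⊗≫ (c ≫ ε[B] ▷ A) ▷ B ⊗≫ (𝟙_ 𝒞 ◁ i ⋆ j ≫ η[A] ▷ E) := by
      rw [MonoidalCategory.tensorHom_def, comp_whiskerRight, Category.assoc, ← whisker_exchange]
      monoidal
    _ = 𝟙 _ ⊗≫ (Δ[B] ≫ ε[B] ▷ B) ⊗≫ ((λ_ B).inv ≫ η[A] ▷ B ≫ i ⋆ j) ⊗≫ η[A] ▷ E := by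
      rw [hc, unitCoact]; monoidal
    _ = _ := by rw [← h.j_eq, ComonObj.counit_comul]; monoidal

theorem j_comul_snd (h : IsCrossProd b c i j p q) :
    j ≫ Δ[E] ≫ E ◁ p = c ≫ j ▷ A := by
  rw [reassoc_of% h.j_comul, ← id_tensorHom, tensorHom_comp_tensorHom, Category.comp_id]
  rw [h.mulHom_p]
  calc
    _ = 𝟙 _ ⊗≫ (Δ[B] ≫ c ▷ B ≫ (B ⊗ A) ◁ ε[B]) ⊗≫ j ▷ A := by
      rw [MonoidalCategory.tensorHom_def']; monoidal
    _ = 𝟙 _ ⊗≫ (Δ[B] ≫ B ◁ ε[B]) ⊗≫ c ⊗≫ j ▷ A := by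
      rw [← whisker_exchange]; monoidal
    _ = _ := by rw [ComonObj.comul_counit]; monoidal

/-- Moving `i` past `j` by `j_i` shows that `i ⋆ j` is linear from the diagonal action on `A ⊗ B` to
right multiplication through `i`. -/
theorem mulHom_i (h : IsCrossProd b c i j p q) :
    (i ⋆ j) ▷ A ≫ E ◁ i ≫ μ[E] = tensorAct μ[A] b ≫ i ⋆ j := by
  rw [← MonoidalCategory.tensorHom_def_assoc]
  change (i ⋆ j) ⋆ i = _
  have key : i ⋆ (j ⋆ i) = A ◁ psi b Δ[A] ≫ (α_ A A B).inv ≫ (i ⋆ i) ⋆ j := by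
    rw [h.j_i, mulHom_assoc, Iso.inv_hom_id_assoc, whiskerLeft_comp_mulHom]
  rw [mulHom_assoc, key, ← h.mul_i, ← whiskerRight_comp_mulHom, tensorAct_eq]
  simp only [Category.assoc]

theorem mulHom_j (h : IsCrossProd b c i j p q) :
    (i ⋆ j) ▷ B ≫ E ◁ j ≫ μ[E] = (α_ A B B).hom ≫ A ◁ μ[B] ≫ i ⋆ j := by
  rw [← MonoidalCategory.tensorHom_def_assoc]
  change (i ⋆ j) ⋆ j = _
  rw [mulHom_assoc, ← h.mul_j, whiskerLeft_comp_mulHom]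

theorem mulHom_mulHom (h : IsCrossProd b c i j p q) :
    (i ⋆ j) ⋆ (i ⋆ j) = (interchange A B (psi b Δ[A]) ≫ (μ[A] ⊗ₘ μ[B])) ≫ i ⋆ j :=
  mulHom_mulHom_mulHom h.mul_i h.mul_j h.j_i

end Mon

end IsCrossProd

end Total

/-! ### Stability of the compatibility condition under products -/

section CrossedMul

variable {𝒞 : Type u} [Category.{v} 𝒞] [MonoidalCategory 𝒞] [BraidedCategory 𝒞]
  {H W X Y : 𝒞} [BimonObj H]

/-- Carries an extra `H`-strand, multiplied in from the left, through the right side of the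
compatibility condition. It rests on associativity of `μ[H]` and naturality of the braiding. -/
theorem psi_mul_tensorAct (a : X ⊗ H ⟶ X) (d : X ⟶ X ⊗ H) :
    (α_ H X H).hom ≫ H ◁ (d ▷ H ≫ tensorAct a μ[H]) ≫ (α_ H X H).inv ≫ (β_ H X).hom ▷ H ≫
      (α_ X H H).hom ≫ X ◁ μ[H] = psi μ[H] d ▷ H ≫ tensorAct a μ[H] := by
  unfold tensorAct tensorμ psi
  calc
    _ = 𝟙 _ ⊗≫ H ◁ d ▷ H ⊗≫ H ◁ (X ⊗ H) ◁ Δ[H] ⊗≫ H ◁ X ◁ (β_ H H).hom ▷ H ⊗≫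
          H ◁ a ▷ (H ⊗ H) ⊗≫ ((H ⊗ X) ◁ μ[H] ≫ (β_ H X).hom ▷ H) ⊗≫ X ◁ μ[H] := by
      rw [MonoidalCategory.tensorHom_def]; monoidal
    _ = 𝟙 _ ⊗≫ H ◁ d ▷ H ⊗≫ H ◁ (X ⊗ H) ◁ Δ[H] ⊗≫ H ◁ X ◁ (β_ H H).hom ▷ H ⊗≫
          (H ◁ a ≫ (β_ H X).hom) ▷ (H ⊗ H) ⊗≫ X ◁ H ◁ μ[H] ⊗≫ X ◁ μ[H] := by
      rw [whisker_exchange]; monoidal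
    _ = 𝟙 _ ⊗≫ H ◁ d ▷ H ⊗≫ H ◁ (X ⊗ H) ◁ Δ[H] ⊗≫ ((H ⊗ X) ◁ (β_ H H).hom ≫
          (β_ H X).hom ▷ (H ⊗ H)) ▷ H ⊗≫ X ◁ (β_ H H).hom ▷ (H ⊗ H) ⊗≫
          a ▷ (H ⊗ H ⊗ H) ⊗≫ X ◁ H ◁ μ[H] ⊗≫ X ◁ μ[H] := by
      rw [braiding_naturality_right, braiding_tensor_right_hom]; monoidal
    _ = 𝟙 _ ⊗≫ H ◁ d ▷ H ⊗≫ (((H ⊗ X) ⊗ H) ◁ Δ[H] ≫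
          ((β_ H X).hom ▷ H) ▷ (H ⊗ H)) ⊗≫ X ◁ H ◁ (β_ H H).hom ▷ H ⊗≫
          X ◁ (β_ H H).hom ▷ (H ⊗ H) ⊗≫
          a ▷ (H ⊗ H ⊗ H) ⊗≫ X ◁ ((α_ H H H).hom ≫ H ◁ μ[H] ≫ μ[H]) := by
      rw [whisker_exchange]; monoidal
    _ = 𝟙 _ ⊗≫ H ◁ d ▷ H ⊗≫ (β_ H X).hom ▷ H ▷ H ⊗≫ (X ⊗ H ⊗ H) ◁ Δ[H] ⊗≫
          X ◁ (β_ (H ⊗ H) H).hom ▷ H ⊗≫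
          (a ▷ ((H ⊗ H) ⊗ H) ≫ X ◁ μ[H] ▷ H) ⊗≫ X ◁ μ[H] := by
      rw [whisker_exchange, ← MonObj.mul_assoc, braiding_tensor_left_hom]; monoidal
    _ = 𝟙 _ ⊗≫ H ◁ d ▷ H ⊗≫ (β_ H X).hom ▷ H ▷ H ⊗≫ (X ⊗ H ⊗ H) ◁ Δ[H] ⊗≫
          X ◁ ((β_ (H ⊗ H) H).hom ≫ H ◁ μ[H]) ▷ H ⊗≫
          a ▷ (H ⊗ H) ⊗≫ X ◁ μ[H] := by
      rw [← whisker_exchange]; monoidal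
    _ = 𝟙 _ ⊗≫ H ◁ d ▷ H ⊗≫ (β_ H X).hom ▷ H ▷ H ⊗≫ X ◁ ((H ⊗ H) ◁ Δ[H] ≫ μ[H] ▷ (H ⊗ H)) ⊗≫
          X ◁ (β_ H H).hom ▷ H ⊗≫ a ▷ (H ⊗ H) ⊗≫ X ◁ μ[H] := by
      rw [← braiding_naturality_left]; monoidal
    _ = _ := by
      rw [whisker_exchange, MonoidalCategory.tensorHom_def]; monoidal

/-- If the compatibility condition holds on the images of `f` and `g`, then it holds on the image
of `f ⋆ g`. -/
theorem crossed_mulHom {a : X ⊗ H ⟶ X} {d : X ⟶ X ⊗ H}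
    (ha : a ▷ H ≫ a = (α_ X H H).hom ≫ X ◁ μ[H] ≫ a) {f : W ⟶ H} {g : Y ⟶ H}
    (hf : X ◁ f ≫ psi a Δ[H] ≫ psi μ[H] d = X ◁ f ≫ d ▷ H ≫ tensorAct a μ[H])
    (hg : X ◁ g ≫ psi a Δ[H] ≫ psi μ[H] d = X ◁ g ≫ d ▷ H ≫ tensorAct a μ[H]) :
    X ◁ (f ⋆ g) ≫ psi a Δ[H] ≫ psi μ[H] d = X ◁ (f ⋆ g) ≫ d ▷ H ≫ tensorAct a μ[H] := by
  -- The swap with a product is two successive swaps. The condition `hg` is applied after the second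
  -- one and `hf` after the first; `tensorAct_mul` recombines the two diagonal actions.
  have hmul : X ◁ μ[H] ≫ psi a Δ[H] = (α_ X H H).inv ≫ psi a Δ[H] ▷ H ≫ (α_ H X H).hom ≫
      H ◁ psi a Δ[H] ≫ (α_ H H X).inv ≫ μ[H] ▷ X := by
    rw [← psi_naturality_right a (tensorCoact Δ[H] Δ[H]) Δ[H] μ[H] mul_coact_comul,
      psi_tensor_right _ _ _ ha]
    simp only [Category.assoc]
  unfold mulHom
  calc
    _ = X ◁ (f ⊗ₘ g) ≫ (X ◁ μ[H] ≫ psi a Δ[H]) ≫ psi μ[H] d := by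
      simp only [whiskerLeft_comp, Category.assoc]
    _ = 𝟙 _ ⊗≫ X ◁ f ▷ Y ⊗≫ ((X ⊗ H) ◁ g ≫ psi a Δ[H] ▷ H) ⊗≫ H ◁ psi a Δ[H] ⊗≫
          (μ[H] ▷ X ≫ psi μ[H] d) := by
      rw [hmul, MonoidalCategory.tensorHom_def]; monoidal
    _ = 𝟙 _ ⊗≫ X ◁ f ▷ Y ⊗≫ psi a Δ[H] ▷ Y ⊗≫
          H ◁ (X ◁ g ≫ psi a Δ[H] ≫ psi μ[H] d) ⊗≫
          (β_ H X).hom ▷ H ⊗≫ X ◁ μ[H] := by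
      rw [whisker_exchange, mul_psi]; monoidal
    _ = 𝟙 _ ⊗≫ X ◁ f ▷ Y ⊗≫ (psi a Δ[H] ▷ Y ≫ (H ⊗ X) ◁ g) ≫
          ((α_ H X H).hom ≫ H ◁ (d ▷ H ≫ tensorAct a μ[H]) ≫ (α_ H X H).inv ≫
          (β_ H X).hom ▷ H ≫ (α_ X H H).hom ≫ X ◁ μ[H]) := by
      rw [hg]; monoidal
    _ = 𝟙 _ ⊗≫ (X ◁ f ≫ psi a Δ[H] ≫ psi μ[H] d) ▷ Y ⊗≫ ((X ⊗ H) ◁ g ≫ tensorAct a μ[H]) := by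
      rw [psi_mul_tensorAct]
      have := whisker_exchange (psi μ[H] d) g
      calc
        _ = 𝟙 _ ⊗≫ X ◁ f ▷ Y ⊗≫ psi a Δ[H] ▷ Y ⊗≫ ((H ⊗ X) ◁ g ≫ psi μ[H] d ▷ H) ⊗≫
              tensorAct a μ[H] := by monoidal
        _ = _ := by rw [this]; monoidal
    _ = 𝟙 _ ⊗≫ (X ◁ f ≫ d ▷ H) ▷ Y ⊗≫ (tensorAct a μ[H] ▷ Y ≫ (X ⊗ H) ◁ g) ≫ tensorAct a μ[H] := by
      rw [hf]; monoidal
    _ = 𝟙 _ ⊗≫ (X ◁ f ≫ d ▷ H) ▷ Y ⊗≫ ((X ⊗ H) ⊗ H) ◁ g ≫ tensorAct a μ[H] ▷ H ≫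
          tensorAct a μ[H] := by
      rw [← whisker_exchange]; monoidal
    _ = 𝟙 _ ⊗≫ X ◁ f ▷ Y ⊗≫ (d ▷ (H ⊗ Y) ≫ (X ⊗ H) ◁ (H ◁ g ≫ μ[H])) ≫ tensorAct a μ[H] := by
      rw [tensorAct_mul _ _ ha (MonObj.mul_assoc H)]; monoidal
    _ = _ := by
      rw [← whisker_exchange, MonoidalCategory.tensorHom_def]; monoidal

end CrossedMul

/-! ### The swap over a cross product on each factor -/

section TotalPsi

variable {𝒞 : Type u} [Category.{v} 𝒞] [MonoidalCategory 𝒞] [BraidedCategory 𝒞]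
  {A B E W X Y K : 𝒞}

theorem comp_psi_mul [MonObj E] (f : W ⟶ E) (d : X ⟶ X ⊗ K) (g : K ⟶ E) :
    f ▷ X ≫ psi μ[E] (d ≫ X ◁ g) =
      W ◁ d ≫ (α_ W X K).inv ≫ (β_ W X).hom ▷ K ≫ (α_ X W K).hom ≫ X ◁ (f ⋆ g) := by
  unfold psi mulHom
  calc
    _ = 𝟙 _ ⊗≫ (f ▷ X ≫ E ◁ d) ⊗≫ ((E ⊗ X) ◁ g ≫ (β_ E X).hom ▷ E) ⊗≫ X ◁ μ[E] := by monoidal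
    _ = 𝟙 _ ⊗≫ W ◁ d ⊗≫ (f ▷ X ≫ (β_ E X).hom) ▷ K ⊗≫ X ◁ E ◁ g ⊗≫ X ◁ μ[E] := by
      rw [← whisker_exchange, whisker_exchange (β_ E X).hom]; monoidal
    _ = _ := by rw [braiding_naturality_left, MonoidalCategory.tensorHom_def]; monoidal

variable [BimonObj A] [MonObj B] [ComonObj B] [BimonObj E] {b : B ⊗ A ⟶ B} {c : B ⟶ B ⊗ A}
  {i : A ⟶ E} {j : B ⟶ E} {p : E ⟶ A} {q : E ⟶ B}

namespace IsCrossProd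

/-- `i ⋆ j` has a section, so whiskering by it is epi. -/
theorem act_ext (h : IsCrossProd b c i j p q) {f g : X ⊗ E ⟶ Y}
    (hfg : X ◁ (i ⋆ j) ≫ f = X ◁ (i ⋆ j) ≫ g) : f = g := by
  have := congrArg (X ◁ (Δ[E] ≫ (p ⊗ₘ q)) ≫ ·) hfg
  simpa only [← whiskerLeft_comp_assoc, Category.assoc, h.split, whiskerLeft_id, Category.id_comp]
    using this

theorem coact_ext (h : IsCrossProd b c i j p q) {f g : Y ⟶ X ⊗ E}
    (hfg : f ≫ X ◁ (Δ[E] ≫ (p ⊗ₘ q)) = g ≫ X ◁ (Δ[E] ≫ (p ⊗ₘ q))) : f = g := by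
  have := congrArg (· ≫ X ◁ (i ⋆ j)) hfg
  simpa only [← whiskerLeft_comp, Category.assoc, h.split, whiskerLeft_id, Category.comp_id]
    using this

variable {a : X ⊗ E ⟶ X} {d : X ⟶ X ⊗ E}

theorem psi_i (h : IsCrossProd b c i j p q) (a : X ⊗ E ⟶ X) :
    X ◁ i ≫ psi a Δ[E] = psi (X ◁ i ≫ a) Δ[A] ≫ i ▷ X :=
  psi_comp_left _ _ _ _ _ h.i_comul

/-- The coproduct of `j b` has second leg in both factors (`j_comul`), so the restriction along `j`
involves the `A`-action as well and yields `psi₂`. -/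
theorem psi_j (h : IsCrossProd b c i j p q)
    (ha : a ▷ E ≫ a = (α_ X E E).hom ≫ X ◁ μ[E] ≫ a) :
    X ◁ j ≫ psi a Δ[E] = psi₂ (X ◁ i ≫ a) (X ◁ j ≫ a) c Δ[B] ≫ j ▷ X := by
  rw [psi_comp_left a Δ[E] (Δ[B] ≫ c ▷ B ≫ (α_ B A B).hom) j (i ⋆ j) (by simp [h.j_comul]),
    act_split ha, psi_eq_psi₂]

theorem psi_p (h : IsCrossProd b c i j p q) (d : X ⟶ X ⊗ E) :
    psi μ[E] d ≫ X ◁ p = p ▷ X ≫ psi μ[A] (d ≫ X ◁ p) :=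
  psi_comp_right _ _ _ _ _ h.p_mul

theorem psi_q (h : IsCrossProd b c i j p q)
    (hd : d ≫ X ◁ Δ[E] = d ≫ d ▷ E ≫ (α_ X E E).hom) :
    psi μ[E] d ≫ X ◁ q = q ▷ X ≫ psi₂ b μ[B] (d ≫ X ◁ p) (d ≫ X ◁ q) := by
  rw [psi_comp_right μ[E] d ((α_ B A B).inv ≫ b ▷ B ≫ μ[B]) q (Δ[E] ≫ (p ⊗ₘ q)) h.mul_q,
    coact_split hd, psi_eq_psi₂]

theorem coact_eq (h : IsCrossProd b c i j p q)
    (hd : d ≫ X ◁ Δ[E] = d ≫ d ▷ E ≫ (α_ X E E).hom) :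
    d = ((d ≫ X ◁ q) ≫ (d ≫ X ◁ p) ▷ B ≫ (α_ X A B).hom) ≫ X ◁ (i ⋆ j) := by
  rw [← coact_split hd, Category.assoc, ← whiskerLeft_comp, Category.assoc, h.split,
    whiskerLeft_id, Category.comp_id]

theorem i_psi (h : IsCrossProd b c i j p q)
    (hd : d ≫ X ◁ Δ[E] = d ≫ d ▷ E ≫ (α_ X E E).hom) :
    i ▷ X ≫ psi μ[E] d = A ◁ (d ≫ X ◁ q) ≫ (α_ A X B).inv ≫ psi μ[A] (d ≫ X ◁ p) ▷ B ≫
      (α_ X A B).hom ≫ X ◁ (i ⋆ j) := by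
  conv_lhs => rw [h.coact_eq hd]
  have : i ⋆ (i ⋆ j) = (α_ A A B).inv ≫ μ[A] ▷ B ≫ i ⋆ j := by
    rw [whiskerRight_comp_mulHom, h.mul_i, mulHom_assoc, Iso.inv_hom_id_assoc]
  rw [comp_psi_mul, this]
  unfold psi
  monoidal

/-- After splitting `d`, the product `j ⋆ (i ⋆ j)` is reordered by `j_i`. The resulting `psi b Δ[A]`
merges with the coaction into the swap against the coaction `d ≫ X ◁ p` by `psi_comp_coact`. -/
theorem j_psi (h : IsCrossProd b c i j p q)
    (hd : d ≫ X ◁ Δ[E] = d ≫ d ▷ E ≫ (α_ X E E).hom)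
    (hyA : (d ≫ X ◁ p) ≫ X ◁ Δ[A] = (d ≫ X ◁ p) ≫ (d ≫ X ◁ p) ▷ A ≫ (α_ X A A).hom) :
    j ▷ X ≫ psi μ[E] d = psi₂ b μ[B] (d ≫ X ◁ p) (d ≫ X ◁ q) ≫ (d ≫ X ◁ p) ▷ B ≫
      (α_ X A B).hom ≫ X ◁ (i ⋆ j) := by
  conv_lhs => rw [h.coact_eq hd]
  generalize d ≫ X ◁ p = yA at hyA ⊢
  generalize d ≫ X ◁ q = yB
  have : j ⋆ (i ⋆ j) = (α_ B A B).inv ≫ psi b Δ[A] ▷ B ≫ (α_ A B B).hom ≫ A ◁ μ[B] ≫ i ⋆ j := by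
    rw [whiskerLeft_comp_mulHom, h.mul_j, ← mulHom_assoc i j j, whiskerRight_comp_mulHom, ← h.j_i,
      mulHom_assoc, Iso.inv_hom_id_assoc]
  rw [comp_psi_mul, this, psi₂]
  symm
  calc
    _ = 𝟙 _ ⊗≫ B ◁ yB ⊗≫ psi b yA ▷ B ⊗≫ (X ◁ μ[B] ≫ yA ▷ B) ⊗≫ X ◁ (i ⋆ j) := by monoidal
    _ = 𝟙 _ ⊗≫ B ◁ yB ⊗≫ (psi b yA ≫ yA ▷ B ≫ (α_ X A B).hom) ▷ B ⊗≫ X ◁ A ◁ μ[B] ⊗≫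
          X ◁ (i ⋆ j) := by
      rw [whisker_exchange]; monoidal
    _ = _ := by rw [psi_comp_coact b yA hyA]; monoidal

theorem tensorAct_i (h : IsCrossProd b c i j p q) (a : X ⊗ E ⟶ X) (a' : Y ⊗ E ⟶ Y) :
    (X ⊗ Y) ◁ i ≫ tensorAct a a' = tensorAct (X ◁ i ≫ a) (Y ◁ i ≫ a') :=
  tensorAct_comp i h.i_comul a a'

theorem tensorAct_j (h : IsCrossProd b c i j p q) (a : X ⊗ E ⟶ X) {a' : Y ⊗ E ⟶ Y}
    (ha' : a' ▷ E ≫ a' = (α_ Y E E).hom ≫ Y ◁ μ[E] ≫ a') :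
    (X ⊗ Y) ◁ j ≫ tensorAct a a' = (α_ X Y B).hom ≫
      X ◁ psi₂ (Y ◁ i ≫ a') (Y ◁ j ≫ a') c Δ[B] ≫ (α_ X B Y).inv ≫ (X ◁ j ≫ a) ▷ Y := by
  rw [tensorAct_eq]
  calc
    _ = 𝟙 _ ⊗≫ X ◁ (Y ◁ j ≫ psi a' Δ[E]) ⊗≫ a ▷ Y := by monoidal
    _ = _ := by rw [h.psi_j ha']; monoidal

theorem tensorCoact_p (h : IsCrossProd b c i j p q) (d : X ⟶ X ⊗ E) (d' : Y ⟶ Y ⊗ E) :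
    tensorCoact d d' ≫ (X ⊗ Y) ◁ p = tensorCoact (d ≫ X ◁ p) (d' ≫ Y ◁ p) :=
  tensorCoact_comp p h.p_mul d d'

theorem tensorCoact_q (h : IsCrossProd b c i j p q) (d : X ⟶ X ⊗ E) {d' : Y ⟶ Y ⊗ E}
    (hd' : d' ≫ Y ◁ Δ[E] = d' ≫ d' ▷ E ≫ (α_ Y E E).hom) :
    tensorCoact d d' ≫ (X ⊗ Y) ◁ q = (d ≫ X ◁ q) ▷ Y ≫ (α_ X B Y).hom ≫
      X ◁ psi₂ b μ[B] (d' ≫ Y ◁ p) (d' ≫ Y ◁ q) ≫ (α_ X Y B).inv := by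
  rw [tensorCoact_eq]
  calc
    _ = 𝟙 _ ⊗≫ d ▷ Y ⊗≫ X ◁ (psi μ[E] d' ≫ Y ◁ q) ⊗≫ 𝟙 _ := by monoidal
    _ = _ := by rw [h.psi_q hd']; monoidal

end IsCrossProd

end TotalPsi

/-! ### The compatibility condition over a cross product -/

section TotalCrossed

variable {𝒞 : Type u} [Category.{v} 𝒞] [MonoidalCategory 𝒞] [BraidedCategory 𝒞]
  {A B E X : 𝒞} [BimonObj A] [MonObj B] [ComonObj B] [BimonObj E] {b : B ⊗ A ⟶ B} {c : B ⟶ B ⊗ A}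
  {i : A ⟶ E} {j : B ⟶ E} {p : E ⟶ A} {q : E ⟶ B}
  {a : X ⊗ E ⟶ X} {d : X ⟶ X ⊗ E} {xA : X ⊗ A ⟶ X} {xB : X ⊗ B ⟶ X} {yA : X ⟶ X ⊗ A}
  {yB : X ⟶ X ⊗ B}

namespace IsCrossProd

/-- On `A`, the coaction `d` is split into `yB` and `yA`. Linearity of `yB` carries it past the
action, and the condition over `A` finishes the remaining part. -/
theorem crossed_i (h : IsCrossProd b c i j p q)
    (hd : d ≫ X ◁ Δ[E] = d ≫ d ▷ E ≫ (α_ X E E).hom)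
    (hxA : X ◁ i ≫ a = xA) (hyA : d ≫ X ◁ p = yA) (hyB : d ≫ X ◁ q = yB)
    (crossedA : IsCrossed xA yA) (linear : xA ≫ yB = yB ▷ A ≫ tensorAct xA b) :
    X ◁ i ≫ psi a Δ[E] ≫ psi μ[E] d = X ◁ i ≫ d ▷ E ≫ tensorAct a μ[E] := by
  have hd' : d = (yB ≫ yA ▷ B ≫ (α_ X A B).hom) ≫ X ◁ (i ⋆ j) := by
    rw [← hyA, ← hyB]; exact h.coact_eq hd
  rw [isCrossed_iff] at crossedA
  trans yB ▷ A ≫ (α_ X B A).hom ≫ X ◁ psi b Δ[A] ≫ (α_ X A B).inv ≫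
    (yA ▷ A ≫ tensorAct xA μ[A]) ▷ B ≫ (α_ X A B).hom ≫ X ◁ (i ⋆ j)
  · rw [reassoc_of% h.psi_i a, h.i_psi hd, hxA, hyA, hyB,
      reassoc_of% (psi_naturality_left xA (tensorAct xA b) Δ[A] yB linear),
      psi_tensor_left _ _ _ (ComonObj.comul_assoc A), ← crossedA]
    simp
  · rw [whisker_exchange_assoc, h.tensorAct_i, hxA, hd']
    calc
      _ = 𝟙 _ ⊗≫ yB ▷ A ⊗≫ (yA ▷ (B ⊗ A) ≫ (X ⊗ A) ◁ psi b Δ[A]) ⊗≫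
            tensorAct xA μ[A] ▷ B ⊗≫ X ◁ (i ⋆ j) := by
        rw [← whisker_exchange]; monoidal
      _ = 𝟙 _ ⊗≫ yB ▷ A ⊗≫ yA ▷ B ▷ A ⊗≫ tensorAct (tensorAct xA μ[A]) b ≫ (α_ X A B).hom ≫
            X ◁ (i ⋆ j) := by
        rw [tensorAct_eq _ b]; monoidal
      _ = 𝟙 _ ⊗≫ yB ▷ A ⊗≫ yA ▷ B ▷ A ⊗≫ (α_ X A B).hom ▷ A ≫ tensorAct xA (tensorAct μ[A] b) ≫
            X ◁ (i ⋆ j) := by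
        rw [reassoc_of% (tensorAct_assoc xA μ[A] b)]
      _ = 𝟙 _ ⊗≫ yB ▷ A ⊗≫ yA ▷ B ▷ A ⊗≫ (α_ X A B).hom ▷ A ≫ (X ◁ (i ⋆ j)) ▷ A ≫
            tensorAct xA (E ◁ i ≫ μ[E]) := by
        have := tensorAct_natural xA xA (tensorAct μ[A] b) (E ◁ i ≫ μ[E]) (𝟙 X) (i ⋆ j) (by simp)
          h.mulHom_i.symm
        rw [id_tensorHom] at this
        rw [this]
      _ = _ := by monoidal

/-- On `B`, the condition over `B` treats `yB`, and colinearity of `xB` then moves `yA` in front of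
the action. -/
theorem crossed_j (h : IsCrossProd b c i j p q) (H : IsCrossedBimon b c)
    (ha : a ▷ E ≫ a = (α_ X E E).hom ≫ X ◁ μ[E] ≫ a)
    (hd : d ≫ X ◁ Δ[E] = d ≫ d ▷ E ≫ (α_ X E E).hom)
    (hxA : X ◁ i ≫ a = xA) (hxB : X ◁ j ≫ a = xB) (hyA : d ≫ X ◁ p = yA) (hyB : d ≫ X ◁ q = yB)
    (hA : yA ≫ X ◁ Δ[A] = yA ≫ yA ▷ A ≫ (α_ X A A).hom)
    (colinear : tensorCoact yA c ≫ xB ▷ A = xB ≫ yA)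
    (crossedB : psi₂ xA xB c Δ[B] ≫ psi₂ b μ[B] yA yB = yB ▷ B ≫ (α_ X B B).hom ≫
      X ◁ psi₂ b μ[B] c Δ[B] ≫ (α_ X B B).inv ≫ xB ▷ B) :
    X ◁ j ≫ psi a Δ[E] ≫ psi μ[E] d = X ◁ j ≫ d ▷ E ≫ tensorAct a μ[E] := by
  have hd' : d = (yB ≫ yA ▷ B ≫ (α_ X A B).hom) ≫ X ◁ (i ⋆ j) := by
    rw [← hyA, ← hyB]; exact h.coact_eq hd
  trans 𝟙 _ ⊗≫ yB ▷ B ⊗≫ X ◁ B ◁ Δ[B] ⊗≫ X ◁ psi b c ▷ B ⊗≫ yA ▷ (B ⊗ B ⊗ B) ⊗≫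
    X ◁ psi μ[A] c ▷ (B ⊗ B) ⊗≫ xB ▷ (A ⊗ B ⊗ B) ⊗≫ X ◁ A ◁ μ[B] ⊗≫ X ◁ (i ⋆ j)
  · rw [reassoc_of% h.psi_j ha, h.j_psi hd (by rw [hyA]; exact hA), hxA, hxB, hyA, hyB,
      reassoc_of% crossedB]
    conv_lhs => rw [psi₂]
    calc
      _ = 𝟙 _ ⊗≫ yB ▷ B ⊗≫ X ◁ B ◁ Δ[B] ⊗≫ X ◁ psi b c ▷ B ⊗≫ ((X ⊗ B) ◁ μ[B] ≫
            (xB ≫ yA) ▷ B) ⊗≫ X ◁ (i ⋆ j) := by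
        monoidal
      _ = 𝟙 _ ⊗≫ yB ▷ B ⊗≫ X ◁ B ◁ Δ[B] ⊗≫ X ◁ psi b c ▷ B ⊗≫ (xB ≫ yA) ▷ (B ⊗ B) ⊗≫
            X ◁ A ◁ μ[B] ⊗≫ X ◁ (i ⋆ j) := by
        rw [whisker_exchange]; monoidal
      _ = _ := by
        rw [← colinear, tensorCoact_eq]; monoidal
  · have hpsi : (i ⋆ j) ▷ B ≫ psi₂ (E ◁ i ≫ μ[E]) (E ◁ j ≫ μ[E]) c Δ[B] =
        𝟙 _ ⊗≫ A ◁ B ◁ Δ[B] ⊗≫ A ◁ psi b c ▷ B ⊗≫ psi μ[A] c ▷ (B ⊗ B) ⊗≫ B ◁ A ◁ μ[B] ⊗≫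
          B ◁ (i ⋆ j) := by
      unfold psi₂
      rw [← whisker_exchange_assoc]
      calc
        _ = 𝟙 _ ⊗≫ A ◁ B ◁ Δ[B] ⊗≫ ((i ⋆ j) ▷ B ≫ psi (E ◁ i ≫ μ[E]) c) ▷ B ⊗≫
              B ◁ (E ◁ j ≫ μ[E]) := by monoidal
        _ = 𝟙 _ ⊗≫ A ◁ B ◁ Δ[B] ⊗≫ psi (tensorAct μ[A] b) c ▷ B ⊗≫
              B ◁ ((i ⋆ j) ▷ B ≫ E ◁ j ≫ μ[E]) := by
          rw [← psi_naturality_left (tensorAct μ[A] b) _ c (i ⋆ j) h.mulHom_i.symm]; monoidal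
        _ = _ := by
          rw [h.mulHom_j, psi_tensor_left _ _ _ H.coact_comul]; monoidal
    rw [whisker_exchange_assoc, h.tensorAct_j _ (MonObj.mul_assoc E), hxB, hd']
    symm
    calc
      _ = 𝟙 _ ⊗≫ yB ▷ B ⊗≫ yA ▷ (B ⊗ B) ⊗≫ X ◁ ((i ⋆ j) ▷ B ≫
            psi₂ (E ◁ i ≫ μ[E]) (E ◁ j ≫ μ[E]) c Δ[B]) ⊗≫ xB ▷ E := by monoidal
      _ = 𝟙 _ ⊗≫ yB ▷ B ⊗≫ (yA ▷ (B ⊗ B) ≫ (X ⊗ A) ◁ (B ◁ Δ[B] ⊗≫ psi b c ▷ B)) ⊗≫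
            X ◁ psi μ[A] c ▷ (B ⊗ B) ⊗≫
            ((X ⊗ B) ◁ (A ◁ μ[B] ≫ (i ⋆ j)) ≫ xB ▷ E) := by
        rw [hpsi]; monoidal
      _ = _ := by
        rw [← whisker_exchange yA, whisker_exchange xB]; monoidal

/-- It suffices to test on `i ⋆ j`, and by `crossed_mulHom` on `i` and `j` separately. -/
theorem isCrossed (h : IsCrossProd b c i j p q) (H : IsCrossedBimon b c)
    (ha : a ▷ E ≫ a = (α_ X E E).hom ≫ X ◁ μ[E] ≫ a)
    (hd : d ≫ X ◁ Δ[E] = d ≫ d ▷ E ≫ (α_ X E E).hom)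
    (hxA : X ◁ i ≫ a = xA) (hxB : X ◁ j ≫ a = xB) (hyA : d ≫ X ◁ p = yA) (hyB : d ≫ X ◁ q = yB)
    (hA : yA ≫ X ◁ Δ[A] = yA ≫ yA ▷ A ≫ (α_ X A A).hom) (crossedA : IsCrossed xA yA)
    (linear : xA ≫ yB = yB ▷ A ≫ tensorAct xA b)
    (colinear : tensorCoact yA c ≫ xB ▷ A = xB ≫ yA)
    (crossedB : psi₂ xA xB c Δ[B] ≫ psi₂ b μ[B] yA yB = yB ▷ B ≫ (α_ X B B).hom ≫
      X ◁ psi₂ b μ[B] c Δ[B] ≫ (α_ X B B).inv ≫ xB ▷ B) :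
    IsCrossed a d :=
  (isCrossed_iff a d).2 <| h.act_ext <| crossed_mulHom ha
    (h.crossed_i hd hxA hyA hyB crossedA linear)
    (h.crossed_j H ha hd hxA hxB hyA hyB hA colinear crossedB)

/-- The first of four converse statements, each obtained by restricting the condition over `E` to
one factor and projecting to one factor. Here the pair is `i`, `p`. -/
theorem crossed_fst (h : IsCrossProd b c i j p q) (crossed : IsCrossed a d)
    (hxA : X ◁ i ≫ a = xA) (hyA : d ≫ X ◁ p = yA) : IsCrossed xA yA := by
  rw [isCrossed_iff] at crossed ⊢
  have := X ◁ i ≫= crossed =≫ X ◁ p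
  simp only [Category.assoc] at this
  rw [h.psi_p, reassoc_of% h.psi_i a, ← comp_whiskerRight_assoc, h.i_p, id_whiskerRight,
    Category.id_comp, whisker_exchange_assoc, reassoc_of% h.tensorAct_i a μ[E], hxA, hyA] at this
  rw [this, ← hyA, comp_whiskerRight, Category.assoc]
  have nat := tensorAct_natural xA xA (E ◁ i ≫ μ[E]) μ[A] (𝟙 X) p (by simp) h.mul_i_p
  rw [id_tensorHom] at nat
  rw [nat]

/-- The pair `i`, `q`. Since `q` sends `i a * e` to `ε(a) q(e)`, the left side of the condition
collapses to `xA ≫ yB`. -/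
theorem linear (h : IsCrossProd b c i j p q) (H : IsCrossedBimon b c) (crossed : IsCrossed a d)
    (hxA : X ◁ i ≫ a = xA) (hyB : d ≫ X ◁ q = yB) : xA ≫ yB = yB ▷ A ≫ tensorAct xA b := by
  rw [isCrossed_iff] at crossed
  have := X ◁ i ≫= crossed =≫ X ◁ q
  have key : i ▷ X ≫ psi μ[E] d ≫ X ◁ q = ε[A] ▷ X ≫ (λ_ X).hom ≫ yB := by
    have h₁ := comp_psi_mul i d (𝟙 E)
    have h₂ : i ⋆ 𝟙 E = i ▷ E ≫ μ[E] := by rw [mulHom, tensorHom_id]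
    rw [whiskerLeft_id, Category.comp_id, h₂] at h₁
    rw [reassoc_of% h₁]
    calc
      _ = 𝟙 _ ⊗≫ A ◁ d ⊗≫ (β_ A X).hom ▷ E ⊗≫ X ◁ ((i ▷ E ≫ μ[E]) ≫ q) := by monoidal
      _ = 𝟙 _ ⊗≫ A ◁ d ⊗≫ ((β_ A X).hom ≫ X ◁ ε[A]) ▷ E ⊗≫ X ◁ q := by
        rw [h.i_mul_q H.one_act]; monoidal
      _ = 𝟙 _ ⊗≫ (A ◁ d ≫ ε[A] ▷ (X ⊗ E)) ⊗≫ X ◁ q := by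
        rw [← braiding_naturality_left, braiding_tensorUnit_left]; monoidal
      _ = _ := by rw [whisker_exchange, ← hyB]; monoidal
  simp only [Category.assoc] at this
  rw [reassoc_of% h.psi_i a, key, reassoc_of% psi_counit (X ◁ i ≫ a), Iso.inv_hom_id_assoc,
    whisker_exchange_assoc, reassoc_of% h.tensorAct_i a μ[E], ← Category.assoc (X ◁ i), hxA] at this
  rw [this, ← hyB, comp_whiskerRight, Category.assoc]
  have nat := tensorAct_natural xA xA (E ◁ i ≫ μ[E]) b (𝟙 X) q (by simp) h.mul_i_q
  rw [id_tensorHom] at nat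
  rw [nat]

/-- The pair `j`, `p`. By `j_comul_fst` one side collapses to `xB ≫ yA`; the other is read through
`act_tensorAct`. -/
theorem colinear (h : IsCrossProd b c i j p q) (H : IsCrossedBimon b c) (crossed : IsCrossed a d)
    (hxB : X ◁ j ≫ a = xB) (hyA : d ≫ X ◁ p = yA) : tensorCoact yA c ≫ xB ▷ A = xB ≫ yA := by
  rw [isCrossed_iff, act_tensorAct] at crossed
  have := X ◁ j ≫= crossed =≫ X ◁ p
  have key : X ◁ j ≫ psi a Δ[E] ≫ p ▷ X = xB ≫ (λ_ X).inv ≫ η[A] ▷ X := by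
    unfold psi
    calc
      _ = 𝟙 _ ⊗≫ X ◁ (j ≫ Δ[E]) ⊗≫ (β_ X E).hom ▷ E ⊗≫ (E ◁ a ≫ p ▷ X) := by monoidal
      _ = 𝟙 _ ⊗≫ X ◁ (j ≫ Δ[E]) ⊗≫ ((β_ X E).hom ≫ p ▷ X) ▷ E ⊗≫ A ◁ a := by
        rw [whisker_exchange]; monoidal
      _ = 𝟙 _ ⊗≫ X ◁ (j ≫ Δ[E] ≫ p ▷ E) ⊗≫ (β_ X A).hom ▷ E ⊗≫ A ◁ a := by
        rw [← braiding_naturality_right]; monoidal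
      _ = 𝟙 _ ⊗≫ X ◁ j ⊗≫ (X ◁ η[A] ≫ (β_ X A).hom) ▷ E ⊗≫ A ◁ a := by
        rw [h.j_comul_fst H.counit_coact]; monoidal
      _ = 𝟙 _ ⊗≫ X ◁ j ⊗≫ (η[A] ▷ (X ⊗ E) ≫ A ◁ a) := by
        rw [braiding_naturality_right, braiding_tensorUnit_right]; monoidal
      _ = _ := by rw [← whisker_exchange, ← hxB]; monoidal
  simp only [Category.assoc] at this
  rw [h.psi_p, reassoc_of% key, one_psi, Iso.inv_hom_id_assoc, ← whisker_exchange, hyA] at this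
  have nat := tensorCoact_natural yA yA c (Δ[E] ≫ E ◁ p) (𝟙 X) j (by simp) h.j_comul_snd.symm
  rw [id_tensorHom] at nat
  have hp := h.tensorCoact_p d Δ[E]
  rw [hyA] at hp
  rw [this, reassoc_of% hp, ← reassoc_of% nat, ← hxB, comp_whiskerRight]

/-- The pair `j`, `q`: both swaps over `E` become iterated swaps `psi₂`. -/
theorem crossed_snd (h : IsCrossProd b c i j p q) (H : IsCrossedBimon b c)
    (crossed : IsCrossed a d)
    (ha : a ▷ E ≫ a = (α_ X E E).hom ≫ X ◁ μ[E] ≫ a)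
    (hd : d ≫ X ◁ Δ[E] = d ≫ d ▷ E ≫ (α_ X E E).hom)
    (hxA : X ◁ i ≫ a = xA) (hxB : X ◁ j ≫ a = xB) (hyA : d ≫ X ◁ p = yA) (hyB : d ≫ X ◁ q = yB) :
    psi₂ xA xB c Δ[B] ≫ psi₂ b μ[B] yA yB = yB ▷ B ≫ (α_ X B B).hom ≫
      X ◁ psi₂ b μ[B] c Δ[B] ≫ (α_ X B B).inv ≫ xB ▷ B := by
  rw [isCrossed_iff] at crossed
  have := X ◁ j ≫= crossed =≫ X ◁ q
  have key : psi₂ (E ◁ i ≫ μ[E]) (E ◁ j ≫ μ[E]) c Δ[B] ≫ B ◁ q =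
      q ▷ B ≫ psi₂ b μ[B] c Δ[B] := by
    have h₁ := psi_naturality_left (E ◁ i ≫ μ[E]) b c q h.mul_i_q
    calc
      _ = 𝟙 _ ⊗≫ E ◁ Δ[B] ⊗≫ psi (E ◁ i ≫ μ[E]) c ▷ B ⊗≫ B ◁ ((E ◁ j ≫ μ[E]) ≫ q) := by
        unfold psi₂; monoidal
      _ = 𝟙 _ ⊗≫ E ◁ Δ[B] ⊗≫ (psi (E ◁ i ≫ μ[E]) c ≫ B ◁ q) ▷ B ⊗≫ B ◁ μ[B] := by
        rw [h.mul_j_q H.act_one]; monoidal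
      _ = 𝟙 _ ⊗≫ (E ◁ Δ[B] ≫ q ▷ (B ⊗ B)) ⊗≫ psi b c ▷ B ⊗≫ B ◁ μ[B] := by
        rw [h₁]; monoidal
      _ = _ := by rw [whisker_exchange, psi₂]; monoidal
  simp only [Category.assoc] at this
  rw [h.psi_q hd, reassoc_of% h.psi_j ha, ← comp_whiskerRight_assoc, h.j_q, id_whiskerRight,
    Category.id_comp, hxA, hxB, hyA, hyB] at this
  rw [this]
  calc
    _ = d ▷ B ≫ ((X ⊗ E) ◁ j ≫ tensorAct a μ[E]) ≫ X ◁ q := by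
      rw [whisker_exchange_assoc]
      simp only [Category.assoc]
    _ = 𝟙 _ ⊗≫ d ▷ B ⊗≫ X ◁ (psi₂ (E ◁ i ≫ μ[E]) (E ◁ j ≫ μ[E]) c Δ[B]) ⊗≫
          (xB ▷ E ≫ X ◁ q) := by
      rw [h.tensorAct_j _ (MonObj.mul_assoc E), hxB]; monoidal
    _ = 𝟙 _ ⊗≫ d ▷ B ⊗≫ X ◁ (psi₂ (E ◁ i ≫ μ[E]) (E ◁ j ≫ μ[E]) c Δ[B] ≫ B ◁ q) ⊗≫
          xB ▷ B := by
      rw [← whisker_exchange]; monoidal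
    _ = _ := by rw [key, ← hyB]; monoidal

end IsCrossProd

end TotalCrossed

/-! ### Restriction of actions and coactions along a morphism -/

section Restrict

variable {𝒞 : Type u} [Category.{v} 𝒞] [MonoidalCategory 𝒞] {H K X : 𝒞}

theorem comp_act_one [MonObj H] [MonObj K] {a : X ⊗ H ⟶ X} (ha : X ◁ η[H] ≫ a = (ρ_ X).hom)
    {f : K ⟶ H} (hf : η[K] ≫ f = η[H]) : X ◁ η[K] ≫ X ◁ f ≫ a = (ρ_ X).hom := by
  rw [← whiskerLeft_comp_assoc, hf, ha]

theorem comp_act_mul [MonObj H] [MonObj K] {a : X ⊗ H ⟶ X}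
    (ha : a ▷ H ≫ a = (α_ X H H).hom ≫ X ◁ μ[H] ≫ a) {f : K ⟶ H} (hf : μ[K] ≫ f = f ⋆ f) :
    (X ◁ f ≫ a) ▷ K ≫ X ◁ f ≫ a = (α_ X K K).hom ≫ X ◁ μ[K] ≫ X ◁ f ≫ a := by
  rw [← whiskerLeft_comp_assoc, hf, act_split ha, Iso.hom_inv_id_assoc]

theorem coact_comp_counit [ComonObj H] [ComonObj K] {c : X ⟶ X ⊗ H}
    (hc : c ≫ X ◁ ε[H] = (ρ_ X).inv) {f : H ⟶ K} (hf : f ≫ ε[K] = ε[H]) :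
    (c ≫ X ◁ f) ≫ X ◁ ε[K] = (ρ_ X).inv := by
  rw [Category.assoc, ← whiskerLeft_comp, hf, hc]

theorem coact_comp_comul [ComonObj H] [ComonObj K] {c : X ⟶ X ⊗ H}
    (hc : c ≫ X ◁ Δ[H] = c ≫ c ▷ H ≫ (α_ X H H).hom) {f : H ⟶ K}
    (hf : f ≫ Δ[K] = Δ[H] ≫ (f ⊗ₘ f)) :
    (c ≫ X ◁ f) ≫ X ◁ Δ[K] = (c ≫ X ◁ f) ≫ (c ≫ X ◁ f) ▷ K ≫ (α_ X K K).hom := by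
  rw [Category.assoc, ← whiskerLeft_comp, hf, coact_split hc]

theorem act_hom_restrict {E K X Y : 𝒞} {a : X ⊗ E ⟶ X} {a' : Y ⊗ E ⟶ Y} {f : X ⟶ Y} {g : K ⟶ E}
    {x : X ⊗ K ⟶ X} {y : Y ⊗ K ⟶ Y} (hf : a ≫ f = f ▷ E ≫ a') (hx : X ◁ g ≫ a = x)
    (hy : Y ◁ g ≫ a' = y) : x ≫ f = f ▷ K ≫ y := by
  rw [← hx, ← hy, Category.assoc, hf, whisker_exchange_assoc]

theorem coact_hom_restrict {E K X Y : 𝒞} {d : X ⟶ X ⊗ E} {d' : Y ⟶ Y ⊗ E} {f : X ⟶ Y} {g : E ⟶ K}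
    {x : X ⟶ X ⊗ K} {y : Y ⟶ Y ⊗ K} (hf : d ≫ f ▷ E = f ≫ d') (hx : d ≫ X ◁ g = x)
    (hy : d' ≫ Y ◁ g = y) : x ≫ f ▷ K = f ≫ y := by
  rw [← hx, ← hy, Category.assoc, whisker_exchange, reassoc_of% hf]

theorem comp_id_eq_id_whiskerRight_comp {Y : 𝒞} {f g : X ⊗ H ⟶ Y} (h : f = g) :
    f ≫ 𝟙 Y = 𝟙 X ▷ H ≫ g := by
  simp [h]

theorem comp_id_whiskerRight_eq_id_comp {Y : 𝒞} {f g : X ⟶ Y ⊗ H} (h : f = g) :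
    f ≫ 𝟙 Y ▷ H = 𝟙 X ≫ g := by
  simp [h]

end Restrict

/-! ### Gluing and separating actions and coactions of the factors -/

section TotalStructure

variable {𝒞 : Type u} [Category.{v} 𝒞] [MonoidalCategory 𝒞] [BraidedCategory 𝒞]
  {A B E X : 𝒞} [BimonObj A] [MonObj B] [ComonObj B] {b : B ⊗ A ⟶ B} {c : B ⟶ B ⊗ A}
  {i : A ⟶ E} {j : B ⟶ E} {p : E ⟶ A} {q : E ⟶ B} {xA : X ⊗ A ⟶ X} {xB : X ⊗ B ⟶ X}
  {yA : X ⟶ X ⊗ A} {yB : X ⟶ X ⊗ B}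

namespace IsCrossProd

section Act

variable [MonObj E] [ComonObj E]

theorem act_i (h : IsCrossProd b c i j p q) (hB : X ◁ η[B] ≫ xB = (ρ_ X).hom) :
    X ◁ i ≫ X ◁ (Δ[E] ≫ (p ⊗ₘ q)) ≫ (α_ X A B).inv ≫ xA ▷ B ≫ xB = xA := by
  rw [← whiskerLeft_comp_assoc, h.i_split]
  calc
    _ = 𝟙 _ ⊗≫ ((X ⊗ A) ◁ η[B] ≫ xA ▷ B) ⊗≫ xB := by monoidal
    _ = 𝟙 _ ⊗≫ xA ⊗≫ (X ◁ η[B] ≫ xB) := by rw [whisker_exchange]; monoidal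
    _ = _ := by rw [hB]; monoidal

theorem act_j (h : IsCrossProd b c i j p q) (hA : X ◁ η[A] ≫ xA = (ρ_ X).hom) :
    X ◁ j ≫ X ◁ (Δ[E] ≫ (p ⊗ₘ q)) ≫ (α_ X A B).inv ≫ xA ▷ B ≫ xB = xB := by
  rw [← whiskerLeft_comp_assoc, h.j_split]
  calc
    _ = 𝟙 _ ⊗≫ (X ◁ η[A] ≫ xA) ▷ B ⊗≫ xB := by monoidal
    _ = _ := by rw [hA]; monoidal

theorem coact_p (h : IsCrossProd b c i j p q) (hB : yB ≫ X ◁ ε[B] = (ρ_ X).inv) :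
    ((yB ≫ yA ▷ B ≫ (α_ X A B).hom) ≫ X ◁ (i ⋆ j)) ≫ X ◁ p = yA := by
  rw [Category.assoc, ← whiskerLeft_comp, h.mulHom_p]
  calc
    _ = 𝟙 _ ⊗≫ yB ⊗≫ (yA ▷ B ≫ (X ⊗ A) ◁ ε[B]) ⊗≫ 𝟙 _ := by monoidal
    _ = 𝟙 _ ⊗≫ (yB ≫ X ◁ ε[B]) ⊗≫ yA ⊗≫ 𝟙 _ := by rw [← whisker_exchange]; monoidal
    _ = _ := by rw [hB]; monoidal

theorem coact_q (h : IsCrossProd b c i j p q) (hA : yA ≫ X ◁ ε[A] = (ρ_ X).inv) :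
    ((yB ≫ yA ▷ B ≫ (α_ X A B).hom) ≫ X ◁ (i ⋆ j)) ≫ X ◁ q = yB := by
  rw [Category.assoc, ← whiskerLeft_comp, h.mulHom_q]
  calc
    _ = 𝟙 _ ⊗≫ yB ⊗≫ (yA ≫ X ◁ ε[A]) ▷ B ⊗≫ 𝟙 _ := by monoidal
    _ = _ := by rw [hA]; monoidal

theorem act_one (h : IsCrossProd b c i j p q) (hA : X ◁ η[A] ≫ xA = (ρ_ X).hom)
    (hB : X ◁ η[B] ≫ xB = (ρ_ X).hom) :
    X ◁ η[E] ≫ X ◁ (Δ[E] ≫ (p ⊗ₘ q)) ≫ (α_ X A B).inv ≫ xA ▷ B ≫ xB = (ρ_ X).hom := by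
  rw [← h.one_i, whiskerLeft_comp, Category.assoc, h.act_i hB, hA]

theorem coact_counit (h : IsCrossProd b c i j p q) (hA : yA ≫ X ◁ ε[A] = (ρ_ X).inv)
    (hB : yB ≫ X ◁ ε[B] = (ρ_ X).inv) :
    ((yB ≫ yA ▷ B ≫ (α_ X A B).hom) ≫ X ◁ (i ⋆ j)) ≫ X ◁ ε[E] = (ρ_ X).inv := by
  rw [← h.p_counit, whiskerLeft_comp, ← Category.assoc, h.coact_p hB, hA]

/-- Transports `total_act_mul` along `s`, which is inverse to `i ⋆ j` and therefore turns `μ[E]`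
into the product given by the distributive law. -/
theorem act_mul (h : IsCrossProd b c i j p q)
    (hA : xA ▷ A ≫ xA = (α_ X A A).hom ≫ X ◁ μ[A] ≫ xA)
    (hB : xB ▷ B ≫ xB = (α_ X B B).hom ≫ X ◁ μ[B] ≫ xB)
    (hAB : tensorAct xA b ≫ xB = xB ▷ A ≫ xA) {a : X ⊗ E ⟶ X}
    (ha : a = X ◁ (Δ[E] ≫ (p ⊗ₘ q)) ≫ (α_ X A B).inv ≫ xA ▷ B ≫ xB) :
    a ▷ E ≫ a = (α_ X E E).hom ≫ X ◁ μ[E] ≫ a := by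
  set s := Δ[E] ≫ (p ⊗ₘ q) with hs
  have hμ : μ[E] ≫ s = (s ⊗ₘ s) ≫ interchange A B (psi b Δ[A]) ≫ (μ[A] ⊗ₘ μ[B]) := by
    have h₁ : s ≫ i ⋆ j = 𝟙 E := by rw [hs, Category.assoc, h.split]
    have h₂ : i ⋆ j ≫ s = 𝟙 (A ⊗ B) := h.split'
    have := (s ⊗ₘ s) ≫= h.mulHom_mulHom =≫ s
    rw [← Category.assoc, tensor_comp_mulHom, h₁, Category.assoc, h₂, Category.comp_id, mulHom,
      id_tensorHom_id, Category.id_comp] at this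
    exact this
  have key := total_act_mul hA hB hAB rfl
  generalize (α_ X A B).inv ≫ xA ▷ B ≫ xB = t at key ha
  subst ha
  rw [← whiskerLeft_comp_assoc, hμ, whiskerLeft_comp]
  calc
    _ = 𝟙 _ ⊗≫ X ◁ s ▷ E ⊗≫ (t ▷ E ≫ X ◁ s) ≫ t := by monoidal
    _ = 𝟙 _ ⊗≫ X ◁ (s ⊗ₘ s) ⊗≫ t ▷ (A ⊗ B) ≫ t := by
      rw [← whisker_exchange, MonoidalCategory.tensorHom_def]; monoidal
    _ = _ := by rw [key]; monoidal

theorem coact_comul (h : IsCrossProd b c i j p q)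
    (hA : yA ≫ X ◁ Δ[A] = yA ≫ yA ▷ A ≫ (α_ X A A).hom)
    (hB : yB ≫ X ◁ Δ[B] = yB ≫ yB ▷ B ≫ (α_ X B B).hom)
    (hAB : yB ≫ tensorCoact yA c = yA ≫ yB ▷ A) {d : X ⟶ X ⊗ E}
    (hd : d = (yB ≫ yA ▷ B ≫ (α_ X A B).hom) ≫ X ◁ (i ⋆ j)) :
    d ≫ X ◁ Δ[E] = d ≫ d ▷ E ≫ (α_ X E E).hom := by
  have key := total_coact_comul hA hB hAB rfl
  generalize yB ≫ yA ▷ B ≫ (α_ X A B).hom = t at key hd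
  subst hd
  rw [Category.assoc, ← whiskerLeft_comp, h.comul, whiskerLeft_comp, reassoc_of% key]
  symm
  calc
    _ = 𝟙 _ ⊗≫ t ⊗≫ (X ◁ (i ⋆ j) ≫ t ▷ E) ⊗≫ X ◁ (i ⋆ j) ▷ E ⊗≫ 𝟙 _ := by monoidal
    _ = _ := by
      rw [whisker_exchange, MonoidalCategory.tensorHom_def' (i ⋆ j)]; monoidal

/-- Both sides act by `j b * i a`, once reordered by `j_i`. The outcome is exactly `A`-linearity of
the restricted `B`-action. -/
theorem act_act (h : IsCrossProd b c i j p q) {a : X ⊗ E ⟶ X}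
    (ha : a ▷ E ≫ a = (α_ X E E).hom ≫ X ◁ μ[E] ≫ a) :
    tensorAct (X ◁ i ≫ a) b ≫ X ◁ j ≫ a = (X ◁ j ≫ a) ▷ A ≫ X ◁ i ≫ a := by
  have h₁ := act_split ha j i
  rw [h.j_i, whiskerLeft_comp_assoc, act_split ha i j] at h₁
  rw [tensorAct_eq]
  simp only [Category.assoc]
  rw [h₁, Iso.hom_inv_id_assoc]

theorem coact_coact (h : IsCrossProd b c i j p q) {d : X ⟶ X ⊗ E}
    (hd : d ≫ X ◁ Δ[E] = d ≫ d ▷ E ≫ (α_ X E E).hom) :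
    (d ≫ X ◁ p) ≫ (d ≫ X ◁ q) ▷ A = (d ≫ X ◁ q) ≫ tensorCoact (d ≫ X ◁ p) c := by
  have h₁ := coact_split hd q p
  rw [h.q_p, ← Category.assoc, whiskerLeft_comp, ← Category.assoc, coact_split hd p q] at h₁
  rw [tensorCoact_eq, ← cancel_mono (α_ X B A).hom, Category.assoc (d ≫ X ◁ p), ← h₁]
  simp only [Category.assoc, Iso.inv_hom_id, Category.comp_id]

end Act

end IsCrossProd

end TotalStructure

/-! ### Crossed modules over a cross product -/

section Equivalence

variable {𝒞 : Type u} [Category.{v} 𝒞] [MonoidalCategory 𝒞] [BraidedCategory 𝒞] {A E : 𝒞}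

attribute [local instance] CrossedMod.monObjX CrossedMod.comonObjX

theorem CrossedMod.ext_of_eq {H : 𝒞} [BimonObj H] {M N : CrossedMod H} (e : M.X = N.X)
    (act : M.act ≫ eqToHom e = eqToHom e ▷ H ≫ N.act)
    (coact : M.coact ≫ eqToHom e ▷ H = eqToHom e ≫ N.coact) : M = N := by
  obtain ⟨X, a, c, _, _, _, _, _⟩ := M
  obtain ⟨Y, a', c', _, _, _, _, _⟩ := N
  obtain rfl : X = Y := e
  obtain rfl : a = a' := by simpa using act
  obtain rfl : c = c' := by simpa using coact
  rfl

theorem isIso_of_hom {H : 𝒞} [BimonObj H] {M N : CrossedMod H} (f : M ⟶ N) [IsIso f.hom] :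
    IsIso f :=
  inferInstanceAs (IsIso (CrossedMod.mkIso (asIso f.hom) f.act_hom f.coact_hom).hom)

variable [HopfObj A] [IsIso 𝒮[A]] {B : CrossedMod A} [BimonObj B] [BimonObj E]
  {i : A ⟶ E} {j : B.X ⟶ E} {p : E ⟶ A} {q : E ⟶ B.X}

/-- The swap over `B`, formed with the braiding of crossed modules over `A`, has underlying morphism
`psi₂`, and the forgetful functor is faithful. -/
theorem CrossedMod.isCrossed_iff_hom (M : CrossedMod A) (a : M ⊗ B ⟶ M) (c : M ⟶ M ⊗ B) :
    IsCrossed a c ↔ psi₂ M.act a.hom B.coact Δ[B.X] ≫ psi₂ B.act μ[B.X] M.coact c.hom =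
      c.hom ▷ B.X ≫ (α_ M.X B.X B.X).hom ≫ M.X ◁ psi₂ B.act μ[B.X] B.coact Δ[B.X] ≫
        (α_ M.X B.X B.X).inv ≫ a.hom ▷ B.X := by
  rw [isCrossed_iff, tensorAct_eq]
  exact ⟨congrArg Hom.hom, fun h => CrossedMod.hom_ext h⟩

namespace IsCrossProd

/-- The crossed module over the cross product given by a crossed module over `B` in the category
of crossed modules over `A`. -/
def toTotal (h : IsCrossProd B.act B.coact i j p q) (M : CrossedMod B) : CrossedMod E where
  X := M.X.X
  act := M.X.X ◁ (Δ[E] ≫ (p ⊗ₘ q)) ≫ (α_ M.X.X A B.X).inv ≫ M.X.act ▷ B.X ≫ M.act.hom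
  coact := (M.coact.hom ≫ M.X.coact ▷ B.X ≫ (α_ M.X.X A B.X).hom) ≫ M.X.X ◁ (i ⋆ j)
  act_one := h.act_one M.X.act_one (congrArg CrossedMod.Hom.hom M.act_one)
  act_mul := h.act_mul M.X.act_mul (congrArg CrossedMod.Hom.hom M.act_mul) M.act.act_hom rfl
  coact_counit := h.coact_counit M.X.coact_counit (congrArg CrossedMod.Hom.hom M.coact_counit)
  coact_comul := h.coact_comul M.X.coact_comul (congrArg CrossedMod.Hom.hom M.coact_comul)
    M.coact.coact_hom.symm rfl
  crossed := h.isCrossed B.isCrossedBimon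
    (h.act_mul M.X.act_mul (congrArg CrossedMod.Hom.hom M.act_mul) M.act.act_hom rfl)
    (h.coact_comul M.X.coact_comul (congrArg CrossedMod.Hom.hom M.coact_comul)
      M.coact.coact_hom.symm rfl)
    (h.act_i (congrArg CrossedMod.Hom.hom M.act_one)) (h.act_j M.X.act_one)
    (h.coact_p (congrArg CrossedMod.Hom.hom M.coact_counit)) (h.coact_q M.X.coact_counit)
    M.X.coact_comul M.X.crossed M.coact.act_hom M.act.coact_hom
    ((CrossedMod.isCrossed_iff_hom _ _ _).1 M.crossed)

theorem i_act (h : IsCrossProd B.act B.coact i j p q) (M : CrossedMod B) :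
    M.X.X ◁ i ≫ (h.toTotal M).act = M.X.act :=
  h.act_i (congrArg CrossedMod.Hom.hom M.act_one)

theorem j_act (h : IsCrossProd B.act B.coact i j p q) (M : CrossedMod B) :
    M.X.X ◁ j ≫ (h.toTotal M).act = M.act.hom :=
  h.act_j M.X.act_one

theorem p_coact (h : IsCrossProd B.act B.coact i j p q) (M : CrossedMod B) :
    (h.toTotal M).coact ≫ M.X.X ◁ p = M.X.coact :=
  h.coact_p (congrArg CrossedMod.Hom.hom M.coact_counit)

theorem q_coact (h : IsCrossProd B.act B.coact i j p q) (M : CrossedMod B) :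
    (h.toTotal M).coact ≫ M.X.X ◁ q = M.coact.hom :=
  h.coact_q M.X.coact_counit

/-- The crossed module over `A` underlying a crossed module over the cross product. -/
def ofTotalBase (h : IsCrossProd B.act B.coact i j p q) (N : CrossedMod E) : CrossedMod A where
  X := N.X
  act := N.X ◁ i ≫ N.act
  coact := N.coact ≫ N.X ◁ p
  act_one := comp_act_one N.act_one h.one_i
  act_mul := comp_act_mul N.act_mul h.mul_i
  coact_counit := coact_comp_counit N.coact_counit h.p_counit
  coact_comul := coact_comp_comul N.coact_comul h.p_comul
  crossed := h.crossed_fst N.crossed rfl rfl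

/-- The crossed module over `B` in the category of crossed modules over `A` given by a crossed
module over the cross product. -/
def ofTotal (h : IsCrossProd B.act B.coact i j p q) (N : CrossedMod E) : CrossedMod B where
  X := h.ofTotalBase N
  act := ⟨N.X ◁ j ≫ N.act, h.act_act N.act_mul, h.colinear B.isCrossedBimon N.crossed rfl rfl⟩
  coact := ⟨N.coact ≫ N.X ◁ q, h.linear B.isCrossedBimon N.crossed rfl rfl,
    h.coact_coact N.coact_comul⟩
  act_one := CrossedMod.hom_ext (comp_act_one N.act_one h.one_j)
  act_mul := CrossedMod.hom_ext (comp_act_mul N.act_mul h.mul_j)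
  coact_counit := CrossedMod.hom_ext (coact_comp_counit N.coact_counit h.q_counit)
  coact_comul := CrossedMod.hom_ext (coact_comp_comul N.coact_comul h.q_comul)
  crossed := (CrossedMod.isCrossed_iff_hom _ _ _).2
    (h.crossed_snd B.isCrossedBimon N.crossed N.act_mul N.coact_comul rfl rfl rfl rfl)

theorem toTotal_ofTotal (h : IsCrossProd B.act B.coact i j p q) (N : CrossedMod E) :
    h.toTotal (h.ofTotal N) = N := by
  refine CrossedMod.ext_of_eq rfl (comp_id_eq_id_whiskerRight_comp ?_)
    (comp_id_whiskerRight_eq_id_comp (h.coact_eq N.coact_comul).symm)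
  · have : N.X ◁ (Δ[E] ≫ (p ⊗ₘ q)) ≫ (α_ N.X A B.X).inv ≫ (N.X ◁ i ≫ N.act) ▷ B.X ≫
        N.X ◁ j ≫ N.act = N.act := by
      rw [← act_split N.act_mul, ← whiskerLeft_comp_assoc, Category.assoc, h.split,
        whiskerLeft_id, Category.id_comp]
    exact this

theorem ofTotal_toTotal (h : IsCrossProd B.act B.coact i j p q) (M : CrossedMod B) :
    h.ofTotal (h.toTotal M) = M := by
  have e : h.ofTotalBase (h.toTotal M) = M.X :=
    CrossedMod.ext_of_eq rfl (comp_id_eq_id_whiskerRight_comp (h.i_act M))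
      (comp_id_whiskerRight_eq_id_comp (h.p_coact M))
  -- The equality `e` relates crossed modules with the same underlying object, so transport along it
  -- is the identity in `𝒞`.
  have he : (eqToHom e).hom = 𝟙 M.X.X := by
    have : ∀ {M N : CrossedMod A} (e : M = N), (eqToHom e).hom =
        eqToHom (congrArg CrossedMod.X e) := by
      rintro M _ rfl; rfl
    exact this e
  refine CrossedMod.ext_of_eq e (CrossedMod.hom_ext ?_) (CrossedMod.hom_ext ?_)
  · change (_ ≫ (h.toTotal M).act) ≫ (eqToHom e).hom = (eqToHom e).hom ▷ B.X ≫ M.act.hom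
    rw [he]
    exact comp_id_eq_id_whiskerRight_comp (h.j_act M)
  · change ((h.toTotal M).coact ≫ _) ≫ (eqToHom e).hom ▷ B.X = (eqToHom e).hom ≫ M.coact.hom
    rw [he]
    exact comp_id_whiskerRight_eq_id_comp (h.q_coact M)

theorem toTotal_injective (h : IsCrossProd B.act B.coact i j p q) :
    Function.Injective h.toTotal :=
  Function.LeftInverse.injective h.ofTotal_toTotal

end IsCrossProd

end Equivalence

/-! ### Tensor products, braiding and Hopf structures under `toTotal` -/

section Transfer

variable {𝒞 : Type u} [Category.{v} 𝒞] [MonoidalCategory 𝒞] [BraidedCategory 𝒞] {A E : 𝒞}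

attribute [local instance] CrossedMod.monObjX CrossedMod.comonObjX

namespace IsCrossProd

section Ext

variable [BimonObj A] {B X : 𝒞} [MonObj B] [ComonObj B] [BimonObj E] {b : B ⊗ A ⟶ B}
  {c : B ⟶ B ⊗ A} {i : A ⟶ E} {j : B ⟶ E} {p : E ⟶ A} {q : E ⟶ B}

theorem act_eq_act (h : IsCrossProd b c i j p q) {a a' : X ⊗ E ⟶ X}
    (ha : a ▷ E ≫ a = (α_ X E E).hom ≫ X ◁ μ[E] ≫ a)
    (ha' : a' ▷ E ≫ a' = (α_ X E E).hom ≫ X ◁ μ[E] ≫ a') (hi : X ◁ i ≫ a = X ◁ i ≫ a')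
    (hj : X ◁ j ≫ a = X ◁ j ≫ a') : a = a' :=
  h.act_ext (by rw [act_split ha, act_split ha', hi, hj])

theorem coact_eq_coact (h : IsCrossProd b c i j p q) {d d' : X ⟶ X ⊗ E}
    (hd : d ≫ X ◁ Δ[E] = d ≫ d ▷ E ≫ (α_ X E E).hom)
    (hd' : d' ≫ X ◁ Δ[E] = d' ≫ d' ▷ E ≫ (α_ X E E).hom) (hp : d ≫ X ◁ p = d' ≫ X ◁ p)
    (hq : d ≫ X ◁ q = d' ≫ X ◁ q) : d = d' :=
  h.coact_ext (by rw [coact_split hd, coact_split hd', hp, hq])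

theorem i_counit (h : IsCrossProd b c i j p q) : i ≫ ε[E] = ε[A] := by
  rw [← h.p_counit, reassoc_of% h.i_p]

theorem j_counit (h : IsCrossProd b c i j p q) : j ≫ ε[E] = ε[B] := by
  rw [← h.q_counit, reassoc_of% h.j_q]

theorem one_p (h : IsCrossProd b c i j p q) : η[E] ≫ p = η[A] := by
  rw [← h.one_i, Category.assoc, h.i_p, Category.comp_id]

theorem one_q (h : IsCrossProd b c i j p q) : η[E] ≫ q = η[B] := by
  rw [← h.one_j, Category.assoc, h.j_q, Category.comp_id]

section Raw

variable {Y : 𝒞} {a : X ⊗ E ⟶ X} {a' : Y ⊗ E ⟶ Y} {d : X ⟶ X ⊗ E} {d' : Y ⟶ Y ⊗ E}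
  {xA : X ⊗ A ⟶ X} {xB : X ⊗ B ⟶ X} {yA : Y ⊗ A ⟶ Y} {yB : Y ⊗ B ⟶ Y}
  {cA : X ⟶ X ⊗ A} {cB : X ⟶ X ⊗ B} {dA : Y ⟶ Y ⊗ A} {dB : Y ⟶ Y ⊗ B}

/-- An action of `E` is determined by its restrictions along `i` and `j`. The two required here are
the diagonal actions of the iterated construction. -/
theorem eq_tensorAct (h : IsCrossProd b c i j p q)
    (ha : a ▷ E ≫ a = (α_ X E E).hom ≫ X ◁ μ[E] ≫ a)
    (ha' : a' ▷ E ≫ a' = (α_ Y E E).hom ≫ Y ◁ μ[E] ≫ a')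
    (hxA : X ◁ i ≫ a = xA) (hxB : X ◁ j ≫ a = xB) (hyA : Y ◁ i ≫ a' = yA)
    (hyB : Y ◁ j ≫ a' = yB) {t : (X ⊗ Y) ⊗ E ⟶ X ⊗ Y}
    (ht : t ▷ E ≫ t = (α_ (X ⊗ Y) E E).hom ≫ (X ⊗ Y) ◁ μ[E] ≫ t)
    (hi : (X ⊗ Y) ◁ i ≫ t = tensorAct xA yA)
    (hj : (X ⊗ Y) ◁ j ≫ t = (α_ X Y B).hom ≫ X ◁ psi₂ yA yB c Δ[B] ≫ (α_ X B Y).inv ≫ xB ▷ Y) :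
    t = tensorAct a a' := by
  refine h.act_eq_act ht (tensorAct_mul _ _ ha ha') ?_ ?_
  · rw [hi, h.tensorAct_i, hxA, hyA]
  · rw [hj, h.tensorAct_j _ ha', hxB, hyA, hyB]

theorem eq_tensorCoact (h : IsCrossProd b c i j p q)
    (hd : d ≫ X ◁ Δ[E] = d ≫ d ▷ E ≫ (α_ X E E).hom)
    (hd' : d' ≫ Y ◁ Δ[E] = d' ≫ d' ▷ E ≫ (α_ Y E E).hom)
    (hcA : d ≫ X ◁ p = cA) (hcB : d ≫ X ◁ q = cB) (hdA : d' ≫ Y ◁ p = dA)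
    (hdB : d' ≫ Y ◁ q = dB) {t : X ⊗ Y ⟶ (X ⊗ Y) ⊗ E}
    (ht : t ≫ (X ⊗ Y) ◁ Δ[E] = t ≫ t ▷ E ≫ (α_ (X ⊗ Y) E E).hom)
    (hp : t ≫ (X ⊗ Y) ◁ p = tensorCoact cA dA)
    (hq : t ≫ (X ⊗ Y) ◁ q = cB ▷ Y ≫ (α_ X B Y).hom ≫ X ◁ psi₂ b μ[B] dA dB ≫ (α_ X Y B).inv) :
    t = tensorCoact d d' := by
  refine h.coact_eq_coact ht (tensorCoact_coassoc _ _ hd hd') ?_ ?_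
  · rw [hp, h.tensorCoact_p, hcA, hdA]
  · rw [hq, h.tensorCoact_q _ hd', hcB, hdA, hdB]

/-- Inserting `𝟙 E = Δ[E] ≫ (p ⊗ₘ q) ≫ i ⋆ j` between the coaction and the action splits both. -/
theorem psi_eq (h : IsCrossProd b c i j p q)
    (ha : a ▷ E ≫ a = (α_ X E E).hom ≫ X ◁ μ[E] ≫ a)
    (hd' : d' ≫ Y ◁ Δ[E] = d' ≫ d' ▷ E ≫ (α_ Y E E).hom)
    (hxA : X ◁ i ≫ a = xA) (hxB : X ◁ j ≫ a = xB) (hdA : d' ≫ Y ◁ p = dA)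
    (hdB : d' ≫ Y ◁ q = dB) : psi a d' = psi₂ xA xB dA dB := by
  have h₁ := psi_comp_left a d' (d' ≫ Y ◁ (Δ[E] ≫ (p ⊗ₘ q))) (𝟙 Y) (i ⋆ j) (by
    rw [id_tensorHom, Category.assoc, ← whiskerLeft_comp, Category.assoc, h.split]; simp)
  rw [whiskerLeft_id, Category.id_comp, id_whiskerRight, Category.comp_id, act_split ha,
    coact_split hd', psi_eq_psi₂, hxA, hxB, hdA, hdB] at h₁
  exact h₁

theorem act_hom (h : IsCrossProd b c i j p q)
    (ha : a ▷ E ≫ a = (α_ X E E).hom ≫ X ◁ μ[E] ≫ a)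
    (ha' : a' ▷ E ≫ a' = (α_ Y E E).hom ≫ Y ◁ μ[E] ≫ a')
    (hxA : X ◁ i ≫ a = xA) (hxB : X ◁ j ≫ a = xB) (hyA : Y ◁ i ≫ a' = yA)
    (hyB : Y ◁ j ≫ a' = yB) {f : X ⟶ Y} (hA : xA ≫ f = f ▷ A ≫ yA) (hB : xB ≫ f = f ▷ B ≫ yB) :
    a ≫ f = f ▷ E ≫ a' := by
  apply h.act_ext
  rw [whisker_exchange_assoc, act_split ha', ← Category.assoc, act_split ha, hxA, hxB, hyA, hyB]
  simp only [Category.assoc]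
  rw [hB, ← comp_whiskerRight_assoc, hA]
  simp

theorem coact_hom (h : IsCrossProd b c i j p q)
    (hd : d ≫ X ◁ Δ[E] = d ≫ d ▷ E ≫ (α_ X E E).hom)
    (hd' : d' ≫ Y ◁ Δ[E] = d' ≫ d' ▷ E ≫ (α_ Y E E).hom)
    (hcA : d ≫ X ◁ p = cA) (hcB : d ≫ X ◁ q = cB) (hdA : d' ≫ Y ◁ p = dA)
    (hdB : d' ≫ Y ◁ q = dB) {f : X ⟶ Y} (hA : cA ≫ f ▷ A = f ≫ dA) (hB : cB ≫ f ▷ B = f ≫ dB) :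
    d ≫ f ▷ E = f ≫ d' := by
  apply h.coact_ext
  rw [Category.assoc, ← whisker_exchange, ← Category.assoc, coact_split hd, Category.assoc f,
    coact_split hd', hcA, hcB, hdA, hdB, ← reassoc_of% hB]
  rw [← comp_whiskerRight_assoc, ← hA]
  simp

end Raw

end Ext

variable [HopfObj A] [IsIso 𝒮[A]] {B : CrossedMod A} [HopfObj B] [HopfObj E] {i : A ⟶ E} {j : B.X ⟶ E} {p : E ⟶ A} {q : E ⟶ B.X}

theorem toTotal_hom_act (h : IsCrossProd B.act B.coact i j p q) {M N : CrossedMod B} (f : M ⟶ N) :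
    (h.toTotal M).act ≫ f.hom.hom = f.hom.hom ▷ E ≫ (h.toTotal N).act :=
  h.act_hom (h.toTotal M).act_mul (h.toTotal N).act_mul (h.i_act M) (h.j_act M) (h.i_act N)
    (h.j_act N) f.hom.act_hom (congrArg CrossedMod.Hom.hom f.act_hom)

theorem toTotal_hom_coact (h : IsCrossProd B.act B.coact i j p q) {M N : CrossedMod B}
    (f : M ⟶ N) : (h.toTotal M).coact ≫ f.hom.hom ▷ E = f.hom.hom ≫ (h.toTotal N).coact :=
  h.coact_hom (h.toTotal M).coact_comul (h.toTotal N).coact_comul (h.p_coact M) (h.q_coact M)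
    (h.p_coact N) (h.q_coact N) f.hom.coact_hom (congrArg CrossedMod.Hom.hom f.coact_hom)

/-- A morphism of crossed modules over `B` in the category of crossed modules over `A`, given by a
morphism that is compatible with the action and the coaction of the cross product. -/
def mkHom (h : IsCrossProd B.act B.coact i j p q) {M N : CrossedMod B} (f : M.X.X ⟶ N.X.X)
    (h₁ : (h.toTotal M).act ≫ f = f ▷ E ≫ (h.toTotal N).act)
    (h₂ : (h.toTotal M).coact ≫ f ▷ E = f ≫ (h.toTotal N).coact) : M ⟶ N where
  hom := ⟨f, act_hom_restrict h₁ (h.i_act M) (h.i_act N),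
    coact_hom_restrict h₂ (h.p_coact M) (h.p_coact N)⟩
  act_hom := CrossedMod.hom_ext (act_hom_restrict h₁ (h.j_act M) (h.j_act N))
  coact_hom := CrossedMod.hom_ext (coact_hom_restrict h₂ (h.q_coact M) (h.q_coact N))

theorem toTotal_unit_act (h : IsCrossProd B.act B.coact i j p q) :
    (h.toTotal (𝟙_ (CrossedMod B))).act = (𝟙_ (CrossedMod E)).act := by
  refine h.act_eq_act (h.toTotal (𝟙_ _)).act_mul (𝟙_ (CrossedMod E)).act_mul ?_ ?_
  · refine (h.i_act (𝟙_ _)).trans ?_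
    change unitAct A = 𝟙_ 𝒞 ◁ i ≫ unitAct E
    rw [unitAct, unitAct, leftUnitor_naturality_assoc, h.i_counit]
  · refine (h.j_act (𝟙_ _)).trans ?_
    change (λ_ B.X).hom ≫ ε[B.X] = 𝟙_ 𝒞 ◁ j ≫ unitAct E
    rw [unitAct, leftUnitor_naturality_assoc, h.j_counit]

theorem toTotal_unit_coact (h : IsCrossProd B.act B.coact i j p q) :
    (h.toTotal (𝟙_ (CrossedMod B))).coact = (𝟙_ (CrossedMod E)).coact := by
  refine h.coact_eq_coact (h.toTotal (𝟙_ _)).coact_comul (𝟙_ (CrossedMod E)).coact_comul ?_ ?_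
  · refine (h.p_coact (𝟙_ _)).trans ?_
    change unitCoact A = unitCoact E ≫ 𝟙_ 𝒞 ◁ p
    rw [unitCoact, unitCoact, Category.assoc, ← leftUnitor_inv_naturality, reassoc_of% h.one_p]
  · refine (h.q_coact (𝟙_ _)).trans ?_
    change η[B.X] ≫ (λ_ B.X).inv = unitCoact E ≫ 𝟙_ 𝒞 ◁ q
    rw [unitCoact, Category.assoc, ← leftUnitor_inv_naturality, reassoc_of% h.one_q]

theorem toTotal_tensor_act (h : IsCrossProd B.act B.coact i j p q) (M N : CrossedMod B) :
    (h.toTotal (M ⊗ N)).act = (h.toTotal M ⊗ h.toTotal N).act :=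
  h.eq_tensorAct (h.toTotal M).act_mul (h.toTotal N).act_mul (h.i_act M) (h.j_act M) (h.i_act N)
    (h.j_act N) (h.toTotal (M ⊗ N)).act_mul (h.i_act (M ⊗ N))
    ((h.j_act (M ⊗ N)).trans (congrArg CrossedMod.Hom.hom (tensorAct_eq M.act N.act)))

theorem toTotal_tensor_coact (h : IsCrossProd B.act B.coact i j p q) (M N : CrossedMod B) :
    (h.toTotal (M ⊗ N)).coact = (h.toTotal M ⊗ h.toTotal N).coact :=
  h.eq_tensorCoact (h.toTotal M).coact_comul (h.toTotal N).coact_comul (h.p_coact M) (h.q_coact M)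
    (h.p_coact N) (h.q_coact N) (h.toTotal (M ⊗ N)).coact_comul (h.p_coact (M ⊗ N))
    ((h.q_coact (M ⊗ N)).trans (congrArg CrossedMod.Hom.hom (tensorCoact_eq M.coact N.coact)))

variable [IsIso 𝒮[B]] [IsIso 𝒮[E]]

theorem toTotal_braiding (h : IsCrossProd B.act B.coact i j p q) (M N : CrossedMod B) :
    (β_ (h.toTotal M) (h.toTotal N)).hom.hom = (β_ M N).hom.hom.hom :=
  h.psi_eq (h.toTotal M).act_mul (h.toTotal N).coact_comul (h.i_act M) (h.j_act M) (h.p_coact N)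
    (h.q_coact N)

/-- `tensorμ` depends on the braiding only through its middle crossing, so `toTotal_braiding`
suffices; this is what the bialgebra axiom needs. -/
theorem toTotal_tensorμ (h : IsCrossProd B.act B.coact i j p q) (M : CrossedMod B) :
    (tensorμ (h.toTotal M) (h.toTotal M) (h.toTotal M) (h.toTotal M)).hom =
      (tensorμ M M M M).hom.hom := by
  have h₁ : (tensorμ (h.toTotal M) (h.toTotal M) (h.toTotal M) (h.toTotal M)).hom =
      interchange M.X.X M.X.X (β_ (h.toTotal M) (h.toTotal M)).hom.hom := (interchange_eq _ _ _).symm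
  have h₂ : (tensorμ M M M M).hom.hom = interchange M.X.X M.X.X (β_ M M).hom.hom.hom :=
    (interchange_eq _ _ _).symm
  exact h₁.trans ((congrArg _ (h.toTotal_braiding M M)).trans h₂.symm)

/-- The Hopf algebra over the cross product given by a Hopf algebra in the iterated category of
crossed modules. -/
@[reducible]
noncomputable def hopfObjToTotal (h : IsCrossProd B.act B.coact i j p q) (M : CrossedMod B) [HopfObj M] :
    HopfObj (h.toTotal M) where
  one := ⟨η[M].hom.hom, (congrArg (· ≫ η[M].hom.hom) h.toTotal_unit_act).symm.trans
      (h.toTotal_hom_act η[M]), (congrArg (· ≫ η[M].hom.hom ▷ E) h.toTotal_unit_coact).symm.trans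
      (h.toTotal_hom_coact η[M])⟩
  mul := ⟨μ[M].hom.hom, (congrArg (· ≫ μ[M].hom.hom) (h.toTotal_tensor_act M M)).symm.trans
      (h.toTotal_hom_act μ[M]),
      (congrArg (· ≫ μ[M].hom.hom ▷ E) (h.toTotal_tensor_coact M M)).symm.trans
      (h.toTotal_hom_coact μ[M])⟩
  counit := ⟨ε[M].hom.hom, (h.toTotal_hom_act ε[M]).trans
      (congrArg (ε[M].hom.hom ▷ E ≫ ·) h.toTotal_unit_act), (h.toTotal_hom_coact ε[M]).trans
      (congrArg (ε[M].hom.hom ≫ ·) h.toTotal_unit_coact)⟩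
  comul := ⟨Δ[M].hom.hom, (h.toTotal_hom_act Δ[M]).trans
      (congrArg (Δ[M].hom.hom ▷ E ≫ ·) (h.toTotal_tensor_act M M)),
      (h.toTotal_hom_coact Δ[M]).trans
      (congrArg (Δ[M].hom.hom ≫ ·) (h.toTotal_tensor_coact M M))⟩
  antipode := ⟨𝒮[M].hom.hom, h.toTotal_hom_act 𝒮[M], h.toTotal_hom_coact 𝒮[M]⟩
  one_mul := CrossedMod.hom_ext (congrArg (·.hom.hom) (MonObj.one_mul M))
  mul_one := CrossedMod.hom_ext (congrArg (·.hom.hom) (MonObj.mul_one M))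
  mul_assoc := CrossedMod.hom_ext (congrArg (·.hom.hom) (MonObj.mul_assoc M))
  counit_comul := CrossedMod.hom_ext (congrArg (·.hom.hom) (ComonObj.counit_comul M))
  comul_counit := CrossedMod.hom_ext (congrArg (·.hom.hom) (ComonObj.comul_counit M))
  comul_assoc := CrossedMod.hom_ext (congrArg (·.hom.hom) (ComonObj.comul_assoc M))
  mul_comul := CrossedMod.hom_ext ((congrArg (·.hom.hom) (BimonObj.mul_comul M)).trans
    (congrArg ((Δ[M].hom.hom ⊗ₘ Δ[M].hom.hom) ≫ · ≫ (μ[M].hom.hom ⊗ₘ μ[M].hom.hom))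
      (h.toTotal_tensorμ M)).symm)
  one_comul := CrossedMod.hom_ext (congrArg (·.hom.hom) (BimonObj.one_comul M))
  mul_counit := CrossedMod.hom_ext (congrArg (·.hom.hom) (BimonObj.mul_counit M))
  one_counit := CrossedMod.hom_ext (congrArg (·.hom.hom) (BimonObj.one_counit M))
  antipode_left := CrossedMod.hom_ext (congrArg (·.hom.hom) (HopfObj.antipode_left M))
  antipode_right := CrossedMod.hom_ext (congrArg (·.hom.hom) (HopfObj.antipode_right M))

/-- The Hopf algebra in the iterated category of crossed modules given by a Hopf algebra over the
cross product. -/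
@[reducible]
noncomputable def hopfObjOfToTotal (h : IsCrossProd B.act B.coact i j p q) (M : CrossedMod B)
    [HopfObj (h.toTotal M)] : HopfObj M where
  one := h.mkHom (M := 𝟙_ _) η[h.toTotal M].hom
    ((congrArg (· ≫ η[h.toTotal M].hom) h.toTotal_unit_act).trans η[h.toTotal M].act_hom)
    ((congrArg (· ≫ η[h.toTotal M].hom ▷ E) h.toTotal_unit_coact).trans η[h.toTotal M].coact_hom)
  mul := h.mkHom (M := M ⊗ M) μ[h.toTotal M].hom
    ((congrArg (· ≫ μ[h.toTotal M].hom) (h.toTotal_tensor_act M M)).trans μ[h.toTotal M].act_hom)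
    ((congrArg (· ≫ μ[h.toTotal M].hom ▷ E) (h.toTotal_tensor_coact M M)).trans
      μ[h.toTotal M].coact_hom)
  counit := h.mkHom (N := 𝟙_ _) ε[h.toTotal M].hom
    (ε[h.toTotal M].act_hom.trans
      (congrArg (ε[h.toTotal M].hom ▷ E ≫ ·) h.toTotal_unit_act).symm)
    (ε[h.toTotal M].coact_hom.trans (congrArg (ε[h.toTotal M].hom ≫ ·) h.toTotal_unit_coact).symm)
  comul := h.mkHom (N := M ⊗ M) Δ[h.toTotal M].hom
    (Δ[h.toTotal M].act_hom.trans
      (congrArg (Δ[h.toTotal M].hom ▷ E ≫ ·) (h.toTotal_tensor_act M M)).symm)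
    (Δ[h.toTotal M].coact_hom.trans
      (congrArg (Δ[h.toTotal M].hom ≫ ·) (h.toTotal_tensor_coact M M)).symm)
  antipode := h.mkHom 𝒮[h.toTotal M].hom 𝒮[h.toTotal M].act_hom 𝒮[h.toTotal M].coact_hom
  one_mul := CrossedMod.hom_ext (CrossedMod.hom_ext
    (congrArg CrossedMod.Hom.hom (MonObj.one_mul (h.toTotal M)) :))
  mul_one := CrossedMod.hom_ext (CrossedMod.hom_ext
    (congrArg CrossedMod.Hom.hom (MonObj.mul_one (h.toTotal M)) :))
  mul_assoc := CrossedMod.hom_ext (CrossedMod.hom_ext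
    (congrArg CrossedMod.Hom.hom (MonObj.mul_assoc (h.toTotal M)) :))
  counit_comul := CrossedMod.hom_ext (CrossedMod.hom_ext
    (congrArg CrossedMod.Hom.hom (ComonObj.counit_comul (h.toTotal M)) :))
  comul_counit := CrossedMod.hom_ext (CrossedMod.hom_ext
    (congrArg CrossedMod.Hom.hom (ComonObj.comul_counit (h.toTotal M)) :))
  comul_assoc := CrossedMod.hom_ext (CrossedMod.hom_ext
    (congrArg CrossedMod.Hom.hom (ComonObj.comul_assoc (h.toTotal M)) :))
  mul_comul := CrossedMod.hom_ext (CrossedMod.hom_ext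
    ((congrArg CrossedMod.Hom.hom (BimonObj.mul_comul (h.toTotal M))).trans
      (congrArg ((Δ[h.toTotal M].hom ⊗ₘ Δ[h.toTotal M].hom) ≫ · ≫
        (μ[h.toTotal M].hom ⊗ₘ μ[h.toTotal M].hom)) (h.toTotal_tensorμ M))))
  one_comul := CrossedMod.hom_ext (CrossedMod.hom_ext
    (congrArg CrossedMod.Hom.hom (BimonObj.one_comul (h.toTotal M)) :))
  mul_counit := CrossedMod.hom_ext (CrossedMod.hom_ext
    (congrArg CrossedMod.Hom.hom (BimonObj.mul_counit (h.toTotal M)) :))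
  one_counit := CrossedMod.hom_ext (CrossedMod.hom_ext
    (congrArg CrossedMod.Hom.hom (BimonObj.one_counit (h.toTotal M)) :))
  antipode_left := CrossedMod.hom_ext (CrossedMod.hom_ext
    (congrArg CrossedMod.Hom.hom (HopfObj.antipode_left (h.toTotal M)) :))
  antipode_right := CrossedMod.hom_ext (CrossedMod.hom_ext
    (congrArg CrossedMod.Hom.hom (HopfObj.antipode_right (h.toTotal M)) :))

end IsCrossProd

end Transfer

/-! ### Hopf algebras over a cross product -/

section Same

variable {𝒞 : Type u} [Category.{v} 𝒞] [MonoidalCategory 𝒞]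

theorem whiskerLeft_id_comp {X Y Z : 𝒞} (f : X ⊗ Y ⟶ Z) : X ◁ 𝟙 Y ≫ f = f := by simp

theorem comp_whiskerLeft_id {X Y Z : 𝒞} (f : Z ⟶ X ⊗ Y) : f ≫ X ◁ 𝟙 Y = f := by simp

theorem HopfMaps.transport_eqToIso_rfl {X : 𝒞} (m : HopfMaps X) (e : X = X) :
    m.transport (eqToIso e) = m := by
  ext <;> simp [HopfMaps.transport]

variable [BraidedCategory 𝒞]

attribute [local instance] CrossedMod.monObjX CrossedMod.comonObjX

theorem HopfMaps.forget_injective {H : 𝒞} [BimonObj H] {M : CrossedMod H} :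
    Function.Injective (HopfMaps.forget (M := M)) := by
  intro m n h
  exact HopfMaps.ext (CrossedMod.hom_ext (congrArg HopfMaps.one h))
    (CrossedMod.hom_ext (congrArg HopfMaps.mul h)) (CrossedMod.hom_ext (congrArg HopfMaps.counit h))
    (CrossedMod.hom_ext (congrArg HopfMaps.comul h))
    (CrossedMod.hom_ext (congrArg HopfMaps.antipode h))

theorem HopfAlg.ext_of_eq {C D : HopfAlg 𝒞} (e : C.X = D.X)
    (h : (hopfMaps C.hopf).transport (eqToIso e) = hopfMaps D.hopf) : C = D := by
  obtain @⟨X, hX, iX⟩ := C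
  obtain @⟨Y, hY, iY⟩ := D
  have e' : X = Y := e
  subst e'
  obtain rfl : hX = hY :=
    hopfMaps_injective ((HopfMaps.transport_eqToIso_rfl (hopfMaps hX) rfl).symm.trans h)
  rfl

variable {A : HopfAlg 𝒞} {B : HopfAlg (CrossedMod A.X)}

namespace CrossProduct

theorem inl_mulHom_inr (P : CrossProduct A B) :
    mulHom (M := P.hopfAlg.X) (inl A.X B.X.X) (inr A.X B.X.X) = 𝟙 (A.X ⊗ B.X.X) :=
  (congrArg (fun m => (inl A.X B.X.X ⊗ₘ inr A.X B.X.X) ≫ m.mul) P.maps_eq).trans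
    B.X.isCrossedBimon.isDistributive.inl_inr

theorem comul_fst_snd (P : CrossProduct A B) :
    Δ[P.hopfAlg.X] ≫ (fst A.X B.X.X ⊗ₘ snd A.X B.X.X) = 𝟙 (A.X ⊗ B.X.X) :=
  (congrArg (fun m => m.comul ≫ (fst A.X B.X.X ⊗ₘ snd A.X B.X.X)) P.maps_eq).trans
    B.X.isCrossedBimon.isCodistributive.fst_snd

/-- For the cross product on `A ⊗ B` the section is the identity, so the general construction gives
the prescribed action on the nose. -/
theorem toTotal_act (P : CrossProduct A B) (M : CrossedMod B.X) :
    (P.isCrossProd.toTotal M).act = totalAct M :=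
  (congrArg (fun s => M.X.X ◁ s ≫ totalAct M) P.comul_fst_snd).trans
    (whiskerLeft_id_comp _)

theorem toTotal_coact (P : CrossProduct A B) (M : CrossedMod B.X) :
    (P.isCrossProd.toTotal M).coact = totalCoact M :=
  (congrArg (fun s => totalCoact M ≫ M.X.X ◁ s) P.inl_mulHom_inr).trans
    (comp_whiskerLeft_id _)

/-- The Hopf algebra over `A ⋉ B` that is the same as `C`. -/
noncomputable def total (P : CrossProduct A B) (C : HopfAlg (CrossedMod B.X)) :
    HopfAlg (CrossedMod P.hopfAlg.X) :=
  have : IsIso (P.isCrossProd.hopfObjToTotal C.X).antipode := by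
    have : IsIso (P.isCrossProd.hopfObjToTotal C.X).antipode.hom :=
      have := isIso_hom 𝒮[C.X]
      isIso_hom 𝒮[C.X].hom
    exact isIso_of_hom _
  @HopfAlg.mk _ _ _ _ (P.isCrossProd.toTotal C.X) (P.isCrossProd.hopfObjToTotal C.X) this

theorem sameHopf_total (P : CrossProduct A B) (C : HopfAlg (CrossedMod B.X)) :
    SameHopf P (P.total C) C where
  obj_eq := rfl
  act_eq := comp_id_eq_id_whiskerRight_comp (P.toTotal_act C.X)
  coact_eq := comp_id_whiskerRight_eq_id_comp (P.toTotal_coact C.X)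
  maps_eq := HopfMaps.transport_eqToIso_rfl (hopfMaps C.hopf).forget.forget rfl

end CrossProduct

variable {P : CrossProduct A B} {C' : HopfAlg (CrossedMod P.hopfAlg.X)}
  {C : HopfAlg (CrossedMod B.X)}

theorem SameHopf.toTotal_eq (h : SameHopf P C' C) : C'.X = P.isCrossProd.toTotal C.X :=
  CrossedMod.ext_of_eq h.obj_eq
    (h.act_eq.trans (congrArg (eqToHom h.obj_eq ▷ (A.X ⊗ B.X.X) ≫ ·) (P.toTotal_act C.X).symm))
    (h.coact_eq.trans (congrArg (eqToHom h.obj_eq ≫ ·) (P.toTotal_coact C.X).symm))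

/-- The crossed module is forced by its action and coaction, and the Hopf structure by its five
morphisms in `𝒞`, since forgetting is faithful. -/
theorem SameHopf.eq_total (h : SameHopf P C' C) : C' = P.total C := by
  have e := h.toTotal_eq
  obtain @⟨N, hN, iN⟩ := C'
  obtain rfl : N = P.isCrossProd.toTotal C.X := e
  refine HopfAlg.ext_of_eq rfl ((HopfMaps.transport_eqToIso_rfl _ rfl).trans ?_)
  exact HopfMaps.forget_injective
    ((HopfMaps.transport_eqToIso_rfl (hopfMaps hN).forget h.obj_eq).symm.trans h.maps_eq)

theorem exists_sameHopf (C' : HopfAlg (CrossedMod P.hopfAlg.X)) :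
    ∃ C : HopfAlg (CrossedMod B.X), SameHopf P C' C := by
  obtain @⟨N, hN, iN⟩ := C'
  -- Every crossed module over `A ⋉ B` is of the form `toTotal M`, so the Hopf structure can be
  -- carried over without changing its morphisms.
  obtain ⟨M, rfl⟩ : ∃ M, P.isCrossProd.toTotal M = N := ⟨_, P.isCrossProd.toTotal_ofTotal N⟩
  -- Invertibility passes down to `𝒞` and is then lifted twice, as an inverse in `𝒞` is
  -- automatically linear and colinear.
  have : IsIso (P.isCrossProd.hopfObjOfToTotal M).antipode := by
    have : IsIso (P.isCrossProd.hopfObjOfToTotal M).antipode.hom.hom :=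
      isIso_hom hN.antipode
    have : IsIso (P.isCrossProd.hopfObjOfToTotal M).antipode.hom := isIso_of_hom _
    exact isIso_of_hom _
  exact ⟨@HopfAlg.mk _ _ _ _ M (P.isCrossProd.hopfObjOfToTotal M) this, rfl,
    comp_id_eq_id_whiskerRight_comp (P.toTotal_act M),
    comp_id_whiskerRight_eq_id_comp (P.toTotal_coact M),
    HopfMaps.transport_eqToIso_rfl (hopfMaps hN).forget rfl⟩

theorem SameHopf.unique {D : HopfAlg (CrossedMod B.X)} (h : SameHopf P C' C)
    (h' : SameHopf P C' D) : C = D := by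
  have e : C.X = D.X := P.isCrossProd.toTotal_injective (h.toTotal_eq.symm.trans h'.toTotal_eq)
  obtain @⟨M, hM, iM⟩ := C
  obtain @⟨N, hN, iN⟩ := D
  obtain rfl : M = N := e
  refine HopfAlg.ext_of_eq rfl ((HopfMaps.transport_eqToIso_rfl _ rfl).trans ?_)
  exact HopfMaps.forget_injective (HopfMaps.forget_injective (h.maps_eq.symm.trans h'.maps_eq))

end Same

/-! ### Associativity of the cross product -/

section Assoc

variable {𝒞 : Type u} [Category.{v} 𝒞] [MonoidalCategory 𝒞] {A B C : 𝒞}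

theorem one_assoc {u : 𝟙_ 𝒞 ⟶ A} {v : 𝟙_ 𝒞 ⟶ B} {w : 𝟙_ 𝒞 ⟶ C} {uv : 𝟙_ 𝒞 ⟶ A ⊗ B}
    {vw : 𝟙_ 𝒞 ⟶ B ⊗ C} (h : uv = (λ_ (𝟙_ 𝒞)).inv ≫ (u ⊗ₘ v))
    (h' : vw = (λ_ (𝟙_ 𝒞)).inv ≫ (v ⊗ₘ w)) :
    ((λ_ (𝟙_ 𝒞)).inv ≫ (uv ⊗ₘ w)) ≫ (α_ A B C).hom = (λ_ (𝟙_ 𝒞)).inv ≫ (u ⊗ₘ vw) := by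
  rw [h, h', tensorHom_comp_left, tensorHom_comp_right, Category.assoc, Category.assoc,
    associator_naturality]
  monoidal

theorem counit_assoc {u : A ⟶ 𝟙_ 𝒞} {v : B ⟶ 𝟙_ 𝒞} {w : C ⟶ 𝟙_ 𝒞} {uv : A ⊗ B ⟶ 𝟙_ 𝒞}
    {vw : B ⊗ C ⟶ 𝟙_ 𝒞} (h : uv = (u ⊗ₘ v) ≫ (λ_ (𝟙_ 𝒞)).hom)
    (h' : vw = (v ⊗ₘ w) ≫ (λ_ (𝟙_ 𝒞)).hom) :
    (α_ A B C).hom ≫ (u ⊗ₘ vw) ≫ (λ_ (𝟙_ 𝒞)).hom = (uv ⊗ₘ w) ≫ (λ_ (𝟙_ 𝒞)).hom := by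
  subst h h'
  monoidal

theorem mul_assoc_cross {φ : B ⊗ A ⟶ A ⊗ B} {φ' : C ⊗ A ⟶ A ⊗ C} {φ'' : C ⊗ B ⟶ B ⊗ C}
    {u : A ⊗ A ⟶ A} {v : B ⊗ B ⟶ B} {w : C ⊗ C ⟶ C} {uv : (A ⊗ B) ⊗ (A ⊗ B) ⟶ A ⊗ B}
    {vw : (B ⊗ C) ⊗ (B ⊗ C) ⟶ B ⊗ C} {ψ : C ⊗ (A ⊗ B) ⟶ (A ⊗ B) ⊗ C}
    {ψ' : (B ⊗ C) ⊗ A ⟶ A ⊗ (B ⊗ C)} (h : uv = interchange A B φ ≫ (u ⊗ₘ v))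
    (h' : vw = interchange B C φ'' ≫ (v ⊗ₘ w))
    (hψ : ψ = (α_ C A B).inv ≫ φ' ▷ B ≫ (α_ A C B).hom ≫ A ◁ φ'' ≫ (α_ A B C).inv)
    (hψ' : ψ' = (α_ B C A).hom ≫ B ◁ φ' ≫ (α_ B A C).inv ≫ φ ▷ C ≫ (α_ A B C).hom) :
    (interchange (A ⊗ B) C ψ ≫ (uv ⊗ₘ w)) ≫ (α_ A B C).hom =
      ((α_ A B C).hom ⊗ₘ (α_ A B C).hom) ≫ interchange A (B ⊗ C) ψ' ≫ (u ⊗ₘ vw) := by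
  subst h h' hψ hψ'
  unfold interchange
  simp only [MonoidalCategory.tensorHom_def u, MonoidalCategory.tensorHom_def v,
    MonoidalCategory.tensorHom_def _ w]
  calc
    _ = 𝟙 _ ⊗≫ A ◁ B ◁ φ' ▷ (B ⊗ C) ⊗≫ A ◁ ((B ⊗ A) ◁ φ'' ≫ φ ▷ (B ⊗ C)) ▷ C ⊗≫
          u ▷ (B ⊗ B ⊗ C ⊗ C) ⊗≫ A ◁ v ▷ (C ⊗ C) ⊗≫ A ◁ B ◁ w := by monoidal
    _ = 𝟙 _ ⊗≫ A ◁ B ◁ φ' ▷ (B ⊗ C) ⊗≫ A ◁ φ ▷ C ▷ B ▷ C ⊗≫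
          ((A ⊗ A) ◁ B ◁ φ'' ≫ u ▷ (B ⊗ B ⊗ C)) ▷ C ⊗≫ A ◁ v ▷ (C ⊗ C) ⊗≫ A ◁ B ◁ w := by
      rw [whisker_exchange]; monoidal
    _ = _ := by rw [whisker_exchange]; monoidal

theorem comul_assoc_cross {θ : A ⊗ B ⟶ B ⊗ A} {θ' : A ⊗ C ⟶ C ⊗ A} {θ'' : B ⊗ C ⟶ C ⊗ B}
    {u : A ⟶ A ⊗ A} {v : B ⟶ B ⊗ B} {w : C ⟶ C ⊗ C} {uv : A ⊗ B ⟶ (A ⊗ B) ⊗ (A ⊗ B)}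
    {vw : B ⊗ C ⟶ (B ⊗ C) ⊗ (B ⊗ C)} {ψ : (A ⊗ B) ⊗ C ⟶ C ⊗ (A ⊗ B)}
    {ψ' : A ⊗ (B ⊗ C) ⟶ (B ⊗ C) ⊗ A} (h : uv = (u ⊗ₘ v) ≫ interchange A B θ)
    (h' : vw = (v ⊗ₘ w) ≫ interchange B C θ'')
    (hψ : ψ = (α_ A B C).hom ≫ A ◁ θ'' ≫ (α_ A C B).inv ≫ θ' ▷ B ≫ (α_ C A B).hom)
    (hψ' : ψ' = (α_ A B C).inv ≫ θ ▷ C ≫ (α_ B A C).hom ≫ B ◁ θ' ≫ (α_ B C A).inv) :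
    (α_ A B C).hom ≫ (u ⊗ₘ vw) ≫ interchange A (B ⊗ C) ψ' =
      ((uv ⊗ₘ w) ≫ interchange (A ⊗ B) C ψ) ≫ ((α_ A B C).hom ⊗ₘ (α_ A B C).hom) := by
  subst h h' hψ hψ'
  unfold interchange
  symm
  simp only [MonoidalCategory.tensorHom_def' u, MonoidalCategory.tensorHom_def' v,
    MonoidalCategory.tensorHom_def' _ w]
  calc
    _ = 𝟙 _ ⊗≫ A ◁ B ◁ w ⊗≫ A ◁ v ▷ (C ⊗ C) ⊗≫ u ▷ (B ⊗ B ⊗ C ⊗ C) ⊗≫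
          A ◁ (θ ▷ (B ⊗ C) ≫ (B ⊗ A) ◁ θ'') ▷ C ⊗≫ A ◁ B ◁ θ' ▷ (B ⊗ C) ⊗≫
          𝟙 ((A ⊗ B ⊗ C) ⊗ (A ⊗ B ⊗ C)) := by monoidal
    _ = 𝟙 _ ⊗≫ A ◁ B ◁ w ⊗≫ A ◁ v ▷ (C ⊗ C) ⊗≫
          (u ▷ (B ⊗ B ⊗ C) ≫ (A ⊗ A) ◁ B ◁ θ'') ▷ C ⊗≫
          A ◁ θ ▷ C ▷ B ▷ C ⊗≫ A ◁ B ◁ θ' ▷ (B ⊗ C) ⊗≫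
          𝟙 ((A ⊗ B ⊗ C) ⊗ (A ⊗ B ⊗ C)) := by
      rw [← whisker_exchange]; monoidal
    _ = _ := by rw [← whisker_exchange]; monoidal

theorem whiskerLeftIso_eqToIso_rfl_trans {X Y Z : 𝒞} (e : Y = Y) (f : X ⊗ Y ≅ Z) :
    whiskerLeftIso X (eqToIso e) ≪≫ f = f := by
  ext; simp

theorem eq_of_whiskerLeft_comp_eq {X E : 𝒞} {s : E ⟶ E} (hs : s = 𝟙 E) {f g : X ⊗ E ⟶ E ⊗ X}
    (h : X ◁ s ≫ f = g ≫ s ▷ X) : f = g := by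
  subst hs; simpa using h

theorem eq_of_comp_whiskerLeft_eq {X E : 𝒞} {s : E ⟶ E} (hs : s = 𝟙 E) {f g : E ⊗ X ⟶ X ⊗ E}
    (h : f ≫ X ◁ s = s ▷ X ≫ g) : f = g := by
  subst hs; simpa using h

end Assoc

/-! ### Splitting the swap with a cross product -/

section Transitivity

variable {𝒞 : Type u} [Category.{v} 𝒞] [MonoidalCategory 𝒞] [BraidedCategory 𝒞]

/-- Antipodes need not be compared: a morphism of bialgebras between Hopf algebras commutes with
them. -/
theorem hopfMaps_transport {X Y : 𝒞} [HopfObj X] [HopfObj Y] (e : X ≅ Y)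
    (one : η[X] ≫ e.hom = η[Y]) (mul : μ[X] ≫ e.hom = (e.hom ⊗ₘ e.hom) ≫ μ[Y])
    (counit : e.hom ≫ ε[Y] = ε[X]) (comul : e.hom ≫ Δ[Y] = Δ[X] ≫ (e.hom ⊗ₘ e.hom)) :
    (hopfMaps ‹HopfObj X›).transport e = hopfMaps ‹HopfObj Y› := by
  have : IsBimonHom e.hom :=
    { one_hom := one, mul_hom := mul, hom_counit := counit, hom_comul := comul }
  refine HopfMaps.ext one ?_ ?_ ?_ ?_
  · change (e.inv ⊗ₘ e.inv) ≫ μ[X] ≫ e.hom = μ[Y]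
    rw [mul, tensorHom_comp_tensorHom_assoc]; simp
  · change e.inv ≫ ε[X] = ε[Y]
    rw [← counit]; simp
  · change e.inv ≫ Δ[X] ≫ (e.hom ⊗ₘ e.hom) = Δ[Y]
    rw [← comul]; simp
  · change e.inv ≫ 𝒮[X] ≫ e.hom = 𝒮[Y]
    rw [← HopfObj.hom_antipode]; simp

namespace IsCrossProd

variable {A B E X : 𝒞} [BimonObj A] [MonObj B] [ComonObj B] [BimonObj E] {b : B ⊗ A ⟶ B}
  {c : B ⟶ B ⊗ A} {i : A ⟶ E} {j : B ⟶ E} {p : E ⟶ A} {q : E ⟶ B}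

/-- The hexagon splits the swap with a product of `E` into two swaps, which `psi_i` and `psi_j`
evaluate on the factors. -/
theorem mulHom_psi (h : IsCrossProd b c i j p q) {a : X ⊗ E ⟶ X} {xA : X ⊗ A ⟶ X}
    {xB : X ⊗ B ⟶ X} (ha : a ▷ E ≫ a = (α_ X E E).hom ≫ X ◁ μ[E] ≫ a) (hA : X ◁ i ≫ a = xA)
    (hB : X ◁ j ≫ a = xB) :
    X ◁ (i ⋆ j) ≫ psi a Δ[E] = ((α_ X A B).inv ≫ psi xA Δ[A] ▷ B ≫ (α_ A X B).hom ≫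
      A ◁ psi₂ xA xB c Δ[B] ≫ (α_ A B X).inv) ≫ (i ⋆ j) ▷ X := by
  have h₁ := h.psi_i a
  have h₂ := h.psi_j ha
  rw [hA] at h₁ h₂
  rw [hB] at h₂
  unfold mulHom
  rw [whiskerLeft_comp, Category.assoc,
    ← psi_naturality_right a (tensorCoact Δ[E] Δ[E]) Δ[E] μ[E] mul_coact_comul,
    psi_tensor_right _ _ _ ha]
  calc
    _ = 𝟙 _ ⊗≫ X ◁ A ◁ j ⊗≫ (X ◁ i ≫ psi a Δ[E]) ▷ E ⊗≫ E ◁ psi a Δ[E] ⊗≫ μ[E] ▷ X := by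
      rw [MonoidalCategory.tensorHom_def']; monoidal
    _ = 𝟙 _ ⊗≫ ((X ⊗ A) ◁ j ≫ psi xA Δ[A] ▷ E) ⊗≫ (i ▷ (X ⊗ E) ≫ E ◁ psi a Δ[E]) ⊗≫
          μ[E] ▷ X := by
      rw [h₁]; monoidal
    _ = 𝟙 _ ⊗≫ psi xA Δ[A] ▷ B ⊗≫ A ◁ (X ◁ j ≫ psi a Δ[E]) ⊗≫ i ▷ E ▷ X ⊗≫ μ[E] ▷ X := by
      rw [whisker_exchange, ← whisker_exchange i]; monoidal
    _ = _ := by rw [h₂, MonoidalCategory.tensorHom_def']; monoidal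

/-- Dually, the hexagon for the comultiplied strand reduces the claim to `psi_p` and `psi_q`. -/
theorem psi_comp_split (h : IsCrossProd b c i j p q) {d : X ⟶ X ⊗ E} {yA : X ⟶ X ⊗ A}
    {yB : X ⟶ X ⊗ B} (hd : d ≫ X ◁ Δ[E] = d ≫ d ▷ E ≫ (α_ X E E).hom) (hA : d ≫ X ◁ p = yA)
    (hB : d ≫ X ◁ q = yB) :
    psi μ[E] d ≫ X ◁ (Δ[E] ≫ (p ⊗ₘ q)) = (Δ[E] ≫ (p ⊗ₘ q)) ▷ X ≫ (α_ A B X).hom ≫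
      A ◁ psi₂ b μ[B] yA yB ≫ (α_ A X B).inv ≫ psi μ[A] yA ▷ B ≫ (α_ X A B).hom := by
  have h₁ := h.psi_p d
  have h₂ := h.psi_q hd
  rw [hA] at h₁ h₂
  rw [hB] at h₂
  rw [whiskerLeft_comp, ← Category.assoc,
    psi_naturality_left μ[E] (tensorAct μ[E] μ[E]) d Δ[E] comul_act_mul,
    psi_tensor_left _ _ _ hd]
  symm
  calc
    _ = 𝟙 _ ⊗≫ Δ[E] ▷ X ⊗≫ (p ▷ (E ⊗ X)) ⊗≫ A ◁ (q ▷ X ≫ psi₂ b μ[B] yA yB) ⊗≫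
          psi μ[A] yA ▷ B ⊗≫ 𝟙 _ := by
      rw [MonoidalCategory.tensorHom_def]; monoidal
    _ = 𝟙 _ ⊗≫ Δ[E] ▷ X ⊗≫ (p ▷ (E ⊗ X) ≫ A ◁ psi μ[E] d) ⊗≫
          ((A ⊗ X) ◁ q ≫ psi μ[A] yA ▷ B) ⊗≫ 𝟙 _ := by
      rw [← h₂]; monoidal
    _ = 𝟙 _ ⊗≫ Δ[E] ▷ X ⊗≫ E ◁ psi μ[E] d ⊗≫ (p ▷ X ≫ psi μ[A] yA) ▷ E ⊗≫ X ◁ A ◁ q ⊗≫ 𝟙 _ := by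
      rw [← whisker_exchange, whisker_exchange (psi μ[A] yA)]; monoidal
    _ = _ := by rw [← h₁, MonoidalCategory.tensorHom_def]; monoidal

end IsCrossProd

end Transitivity

/-! ### Transitivity of the cross product -/

section Main

variable {𝒞 : Type u} [Category.{v} 𝒞] [MonoidalCategory 𝒞] [BraidedCategory 𝒞] {A : HopfAlg 𝒞}
  {B : HopfAlg (CrossedMod A.X)}

attribute [local instance] CrossedMod.monObjX CrossedMod.comonObjX

theorem CrossProduct.psi_total_act (P : CrossProduct A B) (C : HopfAlg (CrossedMod B.X)) :
    psi (P.total C).X.act Δ[P.hopfAlg.X] = (α_ C.X.X.X A.X B.X.X).inv ≫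
      psi C.X.X.act Δ[A.X] ▷ B.X.X ≫ (α_ A.X C.X.X.X B.X.X).hom ≫
        A.X ◁ psi₂ C.X.X.act C.X.act.hom B.X.coact Δ[B.X].hom ≫ (α_ A.X B.X.X C.X.X.X).inv :=
  eq_of_whiskerLeft_comp_eq P.inl_mulHom_inr (P.isCrossProd.mulHom_psi (P.isCrossProd.toTotal C.X).act_mul
    (P.isCrossProd.i_act C.X) (P.isCrossProd.j_act C.X))

theorem CrossProduct.psi_total_coact (P : CrossProduct A B) (C : HopfAlg (CrossedMod B.X)) :
    psi μ[P.hopfAlg.X] (P.total C).X.coact = (α_ A.X B.X.X C.X.X.X).hom ≫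
      A.X ◁ psi₂ B.X.act μ[B.X].hom C.X.X.coact C.X.coact.hom ≫ (α_ A.X C.X.X.X B.X.X).inv ≫
        psi μ[A.X] C.X.X.coact ▷ B.X.X ≫ (α_ C.X.X.X A.X B.X.X).hom :=
  eq_of_comp_whiskerLeft_eq P.comul_fst_snd (P.isCrossProd.psi_comp_split
    (P.isCrossProd.toTotal C.X).coact_comul (P.isCrossProd.p_coact C.X)
    (P.isCrossProd.q_coact C.X))

/-- The two decompositions demanded by `mul_assoc_cross` are `psi_total_act`, for `C` against `A ⋉
B`, and the hexagon, for `B ⊗ C` with its diagonal action against `A`. The comultiplication is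
treated dually. -/
theorem CrossProduct.transport_hopfMaps (P : CrossProduct A B) (C : HopfAlg (CrossedMod B.X))
    (R : CrossProduct P.hopfAlg (P.total C)) (Q : CrossProduct B C)
    (T : CrossProduct A Q.hopfAlg) :
    (hopfMaps R.hopf).transport (α_ A.X B.X.X C.X.X.X) = hopfMaps T.hopf := by
  refine @hopfMaps_transport 𝒞 _ _ _ _ _ R.hopf T.hopf (α_ A.X B.X.X C.X.X.X) ?_ ?_ ?_ ?_
  · refine (congrArg (·.one ≫ (α_ A.X B.X.X C.X.X.X).hom) R.maps_eq).trans
      (Eq.trans ?_ (congrArg HopfMaps.one T.maps_eq).symm)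
    exact one_assoc (congrArg HopfMaps.one P.maps_eq) (congrArg (·.one.hom) Q.maps_eq)
  · refine (congrArg (·.mul ≫ (α_ A.X B.X.X C.X.X.X).hom) R.maps_eq).trans (Eq.trans ?_
      (congrArg (((α_ A.X B.X.X C.X.X.X).hom ⊗ₘ (α_ A.X B.X.X C.X.X.X).hom) ≫ ·.mul)
        T.maps_eq).symm)
    exact mul_assoc_cross (congrArg HopfMaps.mul P.maps_eq) (congrArg (·.mul.hom) Q.maps_eq)
      (P.psi_total_act C) (psi_tensor_left _ _ _ (ComonObj.comul_assoc A.X))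
  · refine (congrArg ((α_ A.X B.X.X C.X.X.X).hom ≫ ·.counit) T.maps_eq).trans
      (Eq.trans ?_ (congrArg HopfMaps.counit R.maps_eq).symm)
    exact counit_assoc (congrArg HopfMaps.counit P.maps_eq) (congrArg (·.counit.hom) Q.maps_eq)
  · refine (congrArg ((α_ A.X B.X.X C.X.X.X).hom ≫ ·.comul) T.maps_eq).trans (Eq.trans ?_
      (congrArg (·.comul ≫ ((α_ A.X B.X.X C.X.X.X).hom ⊗ₘ (α_ A.X B.X.X C.X.X.X).hom))
        R.maps_eq).symm)
    exact comul_assoc_cross (congrArg HopfMaps.comul P.maps_eq) (congrArg (·.comul.hom) Q.maps_eq)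
      (P.psi_total_coact C) (psi_tensor_right _ _ _ (MonObj.mul_assoc A.X))

end Main

end CrossProd

theorem mainTheorem8 {𝒞 : Type u} [Category.{v} 𝒞] [MonoidalCategory 𝒞] [BraidedCategory 𝒞]
    (A : CrossProd.HopfAlg 𝒞) (B : CrossProd.HopfAlg (CrossProd.CrossedMod A.X)) :
    ∃ P : CrossProd.CrossProduct A B,
      (∀ C : CrossProd.HopfAlg (CrossProd.CrossedMod B.X),
        ∃! C' : CrossProd.HopfAlg (CrossProd.CrossedMod P.hopfAlg.X),
          CrossProd.SameHopf P C' C) ∧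
      (∀ C' : CrossProd.HopfAlg (CrossProd.CrossedMod P.hopfAlg.X),
        ∃! C : CrossProd.HopfAlg (CrossProd.CrossedMod B.X), CrossProd.SameHopf P C' C) ∧
      ∀ (C' : CrossProd.HopfAlg (CrossProd.CrossedMod P.hopfAlg.X))
        (C : CrossProd.HopfAlg (CrossProd.CrossedMod B.X)) (h : CrossProd.SameHopf P C' C),
        ∃ (R : CrossProd.CrossProduct P.hopfAlg C') (Q : CrossProd.CrossProduct B C)
          (T : CrossProd.CrossProduct A Q.hopfAlg),
          (CrossProd.hopfMaps R.hopf).transport h.assoc = CrossProd.hopfMaps T.hopf := by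
  obtain ⟨P⟩ := CrossProd.nonempty_crossProduct A B
  refine ⟨P, fun C => ⟨P.total C, P.sameHopf_total C, fun D hD => hD.eq_total⟩, fun C' => ?_,
    fun C' C h => ?_⟩
  · obtain ⟨C, hC⟩ := CrossProd.exists_sameHopf C'
    exact ⟨C, hC, fun D hD => hD.unique hC⟩
  · obtain rfl := h.eq_total
    obtain ⟨R⟩ := CrossProd.nonempty_crossProduct P.hopfAlg (P.total C)
    obtain ⟨Q⟩ := CrossProd.nonempty_crossProduct B C
    obtain ⟨T⟩ := CrossProd.nonempty_crossProduct A Q.hopfAlg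
    exact ⟨R, Q, T, (congrArg (CrossProd.hopfMaps R.hopf).transport
      (CrossProd.whiskerLeftIso_eqToIso_rfl_trans h.obj_eq _)).trans
      (P.transport_hopfMaps C R Q T)⟩
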